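/- **Lemma A.1.** Let $a_0\ge 0$ and let $a:(0,\infty)\to\mathbb R$ be locally integrable on $[0,\infty)$ and essentially bounded on $(1,\infty)$. Let $\tilde a(s)=\int_0^\infty e^{-st}a(t)\,dt$, $\operatorname{Re}s>0$, be its Laplace transform. For $\lambda\ge 0$ let $z=z(\lambda,\cdot):[0,\infty)\to\mathbb R$ be a solution, continuous on $[0,\infty)$ and differentiable on $(0,\infty)$, of $$z'(t)+\lambda\Bigl(a_0z(t)+\int_0^t a(t-s)z(s)\,ds\Bigr)=0\quad(t>0),\qquad z(0)=1 .$$ 1. If for every $\omega\in\mathbb R$ the limit $\lim_{h\downarrow 0}\bigl(a_0+\operatorname{Re}\tilde a(i\omega+h)\bigr)$ exists in $[-\infty,\infty]$ and is $\ge 0$, then $|z(t)|\le 1$ for all $t\ge 0$ and all $\lambda\ge 0$. 2. Assume that $a_0$ and $a$ do not both vanish (i.e. not both $a_0=0$ and $a=0$ almost everywhere), and that for some $\alpha>0$ the function $\tilde a$ extends to a bounded continuous function on $\{s\in\mathbb C:\operatorname{Re}s\ge-\alpha\}$, again denoted $\tilde a$, that is holomorphic in $\{\operatorname{Re}s>-\alpha\}$.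 Assume further that either $a_0>0$ and $\inf_{\omega\in\mathbb R}\bigl(a_0+\operatorname{Re}\tilde a(i\omega)\bigr)>0$, or $\operatorname{Re}\tilde a(-\alpha+i\omega)\ge 0$ for all $\omega\in\mathbb R$. Then there is a constant $\varepsilon>0$, independent of $\lambda$ and $t$, such that for all $\lambda\ge 0$ and all $t\ge 0$ $$|z(t)|\le 2e^{-\varepsilon\min(\lambda,1)\,t}.$$ -/

import Mathlib

open MeasureTheory Set Filter Topology

/-- The Laplace transform `∫₀^∞ e^{-st} a(t) dt` of a real kernel `a`; for the kernels considered
here the integral converges absolutely for `0 < re s`, the only range in which it is used. -/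
noncomputable def laplaceTransform (a : ℝ → ℝ) (s : ℂ) : ℂ :=
  ∫ t in Ioi (0 : ℝ), Complex.exp (-(s * (t : ℂ))) * (a t : ℂ)

/-- The standing assumption on the kernel: `a` is locally integrable on `[0, ∞)` (in particular
integrable near `0`) and essentially bounded on `(1, ∞)`. -/
structure IsAdmissibleKernel (a : ℝ → ℝ) : Prop where
  locallyIntegrable : LocallyIntegrableOn a (Ici 0) volume
  essBounded : MemLp a ⊤ (volume.restrict (Ioi 1))

/-- `z : [0, ∞) → ℝ` solves `z' + μ (a₀ z + a * z) = 0`, `z 0 = 1`, where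
`(a * z)(t) = ∫₀ᵗ a (t - s) z(s) ds`. Values of `z` on the negative half-line play no role. -/
structure IsScalarSolution (a₀ : ℝ) (a : ℝ → ℝ) (μ : ℝ) (z : ℝ → ℝ) : Prop where
  continuousOn : ContinuousOn z (Ici 0)
  hasDerivAt : ∀ t : ℝ, 0 < t →
    HasDerivAt z (-(μ * (a₀ * z t + ∫ s in (0 : ℝ)..t, a (t - s) * z s))) t
  initial : z 0 = 1

/-- `F` is an extension of the Laplace transform of `a` to the closed half-plane `-α ≤ re s`:
it agrees with the Laplace transform for `0 < re s`, is holomorphic in the open half-plane, and is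
continuous and bounded on the closed half-plane. -/
structure IsLaplaceExtension (a : ℝ → ℝ) (α : ℝ) (F : ℂ → ℂ) : Prop where
  eq_laplace : ∀ s : ℂ, 0 < s.re → F s = laplaceTransform a s
  differentiableOn : DifferentiableOn ℂ F {s : ℂ | -α < s.re}
  continuousOn : ContinuousOn F {s : ℂ | -α ≤ s.re}
  bounded : ∃ M : ℝ, ∀ s : ℂ, -α ≤ s.re → ‖F s‖ ≤ M

/-! Put w(t) = e^{βt} z(t) and k(r) = e^{βr} a(r), with β ≥ 0. Testing the equation for w with w
itself gives w(T)² = 1 + 2β∫w² − 2μ(a₀∫w² + Q), where Q = ∫₀ᵀ w·(k∗w), so everything rests on lower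
bounds for Q. By Fubini, Q is the pairing of k with the autocorrelation of w on (0, T]. The even
extension of this correlation, also after damping by e^{−κ|r|} with κ ≥ 0, has a nonnegative cosine
transform: the transform is twice ∫ w·X, with X the damped cosine filter of w, and an energy
identity writes this as a sum of squares (`integral_mul_cosFilter`). Parseval's formula then
expresses a₀∫w² + Q through a₀ plus the real part of the transform of a on a vertical line. Since a
need not be integrable, the correlation is first mollified by a Gaussian, which gives decay on
vertical lines and allows the line of integration to be moved.

In part 1 (β = 0) the boundary values are only pointwise Abel limits, with no uniformity and
possibly infinite. The argument is Riemann's from the theory of trigonometric series: G(x) = a₀x² +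
∫ a(t)·2(1 − cos xt)/t² dt is continuous, and a weighted average of its symmetric second differences
is a positive mixture of Abel means. After adding ε to a₀ these second differences are positive for
arbitrarily small steps, so G is convex by a maximum principle (`second_difference_nonneg`). Its
difference quotients are the symbols of integrable kernels tending to a, and positivity passes to
the limit (`pairing_nonneg_of_abel_limit`).

In part 2, take β = ε·min(μ, 1). If a₀ + Re ã is uniformly positive on the imaginary axis, Schwarz's
lemma keeps a₀ − ε + Re ã nonnegative on the line −β. If Re ã ≥ 0 on the line −α, damping the
correlation by e^{−(α−β)|r|} carries this sign to the kernel k, and a positive a₀ pays for the term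
β∫w². If a₀ = 0, nothing controls ∫w² directly. Testing with a low-pass filter y of w then bounds
∫w² by ∫wy and ∫y·(k∗w). Both are bounded by multiples of Q, the first because a ≠ 0 makes Re ã
positive on some interval (`IsLaplaceExtension.exists_lowpass_dissipation_le`), the second because
C·w − y still correlates with w to a function of positive type
(`IsLaplaceExtension.lowpass_pairing_le`). -/

/-! ### Gaussian mollification of compactly supported functions -/

open ProbabilityTheory in
/-- Convolution of `E` with the centred Gaussian of standard deviation `τ`. -/
noncomputable def gaussMollify (E : ℝ → ℝ) (τ r : ℝ) : ℝ :=
  ∫ x, E (r + τ * x) ∂(gaussianReal 0 1)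

lemma continuous_gaussMollify {E : ℝ → ℝ} (hE : Continuous E) {M : ℝ} (hM : ∀ x, |E x| ≤ M)
    (τ : ℝ) : Continuous (gaussMollify E τ) := by
  unfold gaussMollify
  refine continuous_of_dominated (bound := fun _ => M) ?_ ?_ (integrable_const _) ?_
  · intro r; exact (by fun_prop : Continuous fun x => E (r + τ * x)).aestronglyMeasurable
  · intro r; exact ae_of_all _ fun x => by simpa using hM _
  · exact ae_of_all _ fun x => by fun_prop

lemma tendsto_gaussMollify {E : ℝ → ℝ} (hE : Continuous E) {M : ℝ} (hM : ∀ x, |E x| ≤ M)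
    (r : ℝ) : Tendsto (fun τ => gaussMollify E τ r) (𝓝[>] 0) (𝓝 (E r)) := by
  have h : Continuous fun τ => gaussMollify E τ r := by
    unfold gaussMollify
    refine continuous_of_dominated (bound := fun _ => M) ?_ ?_ (integrable_const _) ?_
    · intro τ; exact (by fun_prop : Continuous fun x => E (r + τ * x)).aestronglyMeasurable
    · intro r; exact ae_of_all _ fun x => by simpa using hM _
    · exact ae_of_all _ fun x => by fun_prop
  have h2 := h.tendsto 0
  have h3 : gaussMollify E 0 r = E r := by simp [gaussMollify]
  rw [h3] at h2
  exact h2.mono_left nhdsWithin_le_nhds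

-- E(r + τx) can be nonzero only if r ≤ T + |x|, so the factor exp(N(T + |x| − r)) ≥ 1 may be
-- inserted and integrated against the Gaussian. The bound is uniform in τ ≤ 1 and holds for every
-- rate N ≥ 0, which makes it a dominating function against exponentially growing kernels.
open ProbabilityTheory in
lemma abs_gaussMollify_le {E : ℝ → ℝ} {M T N : ℝ} (hM0 : 0 ≤ M) (hM : ∀ x, |E x| ≤ M)
    (hN : 0 ≤ N) (hT : ∀ x, T < |x| → E x = 0) {τ : ℝ} (hτ : 0 < τ) (hτ1 : τ ≤ 1) (r : ℝ) :
    |gaussMollify E τ r| ≤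
      M * (Real.exp (N * T) * ∫ x, Real.exp (N * |x|) ∂(gaussianReal 0 1)) * Real.exp (-(N * r)) := by
  have hint : Integrable (fun x => Real.exp (N * |x|)) (gaussianReal 0 1) :=
    integrable_exp_mul_abs (X := fun x => x) (integrable_exp_mul_gaussianReal N)
      (integrable_exp_mul_gaussianReal (-N))
  have : |gaussMollify E τ r| ≤
      ∫ x, M * (Real.exp (N * T) * Real.exp (-(N * r))) * Real.exp (N * |x|) ∂(gaussianReal 0 1) := by
    unfold gaussMollify
    rw [← Real.norm_eq_abs]
    refine norm_integral_le_of_norm_le (hint.const_mul _) (ae_of_all _ fun x => ?_)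
    rw [Real.norm_eq_abs, mul_assoc, ← Real.exp_add, ← Real.exp_add]
    by_cases h : T < |r + τ * x|
    · rw [hT _ h, abs_zero]; positivity
    · have h1 : r ≤ T + |x| := by
        have := le_abs_self (r + τ * x)
        have h3 : -(τ * x) ≤ |x| := by
          calc -(τ * x) ≤ |τ * x| := neg_le_abs _
            _ = τ * |x| := by rw [abs_mul, abs_of_pos hτ]
            _ ≤ 1 * |x| := by gcongr
            _ = |x| := one_mul _
        linarith
      have h2 : 0 ≤ N * (T + |x| - r) := mul_nonneg hN (by linarith)
      calc |E (r + τ * x)| ≤ M * 1 := by simpa using hM _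
        _ ≤ M * _ := by
          gcongr
          rw [Real.one_le_exp_iff]; linarith
  refine this.trans (le_of_eq ?_)
  rw [integral_const_mul]; ring

lemma hasCompactSupport_of_abs_gt {E : ℝ → ℝ} {T : ℝ} (hT : ∀ x, T < |x| → E x = 0) :
    HasCompactSupport E := by
  refine HasCompactSupport.intro (isCompact_Icc (a := -T) (b := T)) fun x hx => hT x ?_
  by_contra h
  exact hx (abs_le.1 (not_lt.1 h))

/-- Gaussian mollification is weakly consistent against kernels of exponential growth. -/
lemma tendsto_integral_mul_gaussMollify {k E : ℝ → ℝ} {T N : ℝ} (hN : 0 ≤ N)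
    (hk : IntegrableOn (fun r => Real.exp (-(N * r)) * k r) (Ioi 0))
    (hE : Continuous E) (hT : ∀ x, T < |x| → E x = 0) :
    Tendsto (fun τ => ∫ r in Ioi (0 : ℝ), k r * gaussMollify E τ r) (𝓝[>] 0)
      (𝓝 (∫ r in Ioi (0 : ℝ), k r * E r)) := by
  have hcs := hasCompactSupport_of_abs_gt hT
  obtain ⟨M, hM⟩ := hE.bounded_above_of_compact_support hcs
  have hM' : ∀ x, |E x| ≤ M := hM
  have hM0 : 0 ≤ M := (abs_nonneg _).trans (hM' 0)
  have hkm : AEStronglyMeasurable k (volume.restrict (Ioi 0)) := by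
    have h := ((by fun_prop : Continuous fun r : ℝ => Real.exp (N * r)).aestronglyMeasurable
      (μ := volume.restrict (Ioi (0 : ℝ)))).mul hk.aestronglyMeasurable
    refine h.congr (ae_of_all _ fun r => ?_)
    simp only [Pi.mul_apply]
    rw [← mul_assoc, ← Real.exp_add]; simp
  refine tendsto_integral_filter_of_dominated_convergence
    (fun r => ‖Real.exp (-(N * r)) * k r‖ *
      (M * (Real.exp (N * T) * ∫ x, Real.exp (N * |x|) ∂(ProbabilityTheory.gaussianReal 0 1))))
    ?_ ?_ (hk.norm.mul_const _) ?_
  · exact Eventually.of_forall fun τ =>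
      hkm.mul (continuous_gaussMollify hE hM' τ).aestronglyMeasurable
  · have : ∀ᶠ τ : ℝ in 𝓝[>] 0, τ ∈ Ioc (0 : ℝ) 1 := Ioc_mem_nhdsGT one_pos
    filter_upwards [this] with τ hτ
    refine ae_of_all _ fun r => ?_
    have := abs_gaussMollify_le hM0 hM' hN hT hτ.1 hτ.2 r
    rw [norm_mul, norm_mul, Real.norm_eq_abs (gaussMollify E τ r),
      Real.norm_of_nonneg (Real.exp_nonneg _)]
    refine (mul_le_mul_of_nonneg_left this (norm_nonneg (k r))).trans (le_of_eq ?_)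
    ring
  · exact ae_of_all _ fun r => (tendsto_gaussMollify hE hM' r).const_mul _

/-! ### Transforms and integrals on vertical lines -/

/-- The two-sided Laplace transform of a function with compact support. -/
noncomputable def bilateralTransform (E : ℝ → ℝ) (s : ℂ) : ℂ :=
  ∫ ρ : ℝ, Complex.exp (s * ρ) * (E ρ : ℂ)

/-- A complex Gaussian integral, evaluated by completing the square. The value does not depend on c,
so the inversion formula built on it may use whichever line makes the kernel integrable. -/
lemma integral_gaussian_vertical {τ : ℝ} (hτ : 0 < τ) (c y : ℝ) :
    ∫ ω : ℝ, Complex.exp ((τ : ℂ) ^ 2 * ((c : ℂ) + Complex.I * ω) ^ 2 / 2 +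
      ((c : ℂ) + Complex.I * ω) * y) =
      ((2 * Real.pi * (τ⁻¹ * ProbabilityTheory.gaussianPDFReal 0 1 (y / τ)) : ℝ) : ℂ) := by
  have hτ' : (τ : ℂ) ≠ 0 := by exact_mod_cast hτ.ne'
  have hre : (-(τ : ℂ) ^ 2 / 2).re < 0 := by
    have : (-(τ : ℂ) ^ 2 / 2) = ((-τ ^ 2 / 2 : ℝ) : ℂ) := by push_cast; ring
    rw [this, Complex.ofReal_re]
    have := pow_pos hτ 2
    linarith
  have h := integral_cexp_quadratic hre
    (Complex.I * ((τ : ℂ) ^ 2 * c + y)) ((τ : ℂ) ^ 2 * (c : ℂ) ^ 2 / 2 + c * y)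
  have h2 : ∀ ω : ℝ, (τ : ℂ) ^ 2 * ((c : ℂ) + Complex.I * ω) ^ 2 / 2 +
      ((c : ℂ) + Complex.I * ω) * y = -(τ : ℂ) ^ 2 / 2 * ω ^ 2 +
      Complex.I * ((τ : ℂ) ^ 2 * c + y) * ω + ((τ : ℂ) ^ 2 * (c : ℂ) ^ 2 / 2 + c * y) := by
    intro ω
    linear_combination ((τ : ℂ) ^ 2 * ω ^ 2 / 2) * Complex.I_sq
  simp_rw [h2]
  rw [h]
  have h3 : (τ : ℂ) ^ 2 * (c : ℂ) ^ 2 / 2 + c * y -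
      (Complex.I * ((τ : ℂ) ^ 2 * c + y)) ^ 2 / (4 * (-(τ : ℂ) ^ 2 / 2)) =
      ((-(y / τ) ^ 2 / 2 : ℝ) : ℂ) := by
    push_cast
    rw [mul_pow, Complex.I_sq]
    field_simp
    ring
  have h4 : (Real.pi : ℂ) / -(-(τ : ℂ) ^ 2 / 2) = ((2 * Real.pi / τ ^ 2 : ℝ) : ℂ) := by
    push_cast; field_simp
  rw [h3, h4, ← Complex.ofReal_exp]
  have h5 : (1 / 2 : ℂ) = ((1 / 2 : ℝ) : ℂ) := by push_cast; rfl
  rw [h5, ← Complex.ofReal_cpow (by positivity), ← Complex.ofReal_mul, ← Real.sqrt_eq_rpow]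
  congr 1
  rw [ProbabilityTheory.gaussianPDFReal]
  simp only [sub_zero, NNReal.coe_one, mul_one]
  rw [← mul_assoc, ← mul_assoc]
  congr 1
  rw [Real.sqrt_div (by positivity), Real.sqrt_sq hτ.le]
  have : √(2 * Real.pi) * √(2 * Real.pi) = 2 * Real.pi := Real.mul_self_sqrt (by positivity)
  have h0 : √(2 * Real.pi) ≠ 0 := by positivity
  field_simp
  nlinarith

lemma gaussMollify_eq_integral {E : ℝ → ℝ} {τ : ℝ} (hτ : 0 < τ) (r : ℝ) :
    gaussMollify E τ r =
      ∫ ρ, E ρ * (τ⁻¹ * ProbabilityTheory.gaussianPDFReal 0 1 ((ρ - r) / τ)) := by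
  unfold gaussMollify
  rw [ProbabilityTheory.integral_gaussianReal_eq_integral_smul one_ne_zero]
  have h := integral_sub_right_eq_self (μ := volume)
    (fun ρ => E (ρ + r) * (τ⁻¹ * ProbabilityTheory.gaussianPDFReal 0 1 (ρ / τ))) r
  simp only [sub_add_cancel] at h
  rw [h]
  have h2 := Measure.integral_comp_mul_left
    (fun ρ => E (ρ + r) * (τ⁻¹ * ProbabilityTheory.gaussianPDFReal 0 1 (ρ / τ))) τ
  rw [abs_of_pos (inv_pos.2 hτ), smul_eq_mul] at h2
  have h3 : ∀ x, τ * x / τ = x := fun x => by field_simp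
  simp only [h3] at h2
  have h4 := congrArg (fun y => τ * y) h2
  rw [← mul_assoc τ, mul_inv_cancel₀ hτ.ne', one_mul, ← integral_const_mul] at h4
  rw [← h4]
  refine integral_congr_ae (ae_of_all _ fun x => ?_)
  simp only [smul_eq_mul]
  rw [add_comm r]
  field_simp

/-- Representation of the pairing of a kernel with a mollified function on a vertical line. -/
lemma integral_mul_gaussMollify_eq {k E : ℝ → ℝ} {c τ T : ℝ} (hτ : 0 < τ)
    (hk : IntegrableOn (fun r => Real.exp (-(c * r)) * k r) (Ioi 0))
    (hE : Continuous E) (hT : ∀ x, T < |x| → E x = 0) :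
    ((∫ r in Ioi (0 : ℝ), k r * gaussMollify E τ r : ℝ) : ℂ) =
      (2 * Real.pi : ℂ)⁻¹ * ∫ ω : ℝ, Complex.exp ((τ : ℂ) ^ 2 * ((c : ℂ) + Complex.I * ω) ^ 2 / 2) *
        bilateralTransform E (c + Complex.I * ω) * laplaceTransform k (c + Complex.I * ω) := by
  have hcs := hasCompactSupport_of_abs_gt hT
  have hEi : Integrable (fun ρ => Real.exp (c * ρ) * E ρ) :=
    (by fun_prop : Continuous fun ρ => Real.exp (c * ρ) * E ρ).integrable_of_hasCompactSupport
      hcs.mul_left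
  let G : ℝ → ℝ × ℝ → ℂ := fun ω p =>
    Complex.exp ((τ : ℂ) ^ 2 * ((c : ℂ) + Complex.I * ω) ^ 2 / 2) *
      ((Complex.exp (-((c + Complex.I * ω) * (p.1 : ℂ))) * (k p.1 : ℂ)) *
      (Complex.exp ((c + Complex.I * ω) * (p.2 : ℂ)) * (E p.2 : ℂ)))
  have hgi : Integrable (fun ω : ℝ => Real.exp (-(τ ^ 2 / 2) * ω ^ 2)) :=
    integrable_exp_neg_mul_sq (by positivity)
  have hprod : Integrable (fun q : ℝ × (ℝ × ℝ) =>
      (((Real.exp (-(τ ^ 2 / 2) * q.1 ^ 2)) *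
        ((Real.exp (-(c * q.2.1)) * k q.2.1) * (Real.exp (c * q.2.2) * E q.2.2)) : ℝ) : ℂ))
      (volume.prod ((volume.restrict (Ioi 0)).prod volume)) :=
    (hgi.mul_prod (Integrable.mul_prod hk hEi)).ofReal
  -- In modulus G is a constant times a product of integrable functions of ω, r and ρ separately;
  -- the remaining factor is a pure phase.
  have hG : Integrable (Function.uncurry G)
      (volume.prod ((volume.restrict (Ioi 0)).prod volume)) := by
    have hb := hprod.bdd_mul (f := fun q : ℝ × (ℝ × ℝ) => Complex.exp ((τ ^ 2 * c ^ 2 / 2 : ℝ)) *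
      Complex.exp (((τ ^ 2 * c * q.1 - q.1 * q.2.1 + q.1 * q.2.2 : ℝ) : ℂ) * Complex.I))
      (c := Real.exp (τ ^ 2 * c ^ 2 / 2))
      (Continuous.aestronglyMeasurable (by fun_prop)) (ae_of_all _ fun q => by
        rw [norm_mul, Complex.norm_exp_ofReal_mul_I, mul_one, ← Complex.ofReal_exp,
          Complex.norm_of_nonneg (Real.exp_nonneg _)])
    refine hb.congr (ae_of_all _ fun q => ?_)
    simp only [Function.uncurry, G]
    push_cast
    have e : ∀ a b c' d e' f g h : ℂ, a * b * (c' * (d * f * (e' * g))) =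
      (a * b * c' * d * e') * (f * g) := by intros; ring
    have e2 : ∀ a d e' f g : ℂ, a * (d * f * (e' * g)) =
      (a * d * e') * (f * g) := by intros; ring
    rw [e _ _ _ _ _ _ _ 0, e2]
    congr 1
    simp only [← Complex.exp_add]
    congr 1
    linear_combination -((τ : ℂ) ^ 2 * q.1 ^ 2 / 2) * Complex.I_sq
  have hswap := integral_integral_swap hG
  have hL : ∀ ω : ℝ, ∫ p, G ω p ∂((volume.restrict (Ioi 0)).prod volume) =
      Complex.exp ((τ : ℂ) ^ 2 * ((c : ℂ) + Complex.I * ω) ^ 2 / 2) *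
        bilateralTransform E (c + Complex.I * ω) * laplaceTransform k (c + Complex.I * ω) := by
    intro ω
    simp only [G]
    rw [integral_const_mul, integral_prod_mul (μ := volume.restrict (Ioi 0)) (ν := volume)
      (fun r : ℝ => Complex.exp (-((c + Complex.I * ω) * (r : ℂ))) * (k r : ℂ))
      (fun ρ : ℝ => Complex.exp ((c + Complex.I * ω) * (ρ : ℂ)) * (E ρ : ℂ))]
    unfold bilateralTransform laplaceTransform
    ring
  have hR : ∀ p : ℝ × ℝ, ∫ ω, G ω p = ((2 * Real.pi * (k p.1 * (E p.2 *
      (τ⁻¹ * ProbabilityTheory.gaussianPDFReal 0 1 ((p.2 - p.1) / τ)))) : ℝ) : ℂ) := by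
    intro p
    have h := integral_gaussian_vertical hτ c (p.2 - p.1)
    have : ∀ ω, G ω p = (k p.1 * E p.2 : ℂ) * Complex.exp ((τ : ℂ) ^ 2 *
        ((c : ℂ) + Complex.I * ω) ^ 2 / 2 + ((c : ℂ) + Complex.I * ω) * ((p.2 - p.1 : ℝ) : ℂ)) := by
      intro ω
      simp only [G]
      have e2 : ∀ a d e' f g : ℂ, a * (d * f * (e' * g)) =
        (f * g) * (a * d * e') := by intros; ring
      rw [e2]
      congr 1
      simp only [← Complex.exp_add]
      congr 1
      push_cast; ring
    simp_rw [this]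
    rw [integral_const_mul, h]
    push_cast; ring
  simp_rw [hL, hR] at hswap
  rw [hswap]
  have hint2 : Integrable (fun p : ℝ × ℝ => (2 * Real.pi * (k p.1 * (E p.2 *
      (τ⁻¹ * ProbabilityTheory.gaussianPDFReal 0 1 ((p.2 - p.1) / τ)))) : ℝ))
      ((volume.restrict (Ioi 0)).prod volume) := by
    have h := hG.integral_prod_right
    simp only [Function.uncurry] at h
    simp_rw [hR] at h
    have := h.re
    simpa only [RCLike.re_to_complex, Complex.ofReal_re] using this
  rw [integral_complex_ofReal, integral_prod _ hint2]
  simp_rw [integral_const_mul, ← gaussMollify_eq_integral hτ]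
  push_cast
  rw [← mul_assoc, inv_mul_cancel₀, one_mul]
  exact_mod_cast (by positivity : (2 * Real.pi : ℝ) ≠ 0)

/-- Integrals over vertical lines agree for holomorphic functions with Gaussian decay. -/
lemma integral_vertical_shift {f : ℂ → ℂ} {c C κ : ℝ} (hc : 0 ≤ c) (hκ : 0 < κ)
    (hcont : ContinuousOn f {s | 0 ≤ s.re ∧ s.re ≤ c})
    (hdiff : DifferentiableOn ℂ f {s | 0 < s.re ∧ s.re < c})
    (hbound : ∀ x y : ℝ, 0 ≤ x → x ≤ c → ‖f (x + y * Complex.I)‖ ≤ C * Real.exp (-κ * y ^ 2)) :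
    ∫ y : ℝ, f (c + y * Complex.I) = ∫ y : ℝ, f ((0 : ℝ) + y * Complex.I) := by
  have hint : ∀ x : ℝ, 0 ≤ x → x ≤ c → Integrable (fun y : ℝ => f (x + y * Complex.I)) := by
    intro x h0 h1
    refine Integrable.mono' ((integrable_exp_neg_mul_sq hκ).const_mul C) ?_
      (ae_of_all _ fun y => hbound x y h0 h1)
    refine Continuous.aestronglyMeasurable (hcont.comp_continuous (by fun_prop) fun y => ?_)
    simp [h0, h1]
  have hrect : ∀ R : ℝ, (∫ y in (-R)..R, f (c + y * Complex.I)) -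
      (∫ y in (-R)..R, f ((0 : ℝ) + y * Complex.I)) =
      Complex.I * ((∫ x in (0 : ℝ)..c, f (x + (-R : ℝ) * Complex.I)) -
        ∫ x in (0 : ℝ)..c, f (x + (R : ℝ) * Complex.I)) := by
    intro R
    have h := Complex.integral_boundary_rect_eq_zero_of_continuousOn_of_differentiableOn f
      ⟨0, -R⟩ ⟨c, R⟩ (hcont.mono ?_) (hdiff.mono ?_)
    · simp only [smul_eq_mul] at h
      linear_combination (-Complex.I) * h + ((∫ y in (-R)..R, f (c + y * Complex.I)) -
        (∫ y in (-R)..R, f ((0 : ℝ) + y * Complex.I))) * Complex.I_sq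
    · intro s hs
      have := hs.1
      simp only [mem_preimage, uIcc_of_le hc] at this
      exact this
    · intro s hs
      have := hs.1
      simp only [mem_preimage, min_eq_left hc, max_eq_right hc] at this
      exact this
  have hgauss : Tendsto (fun R : ℝ => C * Real.exp (-κ * R ^ 2)) atTop (𝓝 0) := by
    have h1 : Tendsto (fun R : ℝ => -κ * R ^ 2) atTop atBot :=
      (tendsto_pow_atTop two_ne_zero).const_mul_atTop_of_neg (by linarith)
    simpa using (Real.tendsto_exp_atBot.comp h1).const_mul C
  have hz : ∀ σ : ℝ, |σ| = 1 → Tendsto (fun R : ℝ => ∫ x in (0 : ℝ)..c,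
      f (x + (σ * R : ℝ) * Complex.I)) atTop (𝓝 0) := by
    intro σ hσ
    have hσ2 : σ ^ 2 = 1 := by rw [← sq_abs, hσ, one_pow]
    refine squeeze_zero_norm (a := fun R => C * Real.exp (-κ * R ^ 2) * |c - 0|) (fun R => ?_) ?_
    · refine intervalIntegral.norm_integral_le_of_norm_le_const fun x hx => ?_
      rw [uIoc_of_le hc] at hx
      have := hbound x (σ * R) hx.1.le hx.2
      rwa [mul_pow, hσ2, one_mul] at this
    · simpa using hgauss.mul_const |c - 0|
  have h1 := (intervalIntegral_tendsto_integral (hint c hc le_rfl) tendsto_neg_atTop_atBot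
    tendsto_id).sub (intervalIntegral_tendsto_integral (hint 0 le_rfl hc) tendsto_neg_atTop_atBot
    tendsto_id)
  have h2 := ((hz (-1) (by simp)).sub (hz 1 (by simp))).const_mul Complex.I
  simp only [id, neg_mul, one_mul] at h1 h2
  simp_rw [hrect] at h1
  have := tendsto_nhds_unique h1 h2
  rw [sub_zero, mul_zero] at this
  exact sub_eq_zero.1 this

lemma norm_cexp_mul_ofReal_le (s : ℂ) (ρ : ℝ) :
    ‖Complex.exp (s * ρ)‖ = Real.exp (s.re * ρ) := by
  rw [Complex.norm_exp]; simp

lemma differentiable_bilateralTransform {E : ℝ → ℝ} (hE : Continuous E)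
    (hcs : HasCompactSupport E) : Differentiable ℂ (bilateralTransform E) := by
  intro s₀
  unfold bilateralTransform
  have hcs' : ∀ g : ℝ → ℝ, Continuous g → Integrable (fun ρ => g ρ * |E ρ|) := fun g hg =>
    (by fun_prop : Continuous fun ρ => g ρ * |E ρ|).integrable_of_hasCompactSupport
      (hcs.comp_left (g := abs) abs_zero).mul_left
  refine (hasDerivAt_integral_of_dominated_loc_of_deriv_le (s := Metric.ball s₀ 1)
    (F := fun s (ρ : ℝ) => Complex.exp (s * ρ) * (E ρ : ℂ))
    (F' := fun s (ρ : ℝ) => Complex.exp (s * ρ) * ρ * (E ρ : ℂ))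
    (bound := fun ρ => Real.exp ((|s₀.re| + 1) * |ρ|) * |ρ| * |E ρ|)
    (Metric.ball_mem_nhds _ one_pos) ?_ ?_ ?_ ?_ ?_ ?_).2.differentiableAt
  · exact Eventually.of_forall fun s => Continuous.aestronglyMeasurable (by fun_prop)
  · refine Integrable.mono' (hcs' (fun ρ => Real.exp (s₀.re * ρ)) (by fun_prop))
      (Continuous.aestronglyMeasurable (by fun_prop)) (ae_of_all _ fun ρ => ?_)
    rw [norm_mul, norm_cexp_mul_ofReal_le]; simp
  · exact Continuous.aestronglyMeasurable (by fun_prop)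
  · refine ae_of_all _ fun ρ s hs => ?_
    rw [norm_mul, norm_mul, norm_cexp_mul_ofReal_le]
    simp only [Complex.norm_real, Real.norm_eq_abs]
    refine mul_le_mul_of_nonneg_right (mul_le_mul_of_nonneg_right (Real.exp_le_exp.2 ?_)
      (abs_nonneg _)) (abs_nonneg _)
    have h1 : |s.re| ≤ |s₀.re| + 1 := by
      have h := Complex.abs_re_le_norm (s - s₀)
      rw [Metric.mem_ball, dist_eq_norm] at hs
      have h2 := abs_sub_abs_le_abs_sub s.re s₀.re
      rw [Complex.sub_re] at h
      linarith
    calc s.re * ρ ≤ |s.re * ρ| := le_abs_self _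
      _ = |s.re| * |ρ| := abs_mul _ _
      _ ≤ _ := by gcongr
  · exact hcs' (fun ρ => Real.exp ((|s₀.re| + 1) * |ρ|) * |ρ|) (by fun_prop)
  · refine ae_of_all _ fun ρ s hs => ?_
    have := ((hasDerivAt_id s).mul_const (ρ : ℂ)).cexp.mul_const (E ρ : ℂ)
    simpa using this

lemma norm_bilateralTransform_le {E : ℝ → ℝ} (hE : Continuous E)
    (hcs : HasCompactSupport E) {c : ℝ} {s : ℂ} (h0 : 0 ≤ s.re) (hc : s.re ≤ c) :
    ‖bilateralTransform E s‖ ≤ ∫ ρ, Real.exp (c * |ρ|) * |E ρ| := by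
  unfold bilateralTransform
  refine norm_integral_le_of_norm_le
    ((by fun_prop : Continuous fun ρ => Real.exp (c * |ρ|) * |E ρ|).integrable_of_hasCompactSupport
      (hcs.comp_left (g := abs) abs_zero).mul_left) (ae_of_all _ fun ρ => ?_)
  rw [norm_mul, norm_cexp_mul_ofReal_le]
  simp only [Complex.norm_real, Real.norm_eq_abs]
  refine mul_le_mul_of_nonneg_right (Real.exp_le_exp.2 ?_) (abs_nonneg _)
  calc s.re * ρ ≤ s.re * |ρ| := by gcongr; exact le_abs_self _
    _ ≤ _ := by gcongr

/-- The cosine transform. -/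
noncomputable def cosTransform (E : ℝ → ℝ) (ω : ℝ) : ℝ := ∫ ρ, E ρ * Real.cos (ω * ρ)

/-- Evenness removes the sine part. The transform is therefore real on the imaginary axis, and
taking real parts there isolates the real part of the kernel's transform. -/
lemma bilateralTransform_I_mul {E : ℝ → ℝ} (hE : Continuous E) (hcs : HasCompactSupport E)
    (heven : ∀ x, E (-x) = E x) (ω : ℝ) :
    bilateralTransform E (Complex.I * ω) = (cosTransform E ω : ℂ) := by
  have hodd : ∫ ρ, E ρ * Real.sin (ω * ρ) = 0 := by
    have h := integral_neg_eq_self (μ := volume) (fun ρ => E ρ * Real.sin (ω * ρ))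
    simp only [heven, mul_neg, Real.sin_neg, integral_neg] at h
    linarith
  have hi : ∀ g : ℝ → ℝ, Continuous g → Integrable (fun ρ => E ρ * g ρ) := fun g hg =>
    (by fun_prop : Continuous fun ρ => E ρ * g ρ).integrable_of_hasCompactSupport hcs.mul_right
  unfold bilateralTransform cosTransform
  have : ∀ ρ : ℝ, Complex.exp (Complex.I * ω * ρ) * (E ρ : ℂ) =
      ((E ρ * Real.cos (ω * ρ) : ℝ) : ℂ) + ((E ρ * Real.sin (ω * ρ) : ℝ) : ℂ) * Complex.I := by
    intro ρ
    have : Complex.I * ω * ρ = ((ω * ρ : ℝ) : ℂ) * Complex.I := by push_cast; ring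
    rw [this, Complex.exp_mul_I]
    push_cast; ring
  simp_rw [this]
  rw [integral_add (hi _ (by fun_prop)).ofReal ((hi _ (by fun_prop)).ofReal.mul_const _),
    integral_mul_const, integral_complex_ofReal, integral_complex_ofReal, hodd]
  simp

lemma abs_cosTransform_le {E : ℝ → ℝ} (hE : Continuous E) (hcs : HasCompactSupport E) (ω : ℝ) :
    |cosTransform E ω| ≤ ∫ ρ, |E ρ| := by
  unfold cosTransform
  rw [← Real.norm_eq_abs]
  refine norm_integral_le_of_norm_le
    (hE.abs.integrable_of_hasCompactSupport (hcs.comp_left (g := abs) abs_zero))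
    (ae_of_all _ fun ρ => ?_)
  rw [norm_mul, Real.norm_eq_abs, Real.norm_eq_abs]
  exact mul_le_of_le_one_right (abs_nonneg _) (Real.abs_cos_le_one _)

lemma continuous_cosTransform {E : ℝ → ℝ} (hE : Continuous E) (hcs : HasCompactSupport E) :
    Continuous (cosTransform E) := by
  unfold cosTransform
  refine continuous_of_dominated (bound := fun ρ => |E ρ|) (fun ω =>
    Continuous.aestronglyMeasurable (by fun_prop)) (fun ω => ae_of_all _ fun ρ => ?_)
    (hE.abs.integrable_of_hasCompactSupport (hcs.comp_left (g := abs) abs_zero))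
    (ae_of_all _ fun ρ => by fun_prop)
  rw [norm_mul, Real.norm_eq_abs, Real.norm_eq_abs]
  exact mul_le_of_le_one_right (abs_nonneg _) (Real.abs_cos_le_one _)

lemma integrable_gaussian_mul_cosTransform_mul {E : ℝ → ℝ} (hE : Continuous E)
    (hcs : HasCompactSupport E) {g : ℝ → ℝ} (hg : Continuous g) {M : ℝ} (hM : ∀ ω, |g ω| ≤ M)
    {τ : ℝ} (hτ : 0 < τ) :
    Integrable (fun ω => Real.exp (-(τ ^ 2 / 2) * ω ^ 2) * (cosTransform E ω * g ω)) := by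
  refine Integrable.mul_bdd (c := (∫ ρ, |E ρ|) * M)
    (integrable_exp_neg_mul_sq (by positivity : 0 < τ ^ 2 / 2))
    ((continuous_cosTransform hE hcs).mul hg).aestronglyMeasurable (ae_of_all _ fun ω => ?_)
  rw [norm_mul]
  exact mul_le_mul (abs_cosTransform_le hE hcs ω) (hM ω) (abs_nonneg _)
    (integral_nonneg fun _ => abs_nonneg _)

/-! ### Pairings of kernels with functions of positive type -/

lemma IsAdmissibleKernel.integrableOn_exp {a : ℝ → ℝ} (ha : IsAdmissibleKernel a) {h : ℝ}
    (hh : 0 < h) : IntegrableOn (fun r => Real.exp (-(h * r)) * a r) (Ioi 0) := by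
  rw [← Ioc_union_Ioi_eq_Ioi zero_le_one]
  refine IntegrableOn.union ?_ ?_
  · have h1 : IntegrableOn a (Icc 0 1) :=
      ha.locallyIntegrable.integrableOn_compact_subset Icc_subset_Ici_self isCompact_Icc
    exact (h1.continuousOn_mul (by fun_prop) isCompact_Icc).mono_set Ioc_subset_Icc_self
  · have h1 : IntegrableOn (fun r => Real.exp (-(h * r))) (Ioi 1) := by
      have := integrableOn_exp_mul_Ioi (a := -h) (by linarith) 1
      refine this.congr_fun (fun r _ => ?_) measurableSet_Ioi
      simp only; congr 1; ring
    exact Integrable.mul_of_top_left h1 ha.essBounded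

lemma cexp_vertical (τ ω : ℝ) :
    Complex.exp ((τ : ℂ) ^ 2 * (Complex.I * ω) ^ 2 / 2) =
      ((Real.exp (-(τ ^ 2 / 2) * ω ^ 2) : ℝ) : ℂ) := by
  rw [Complex.ofReal_exp]
  congr 1
  push_cast
  linear_combination ((τ : ℂ) ^ 2 * ω ^ 2 / 2) * Complex.I_sq

lemma IsLaplaceExtension.continuous_vertical {a : ℝ → ℝ} {α : ℝ} {F : ℂ → ℂ}
    (hF : IsLaplaceExtension a α F) {β : ℝ} (hβα : β ≤ α) :
    Continuous fun ω : ℝ => F (-(β : ℂ) + Complex.I * ω) :=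
  hF.continuousOn.comp_continuous (by fun_prop) fun ω => by simpa using hβα

/-- The pairing of an exponentially weighted kernel with a mollified even function, written through
the boundary values of the extended Laplace transform. -/
lemma IsLaplaceExtension.integral_mul_gaussMollify {a : ℝ → ℝ} (ha : IsAdmissibleKernel a) {α : ℝ}
    {F : ℂ → ℂ} (hF : IsLaplaceExtension a α F) {β : ℝ} (hβ : 0 ≤ β) (hβα : β ≤ α)
    {E : ℝ → ℝ} {T : ℝ} (hE : Continuous E) (hT : ∀ x, T < |x| → E x = 0)
    (heven : ∀ x, E (-x) = E x) {τ : ℝ} (hτ : 0 < τ) :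
    ∫ r in Ioi (0 : ℝ), Real.exp (β * r) * a r * gaussMollify E τ r =
      (2 * Real.pi)⁻¹ * ∫ ω : ℝ, Real.exp (-(τ ^ 2 / 2) * ω ^ 2) *
        (cosTransform E ω * (F (-(β : ℂ) + Complex.I * ω)).re) := by
  have hcs := hasCompactSupport_of_abs_gt hT
  obtain ⟨M, hM⟩ := hF.bounded
  have hM0 : 0 ≤ M := (norm_nonneg _).trans (hM (-(β : ℂ)) (by simpa using hβα))
  -- On Re s = β + 1 the point s − β has real part 1, where F is the Laplace integral. Moving the
  -- line to Re s = 0 then reads F at real part −β.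
  set c : ℝ := β + 1 with hc
  have hk : IntegrableOn (fun r => Real.exp (-(c * r)) * (Real.exp (β * r) * a r)) (Ioi 0) := by
    refine (ha.integrableOn_exp one_pos).congr_fun (fun r _ => ?_) measurableSet_Ioi
    simp only
    rw [← mul_assoc, ← Real.exp_add]
    congr 2; rw [hc]; ring
  have h1 := integral_mul_gaussMollify_eq hτ hk hE hT
  have hlap : ∀ ω : ℝ, laplaceTransform (fun r => Real.exp (β * r) * a r) (c + Complex.I * ω) =
      F (c + Complex.I * ω - β) := by
    intro ω
    rw [hF.eq_laplace _ (by simp [hc])]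
    unfold laplaceTransform
    refine integral_congr_ae (ae_of_all _ fun r => ?_)
    simp only
    push_cast
    rw [← mul_assoc, ← Complex.exp_add]
    congr 2; ring
  simp_rw [hlap] at h1
  let f : ℂ → ℂ := fun s => Complex.exp ((τ : ℂ) ^ 2 * s ^ 2 / 2) * bilateralTransform E s * F (s - β)
  have hdE := differentiable_bilateralTransform hE hcs
  have hshift := integral_vertical_shift (f := f) (c := c) (κ := τ ^ 2 / 2)
    (C := Real.exp (τ ^ 2 * c ^ 2 / 2) * (∫ ρ, Real.exp (c * |ρ|) * |E ρ|) * M)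
    (by linarith) (by positivity) ?_ ?_ ?_
  · have e1 : ∀ y : ℝ, f (c + y * Complex.I) = Complex.exp ((τ : ℂ) ^ 2 *
        ((c : ℂ) + Complex.I * y) ^ 2 / 2) * bilateralTransform E (c + Complex.I * y) *
        F (c + Complex.I * y - β) := by
      intro y; simp only [f, mul_comm Complex.I]
    have e2 : ∀ y : ℝ, f ((0 : ℝ) + y * Complex.I) = ((Real.exp (-(τ ^ 2 / 2) * y ^ 2) *
        cosTransform E y : ℝ) : ℂ) * F (-(β : ℂ) + Complex.I * y) := by
      intro y
      have : ((0 : ℝ) : ℂ) + y * Complex.I = Complex.I * y := by push_cast; ring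
      simp only [f]
      rw [this, cexp_vertical, bilateralTransform_I_mul hE hcs heven, ← Complex.ofReal_mul]
      congr 2; ring
    simp_rw [e1, e2] at hshift
    rw [hshift] at h1
    have h2 := congrArg Complex.re h1
    rw [Complex.ofReal_re] at h2
    rw [h2]
    have e3 : (2 * Real.pi : ℂ)⁻¹ = (((2 * Real.pi)⁻¹ : ℝ) : ℂ) := by push_cast; rfl
    rw [e3, Complex.re_ofReal_mul]
    congr 1
    have hint : Integrable (fun y : ℝ => ((Real.exp (-(τ ^ 2 / 2) * y ^ 2) *
        cosTransform E y : ℝ) : ℂ) * F (-(β : ℂ) + Complex.I * y)) := by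
      have hi := integrable_gaussian_mul_cosTransform_mul hE hcs (g := fun _ => 1)
        continuous_const (M := 1) (by simp) hτ
      simp only [mul_one] at hi
      refine hi.ofReal.mul_bdd (c := M) (hF.continuous_vertical hβα).aestronglyMeasurable
        (ae_of_all _ fun ω => hM _ (by simpa using hβα))
    have := integral_re hint
    simp only [RCLike.re_to_complex] at this
    rw [← this]
    refine integral_congr_ae (ae_of_all _ fun y => ?_)
    simp only [Complex.re_ofReal_mul]
    ring
  · refine ContinuousOn.mul (Continuous.continuousOn (by have := hdE.continuous; fun_prop)) ?_
    exact hF.continuousOn.comp (by fun_prop) fun s hs => by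
      have := hs.1; simp only [mem_ofPred_eq, Complex.sub_re, Complex.ofReal_re]; linarith
  · refine DifferentiableOn.mul (Differentiable.differentiableOn (by fun_prop)) ?_
    exact hF.differentiableOn.comp (by fun_prop) fun s hs => by
      have := hs.1; simp only [mem_ofPred_eq, Complex.sub_re, Complex.ofReal_re]; linarith
  · intro x y hx hxc
    have b1 : ‖Complex.exp ((τ : ℂ) ^ 2 * ((x : ℂ) + y * Complex.I) ^ 2 / 2)‖ ≤
        Real.exp (τ ^ 2 * c ^ 2 / 2) * Real.exp (-(τ ^ 2 / 2) * y ^ 2) := by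
      rw [Complex.norm_exp, ← Real.exp_add]
      have : ((τ : ℂ) ^ 2 * ((x : ℂ) + y * Complex.I) ^ 2 / 2) =
          ((τ ^ 2 * (x ^ 2 - y ^ 2) / 2 : ℝ) : ℂ) + ((τ ^ 2 * x * y : ℝ) : ℂ) * Complex.I := by
        push_cast
        linear_combination ((τ : ℂ) ^ 2 * y ^ 2 / 2) * Complex.I_sq
      rw [this, Complex.add_re, Complex.re_ofReal_mul, Complex.ofReal_re, Complex.I_re]
      rw [Real.exp_le_exp]
      have h3 : τ ^ 2 * x ^ 2 ≤ τ ^ 2 * c ^ 2 := by gcongr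
      nlinarith
    have b2 := norm_bilateralTransform_le hE hcs (s := (x : ℂ) + y * Complex.I) (c := c)
      (by simpa using hx) (by simpa using hxc)
    have b3 : ‖F ((x : ℂ) + y * Complex.I - β)‖ ≤ M := hM _ (by simp; linarith)
    simp only [f]
    rw [norm_mul, norm_mul]
    calc _ ≤ (Real.exp (τ ^ 2 * c ^ 2 / 2) * Real.exp (-(τ ^ 2 / 2) * y ^ 2)) *
          (∫ ρ, Real.exp (c * |ρ|) * |E ρ|) * M := by gcongr
      _ = _ := by ring

/-- The same formula for an integrable kernel. -/
lemma integral_mul_gaussMollify_of_integrable {b : ℝ → ℝ} (hb : IntegrableOn b (Ioi 0))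
    {E : ℝ → ℝ} {T : ℝ} (hE : Continuous E) (hT : ∀ x, T < |x| → E x = 0)
    (heven : ∀ x, E (-x) = E x) {τ : ℝ} (hτ : 0 < τ) :
    ∫ r in Ioi (0 : ℝ), b r * gaussMollify E τ r =
      (2 * Real.pi)⁻¹ * ∫ ω : ℝ, Real.exp (-(τ ^ 2 / 2) * ω ^ 2) *
        (cosTransform E ω * ∫ r in Ioi (0 : ℝ), Real.cos (ω * r) * b r) := by
  have hcs := hasCompactSupport_of_abs_gt hT
  have h1 := integral_mul_gaussMollify_eq (c := 0) hτ (by simpa using hb) hE hT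
  simp only [Complex.ofReal_zero, zero_add, bilateralTransform_I_mul hE hcs heven,
    cexp_vertical] at h1
  have hF : ∀ (ω t : ℝ), ‖Complex.exp (-(Complex.I * ω * t)) * (b t : ℂ)‖ = ‖b t‖ := by
    intro ω t
    have : -(Complex.I * ω * t) = ((-(ω * t) : ℝ) : ℂ) * Complex.I := by push_cast; ring
    rw [norm_mul, this, Complex.norm_exp_ofReal_mul_I, one_mul, Complex.norm_real]
  have hmeas : ∀ ω : ℝ, AEStronglyMeasurable
      (fun t : ℝ => Complex.exp (-(Complex.I * ω * t)) * (b t : ℂ)) (volume.restrict (Ioi 0)) :=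
    fun ω => (Continuous.aestronglyMeasurable (by fun_prop)).mul
      (Complex.continuous_ofReal.comp_aestronglyMeasurable hb.aestronglyMeasurable)
  have hlc : Continuous fun ω : ℝ => laplaceTransform b (Complex.I * ω) := by
    unfold laplaceTransform
    refine continuous_of_dominated (bound := fun t => ‖b t‖) hmeas
      (fun ω => ae_of_all _ fun t => (hF ω t).le) hb.norm (ae_of_all _ fun t => by fun_prop)
  have hlb : ∀ ω : ℝ, ‖laplaceTransform b (Complex.I * ω)‖ ≤ ∫ t in Ioi (0 : ℝ), ‖b t‖ := fun ω =>
    norm_integral_le_of_norm_le hb.norm (ae_of_all _ fun t => (hF ω t).le)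
  have hlre : ∀ ω : ℝ, (laplaceTransform b (Complex.I * ω)).re =
      ∫ r in Ioi (0 : ℝ), Real.cos (ω * r) * b r := by
    intro ω
    have hi : IntegrableOn (fun t : ℝ => Complex.exp (-(Complex.I * ω * t)) * (b t : ℂ)) (Ioi 0) :=
      Integrable.mono' hb.norm (hmeas ω) (ae_of_all _ fun t => (hF ω t).le)
    have := integral_re hi
    simp only [RCLike.re_to_complex] at this
    unfold laplaceTransform
    rw [← this]
    refine integral_congr_ae (ae_of_all _ fun t => ?_)
    have : -(Complex.I * ω * t) = ((-(ω * t) : ℝ) : ℂ) * Complex.I := by push_cast; ring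
    simp only
    rw [this, Complex.re_mul_ofReal, Complex.exp_ofReal_mul_I_re, Real.cos_neg]
  have h2 := congrArg Complex.re h1
  rw [Complex.ofReal_re] at h2
  rw [h2]
  have e3 : (2 * Real.pi : ℂ)⁻¹ = (((2 * Real.pi)⁻¹ : ℝ) : ℂ) := by push_cast; rfl
  rw [e3, Complex.re_ofReal_mul]
  congr 1
  have hint : Integrable (fun y : ℝ => ((Real.exp (-(τ ^ 2 / 2) * y ^ 2) : ℝ) : ℂ) *
      (cosTransform E y : ℂ) * laplaceTransform b (Complex.I * y)) := by
    have hi := integrable_gaussian_mul_cosTransform_mul hE hcs (g := fun _ => 1)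
      continuous_const (M := 1) (by simp) hτ
    simp only [mul_one] at hi
    have hi2 := hi.ofReal (𝕜 := ℂ)
    simp only [RCLike.ofReal_mul] at hi2
    exact hi2.mul_bdd hlc.aestronglyMeasurable (ae_of_all _ fun ω => hlb ω)
  have := integral_re hint
  simp only [RCLike.re_to_complex] at this
  rw [← this]
  refine integral_congr_ae (ae_of_all _ fun y => ?_)
  simp only [← hlre, mul_assoc, Complex.re_ofReal_mul]

/-- Fourier inversion at 0 with Gaussian summation. It lets the instantaneous term a₀ be treated as
a point mass at 0 whose transform is constant. -/
lemma gaussMollify_zero_eq {E : ℝ → ℝ} {T : ℝ} (hE : Continuous E) (hT : ∀ x, T < |x| → E x = 0)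
    {τ : ℝ} (hτ : 0 < τ) :
    gaussMollify E τ 0 =
      (2 * Real.pi)⁻¹ * ∫ ω : ℝ, Real.exp (-(τ ^ 2 / 2) * ω ^ 2) * cosTransform E ω := by
  have hcs := hasCompactSupport_of_abs_gt hT
  have hgi : Integrable (fun ω : ℝ => Real.exp (-(τ ^ 2 / 2) * ω ^ 2)) :=
    integrable_exp_neg_mul_sq (by positivity)
  have hinner : ∀ ρ : ℝ, ∫ ω : ℝ, Real.exp (-(τ ^ 2 / 2) * ω ^ 2) * Real.cos (ω * ρ) =
      2 * Real.pi * (τ⁻¹ * ProbabilityTheory.gaussianPDFReal 0 1 (ρ / τ)) := by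
    intro ρ
    have h := congrArg Complex.re (integral_gaussian_vertical hτ 0 ρ)
    rw [Complex.ofReal_re] at h
    rw [← h]
    have e : ∀ ω : ℝ, Complex.exp ((τ : ℂ) ^ 2 * (((0 : ℝ) : ℂ) + Complex.I * ω) ^ 2 / 2 +
        (((0 : ℝ) : ℂ) + Complex.I * ω) * ρ) =
        ((Real.exp (-(τ ^ 2 / 2) * ω ^ 2) : ℝ) : ℂ) *
          Complex.exp (((ω * ρ : ℝ) : ℂ) * Complex.I) := by
      intro ω
      rw [Complex.exp_add, Complex.ofReal_zero, zero_add, cexp_vertical]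
      congr 2; push_cast; ring
    simp_rw [e]
    have hint : Integrable (fun ω : ℝ => ((Real.exp (-(τ ^ 2 / 2) * ω ^ 2) : ℝ) : ℂ) *
          Complex.exp (((ω * ρ : ℝ) : ℂ) * Complex.I)) :=
      hgi.ofReal.mul_bdd (c := 1) (Continuous.aestronglyMeasurable (by fun_prop))
        (ae_of_all _ fun ω => (Complex.norm_exp_ofReal_mul_I _).le)
    have := integral_re hint
    simp only [RCLike.re_to_complex] at this
    rw [← this]
    refine integral_congr_ae (ae_of_all _ fun y => ?_)
    simp only [Complex.re_ofReal_mul, Complex.exp_ofReal_mul_I_re]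
  have hprod : Integrable (Function.uncurry fun (ω ρ : ℝ) =>
      Real.exp (-(τ ^ 2 / 2) * ω ^ 2) * (E ρ * Real.cos (ω * ρ))) (volume.prod volume) := by
    have h := (hgi.mul_prod (hE.integrable_of_hasCompactSupport (μ := volume) hcs)).mul_bdd
      (g := fun p : ℝ × ℝ => Real.cos (p.1 * p.2)) (c := 1)
      (Continuous.aestronglyMeasurable (by fun_prop))
      (ae_of_all _ fun p => Real.abs_cos_le_one _)
    refine h.congr (ae_of_all _ fun p => ?_)
    simp only [Function.uncurry]; ring
  have hsw := integral_integral_swap hprod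
  simp only [integral_const_mul] at hsw
  unfold cosTransform
  rw [hsw, gaussMollify_eq_integral hτ, ← integral_const_mul]
  refine integral_congr_ae (ae_of_all _ fun ρ => ?_)
  have e : ∀ ω : ℝ, Real.exp (-(τ ^ 2 / 2) * ω ^ 2) * (E ρ * Real.cos (ω * ρ)) =
    E ρ * (Real.exp (-(τ ^ 2 / 2) * ω ^ 2) * Real.cos (ω * ρ)) := fun ω => by ring
  simp only [e, integral_const_mul, hinner, sub_zero]
  have := Real.pi_ne_zero
  field_simp

lemma IsAdmissibleKernel.integrableOn_exp_mul_exp {a : ℝ → ℝ} (ha : IsAdmissibleKernel a) (β : ℝ) :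
    IntegrableOn (fun r => Real.exp (-((β + 1) * r)) * (Real.exp (β * r) * a r)) (Ioi 0) := by
  refine (ha.integrableOn_exp one_pos).congr_fun (fun r _ => ?_) measurableSet_Ioi
  simp only
  rw [← mul_assoc, ← Real.exp_add]
  congr 2; ring

/-- Point mass and kernel combine into one integral with symbol a₁ + g, in which every factor is
nonnegative. Neither term need be nonnegative alone. -/
lemma nonneg_add_mollified_pairing {E : ℝ → ℝ} {T : ℝ} (hE : Continuous E)
    (hT : ∀ x, T < |x| → E x = 0) (hEpos : ∀ ω, 0 ≤ cosTransform E ω) {g : ℝ → ℝ}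
    (hg : Continuous g) {M : ℝ} (hM : ∀ ω, |g ω| ≤ M) {a₁ : ℝ} (hpos : ∀ ω, 0 ≤ a₁ + g ω)
    {τ : ℝ} (hτ : 0 < τ) :
    0 ≤ a₁ * gaussMollify E τ 0 + (2 * Real.pi)⁻¹ *
      ∫ ω : ℝ, Real.exp (-(τ ^ 2 / 2) * ω ^ 2) * (cosTransform E ω * g ω) := by
  have hcs := hasCompactSupport_of_abs_gt hT
  have h1 := integrable_gaussian_mul_cosTransform_mul hE hcs (g := fun _ => 1)
      continuous_const (M := 1) (by simp) hτ
  simp only [mul_one] at h1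
  have h2 := integrable_gaussian_mul_cosTransform_mul hE hcs hg hM hτ
  have h3 : a₁ * gaussMollify E τ 0 + (2 * Real.pi)⁻¹ *
      ∫ ω : ℝ, Real.exp (-(τ ^ 2 / 2) * ω ^ 2) * (cosTransform E ω * g ω) =
      (2 * Real.pi)⁻¹ * ∫ ω : ℝ, Real.exp (-(τ ^ 2 / 2) * ω ^ 2) *
        (cosTransform E ω * (a₁ + g ω)) := by
    have e : ∀ ω : ℝ, Real.exp (-(τ ^ 2 / 2) * ω ^ 2) * (cosTransform E ω * (a₁ + g ω)) =
      a₁ * (Real.exp (-(τ ^ 2 / 2) * ω ^ 2) * cosTransform E ω) +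
        Real.exp (-(τ ^ 2 / 2) * ω ^ 2) * (cosTransform E ω * g ω) := fun ω => by ring
    simp_rw [e]
    rw [integral_add (h1.const_mul _) h2, integral_const_mul, gaussMollify_zero_eq hE hT hτ]
    ring
  rw [h3]
  refine mul_nonneg (by positivity) (integral_nonneg fun ω => ?_)
  exact mul_nonneg (Real.exp_nonneg _) (mul_nonneg (hEpos ω) (hpos ω))

/-- A kernel with nonnegative real part of its transform pairs nonnegatively with functions of
positive type. -/
lemma IsLaplaceExtension.pairing_nonneg {a : ℝ → ℝ} (ha : IsAdmissibleKernel a) {α : ℝ}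
    {F : ℂ → ℂ} (hF : IsLaplaceExtension a α F) {β a₁ : ℝ} (hβ : 0 ≤ β) (hβα : β ≤ α)
    (hpos : ∀ ω : ℝ, 0 ≤ a₁ + (F (-(β : ℂ) + Complex.I * ω)).re)
    {E : ℝ → ℝ} {T : ℝ} (hE : Continuous E) (hT : ∀ x, T < |x| → E x = 0)
    (heven : ∀ x, E (-x) = E x) (hEpos : ∀ ω, 0 ≤ cosTransform E ω) :
    0 ≤ a₁ * E 0 + ∫ r in Ioi (0 : ℝ), Real.exp (β * r) * a r * E r := by
  obtain ⟨K, hK⟩ := hE.bounded_above_of_compact_support (hasCompactSupport_of_abs_gt hT)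
  obtain ⟨M, hM⟩ := hF.bounded
  refine ge_of_tendsto (((tendsto_gaussMollify hE hK 0).const_mul a₁).add
    (tendsto_integral_mul_gaussMollify (N := β + 1) (by linarith)
      (ha.integrableOn_exp_mul_exp β) hE hT)) ?_
  filter_upwards [self_mem_nhdsWithin] with τ hτ
  rw [hF.integral_mul_gaussMollify ha hβ hβα hE hT heven hτ]
  refine nonneg_add_mollified_pairing hE hT hEpos
    (Complex.continuous_re.comp (hF.continuous_vertical hβα)) (M := M) (fun ω => ?_) hpos hτ
  exact (Complex.abs_re_le_norm _).trans (hM _ (by simpa using hβα))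

/-- Quantitative version of positivity, for transforms bounded below on an interval. -/
lemma IsLaplaceExtension.le_pairing {a : ℝ → ℝ} (ha : IsAdmissibleKernel a) {α : ℝ}
    {F : ℂ → ℂ} (hF : IsLaplaceExtension a α F) (hα : 0 ≤ α)
    (hpos : ∀ ω : ℝ, 0 ≤ (F (-(α : ℂ) + Complex.I * ω)).re) {p q R g₀ m : ℝ} (hpq : p ≤ q)
    (hR : ∀ ω ∈ Icc p q, |ω| ≤ R) (hg₀ : 0 ≤ g₀) (hm : 0 ≤ m)
    (hg : ∀ ω ∈ Icc p q, g₀ ≤ (F (-(α : ℂ) + Complex.I * ω)).re)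
    {E : ℝ → ℝ} {T : ℝ} (hE : Continuous E) (hT : ∀ x, T < |x| → E x = 0)
    (heven : ∀ x, E (-x) = E x) (hEpos : ∀ ω, 0 ≤ cosTransform E ω)
    (hEm : ∀ ω ∈ Icc p q, m ≤ cosTransform E ω) :
    (2 * Real.pi)⁻¹ * ((q - p) * Real.exp (-(R ^ 2 / 2)) * g₀) * m ≤
      ∫ r in Ioi (0 : ℝ), Real.exp (α * r) * a r * E r := by
  have hcs := hasCompactSupport_of_abs_gt hT
  obtain ⟨M, hM⟩ := hF.bounded
  refine ge_of_tendsto (tendsto_integral_mul_gaussMollify (N := α + 1) (by linarith)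
      (ha.integrableOn_exp_mul_exp α) hE hT) ?_
  have : ∀ᶠ τ : ℝ in 𝓝[>] 0, τ ∈ Ioc (0 : ℝ) 1 := Ioc_mem_nhdsGT one_pos
  filter_upwards [this] with τ hτ
  rw [hF.integral_mul_gaussMollify ha hα le_rfl hE hT heven hτ.1, mul_assoc]
  refine mul_le_mul_of_nonneg_left ?_ (by positivity)
  have hi := integrable_gaussian_mul_cosTransform_mul hE hcs (M := M)
    (Complex.continuous_re.comp (hF.continuous_vertical (le_refl α)))
    (fun ω => (Complex.abs_re_le_norm _).trans (hM _ (by simp))) hτ.1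
  have hnn : ∀ ω : ℝ, 0 ≤ Real.exp (-(τ ^ 2 / 2) * ω ^ 2) *
      (cosTransform E ω * (F (-(α : ℂ) + Complex.I * ω)).re) := fun ω =>
    mul_nonneg (Real.exp_nonneg _) (mul_nonneg (hEpos ω) (hpos ω))
  -- Only the interval [p, q] is kept. There exp(−R²/2) bounds the Gaussian factor from below for
  -- every τ ≤ 1, so the estimate survives τ → 0.
  calc (q - p) * Real.exp (-(R ^ 2 / 2)) * g₀ * m
      = ∫ ω in Icc p q, Real.exp (-(R ^ 2 / 2)) * (m * g₀) := by
        rw [setIntegral_const]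
        simp only [measureReal_def, Real.volume_Icc, smul_eq_mul]
        rw [ENNReal.toReal_ofReal (by linarith)]; ring
    _ ≤ ∫ ω in Icc p q, Real.exp (-(τ ^ 2 / 2) * ω ^ 2) *
      (cosTransform E ω * (F (-(α : ℂ) + Complex.I * ω)).re) := by
        refine setIntegral_mono_on ?_ hi.integrableOn measurableSet_Icc fun ω hω => ?_
        · exact integrableOn_const (by simp)
        · refine mul_le_mul (Real.exp_le_exp.2 ?_) (mul_le_mul (hEm ω hω) (hg ω hω) hg₀ (hEpos ω))
            (by positivity) (Real.exp_nonneg _)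
          have h1 : ω ^ 2 ≤ R ^ 2 := sq_le_sq' (by linarith [neg_abs_le ω, hR ω hω])
            (by linarith [le_abs_self ω, hR ω hω])
          have h2 : τ ^ 2 ≤ 1 := pow_le_one₀ hτ.1.le hτ.2
          nlinarith [sq_nonneg ω]
    _ ≤ _ := setIntegral_le_integral hi (ae_of_all _ hnn)

/-- Version of `IsLaplaceExtension.pairing_nonneg` for an integrable kernel. -/
lemma pairing_nonneg_of_integrable {b : ℝ → ℝ} (hb : IntegrableOn b (Ioi 0)) {a₁ : ℝ}
    (hpos : ∀ ω : ℝ, 0 ≤ a₁ + ∫ r in Ioi (0 : ℝ), Real.cos (ω * r) * b r)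
    {E : ℝ → ℝ} {T : ℝ} (hE : Continuous E) (hT : ∀ x, T < |x| → E x = 0)
    (heven : ∀ x, E (-x) = E x) (hEpos : ∀ ω, 0 ≤ cosTransform E ω) :
    0 ≤ a₁ * E 0 + ∫ r in Ioi (0 : ℝ), b r * E r := by
  obtain ⟨K, hK⟩ := hE.bounded_above_of_compact_support (hasCompactSupport_of_abs_gt hT)
  refine ge_of_tendsto (((tendsto_gaussMollify hE hK 0).const_mul a₁).add
    (tendsto_integral_mul_gaussMollify (N := 0) le_rfl (by simpa using hb) hE hT)) ?_
  filter_upwards [self_mem_nhdsWithin] with τ hτ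
  rw [integral_mul_gaussMollify_of_integrable hb hE hT heven hτ]
  have hle : ∀ ω t : ℝ, ‖Real.cos (ω * t) * b t‖ ≤ ‖b t‖ := fun ω t => by
    rw [norm_mul]
    exact mul_le_of_le_one_left (norm_nonneg _) (Real.abs_cos_le_one _)
  refine nonneg_add_mollified_pairing hE hT hEpos (M := ∫ t in Ioi (0 : ℝ), ‖b t‖) ?_
    (fun ω => ?_) hpos hτ
  · exact continuous_of_dominated (bound := fun t => ‖b t‖)
      (fun ω => (Continuous.aestronglyMeasurable (by fun_prop)).mul hb.aestronglyMeasurable)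
      (fun ω => ae_of_all _ fun t => hle ω t) hb.norm (ae_of_all _ fun t => by fun_prop)
  · exact norm_integral_le_of_norm_le hb.norm (ae_of_all _ fun t => hle ω t)

/-- A kernel is determined by the real part of its transform on a vertical line. -/
lemma IsLaplaceExtension.ae_eq_zero {a : ℝ → ℝ} (ha : IsAdmissibleKernel a) {α : ℝ}
    {F : ℂ → ℂ} (hF : IsLaplaceExtension a α F) (hα : 0 ≤ α)
    (hzero : ∀ ω : ℝ, (F (-(α : ℂ) + Complex.I * ω)).re = 0) :
    a =ᵐ[volume.restrict (Ioi (0 : ℝ))] 0 := by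
  have hloc : LocallyIntegrableOn (fun r => Real.exp (α * r) * a r) (Ioi 0) := by
    refine LocallyIntegrableOn.continuousOn_mul ?_ (Continuous.continuousOn (by fun_prop))
      isOpen_Ioi.isLocallyClosed
    exact ha.locallyIntegrable.mono_set Ioi_subset_Ici_self
  have h := isOpen_Ioi.ae_eq_zero_of_integral_contDiff_smul_eq_zero hloc fun g hg hgc hgs => ?_
  · refine (ae_restrict_iff' measurableSet_Ioi).2 (h.mono fun r hr hr0 => ?_)
    simpa [(Real.exp_pos (α * r)).ne'] using hr hr0
  · obtain ⟨T, hT⟩ := hgc.isCompact.isBounded.subset_closedBall 0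
    have hg0 : ∀ x, x ∉ Ioi (0 : ℝ) → g x = 0 := fun x hx =>
      image_eq_zero_of_notMem_tsupport fun h => hx (hgs h)
    -- The pairing formula is available for even functions only; the reflection agrees with g on the
    -- half-line of integration.
    have hE : Continuous fun x : ℝ => g |x| := hg.continuous.comp continuous_abs
    have hET : ∀ x : ℝ, T < |x| → g |x| = 0 := fun x hx =>
      image_eq_zero_of_notMem_tsupport fun h => by
        have := hT h
        rw [mem_closedBall_zero_iff, Real.norm_eq_abs, abs_abs] at this
        linarith
    have ht := tendsto_integral_mul_gaussMollify (N := α + 1) (by linarith)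
      (ha.integrableOn_exp_mul_exp α) hE hET
    have h0 : Tendsto (fun τ => ∫ r in Ioi (0 : ℝ), Real.exp (α * r) * a r *
        gaussMollify (fun x => g |x|) τ r) (𝓝[>] 0) (𝓝 0) := by
      refine tendsto_const_nhds.congr' ?_
      filter_upwards [self_mem_nhdsWithin] with τ hτ
      rw [hF.integral_mul_gaussMollify ha hα le_rfl hE hET (fun x => by rw [abs_neg]) hτ]
      simp [hzero]
    have h1 := tendsto_nhds_unique ht h0
    rw [← h1, ← setIntegral_eq_integral_of_forall_compl_eq_zero (s := Ioi 0)
      (fun x hx => by rw [hg0 x hx, zero_smul])]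
    refine setIntegral_congr_fun measurableSet_Ioi fun x hx => ?_
    simp only [smul_eq_mul]
    rw [abs_of_pos hx]; ring

/-! ### An explicit Fourier pair -/

/-- At s = 1 ± ix the two values add up to 4/(1 + x²)², the Fourier transform of (1 + |t|)e^{−|t|}.
Fourier inversion of this pair follows. -/
lemma integral_one_add_mul_cexp {s : ℂ} (hs : 0 < s.re) :
    IntegrableOn (fun t : ℝ => (1 + t : ℂ) * Complex.exp (-(s * t))) (Ioi 0) ∧
    ∫ t in Ioi (0 : ℝ), (1 + t : ℂ) * Complex.exp (-(s * t)) = 1 / s + 1 / s ^ 2 := by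
  have hs0 : s ≠ 0 := by rintro rfl; simp at hs
  have hnorm : ∀ t : ℝ, ‖Complex.exp (-(s * t))‖ = Real.exp (-s.re * t) := by
    intro t; rw [Complex.norm_exp]; simp
  have hint : IntegrableOn (fun t : ℝ => (1 + t : ℂ) * Complex.exp (-(s * t))) (Ioi 0) := by
    have h1 := integrableOn_rpow_mul_exp_neg_mul_rpow (s := 1) (p := 1) (b := s.re) (by norm_num)
      one_pos hs
    have h0 := integrableOn_rpow_mul_exp_neg_mul_rpow (s := 0) (p := 1) (b := s.re) (by norm_num)
      one_pos hs
    simp only [Real.rpow_one, Real.rpow_zero, one_mul] at h1 h0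
    refine Integrable.mono' (h0.add h1) (Continuous.aestronglyMeasurable (by fun_prop)) ?_
    refine (ae_restrict_iff' measurableSet_Ioi).2 (ae_of_all _ fun t ht => ?_)
    rw [norm_mul, hnorm]
    have : ‖(1 + t : ℂ)‖ = 1 + t := by
      rw [← Complex.ofReal_one, ← Complex.ofReal_add, Complex.norm_of_nonneg]
      have := mem_Ioi.1 ht; linarith
    rw [this]
    simp only [Pi.add_apply]
    rw [add_mul, one_mul]
  refine ⟨hint, ?_⟩
  have hd : ∀ t : ℝ, HasDerivAt (fun t : ℝ => -((1 + t : ℂ) * Complex.exp (-(s * t)) / s) -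
      Complex.exp (-(s * t)) / s ^ 2) ((1 + t : ℂ) * Complex.exp (-(s * t))) t := by
    intro t
    have h1 : HasDerivAt (fun t : ℝ => (t : ℂ)) 1 t := Complex.ofRealCLM.hasDerivAt
    have h2 : HasDerivAt (fun t : ℝ => Complex.exp (-(s * t)))
      (Complex.exp (-(s * t)) * -(s * 1)) t := (h1.const_mul s).neg.cexp
    have h3 := (((h1.const_add 1).mul h2).div_const s).neg.sub (h2.div_const (s ^ 2))
    refine h3.congr_deriv ?_
    field_simp
    ring
  have ht1 : Tendsto (fun t : ℝ => Complex.exp (-(s * t))) atTop (𝓝 0) := by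
    rw [tendsto_zero_iff_norm_tendsto_zero]
    simp_rw [hnorm]
    exact Real.tendsto_exp_atBot.comp (tendsto_id.const_mul_atTop_of_neg (by linarith))
  have ht2 : Tendsto (fun t : ℝ => (1 + t : ℂ) * Complex.exp (-(s * t))) atTop (𝓝 0) := by
    have : Tendsto (fun t : ℝ => (t : ℂ) * Complex.exp (-(s * t))) atTop (𝓝 0) := by
      rw [tendsto_zero_iff_norm_tendsto_zero]
      have h := tendsto_rpow_mul_exp_neg_mul_atTop_nhds_zero 1 s.re hs
      refine h.congr' ?_
      filter_upwards [eventually_ge_atTop 0] with t ht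
      rw [norm_mul, hnorm, Complex.norm_of_nonneg ht, Real.rpow_one]
    simpa [add_mul] using ht1.add this
  have ht := (ht2.div_const s).neg.sub (ht1.div_const (s ^ 2))
  have h := integral_Ioi_of_hasDerivAt_of_tendsto' (a := 0) (fun t _ => hd t) hint ht
  rw [h]
  simp
  ring

open FourierTransform in
/-- The Fourier transform of `(1 + x²)⁻²`. -/
lemma integral_cos_div_sq (t : ℝ) :
    ∫ x : ℝ, Real.cos (x * t) * ((1 + x ^ 2) ^ 2)⁻¹ =
      Real.pi / 2 * ((1 + |t|) * Real.exp (-|t|)) := by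
  let f : ℝ → ℂ := fun t => ((1 + |t| : ℝ) : ℂ) * ((Real.exp (-|t|) : ℝ) : ℂ)
  have hfc : Continuous f := by fun_prop
  have hpos : ∀ z : ℂ, ∀ t ∈ Ioi (0 : ℝ), Complex.exp (-(z * t)) * f t =
      (1 + t : ℂ) * Complex.exp (-((1 + z) * t)) := by
    intro z t ht
    simp only [f, abs_of_pos (mem_Ioi.1 ht)]
    push_cast
    have : -((1 + z) * (t : ℂ)) = -(z * t) + -t := by ring
    rw [this, Complex.exp_add]; ring
  have hre : ∀ x : ℝ, 0 < (1 + Complex.I * x : ℂ).re := by intro x; simp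
  have hI : ∀ x : ℝ, IntegrableOn (fun t : ℝ => Complex.exp (-(Complex.I * x * t)) * f t) (Ioi 0) :=
    fun x => (integral_one_add_mul_cexp (hre x)).1.congr_fun (fun t ht => (hpos _ t ht).symm)
      measurableSet_Ioi
  have hneg : ∀ x t : ℝ, Complex.exp (-(Complex.I * x * (-t : ℝ))) * f (-t) =
      Complex.exp (-(Complex.I * (-x : ℝ) * t)) * f t := by
    intro x t
    simp only [f, abs_neg]
    congr 2; push_cast; ring
  have hIic : ∀ x : ℝ, IntegrableOn (fun t : ℝ => Complex.exp (-(Complex.I * x * t)) * f t)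
      (Iic 0) := by
    intro x
    have h := hI (-x)
    simp_rw [← hneg] at h
    have := (integrableOn_Ici_iff_integrableOn_Ioi (f := fun t : ℝ =>
      Complex.exp (-(Complex.I * x * (-t : ℝ))) * f (-t))).2 h
    have h2 := (Measure.measurePreserving_neg (volume : Measure ℝ)).integrableOn_comp_preimage
      (Homeomorph.neg ℝ).measurableEmbedding (f := fun t : ℝ =>
        Complex.exp (-(Complex.I * x * t)) * f t) (s := Iic 0)
    refine h2.1 ?_
    simpa [Function.comp_def] using this
  have hIall : ∀ x : ℝ, Integrable (fun t : ℝ => Complex.exp (-(Complex.I * x * t)) * f t) := by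
    intro x
    rw [← integrableOn_univ, ← Iic_union_Ioi (a := (0 : ℝ))]
    exact (hIic x).union (hI x)
  have hval : ∀ x : ℝ, ∫ t : ℝ, Complex.exp (-(Complex.I * x * t)) * f t =
      ((4 * ((1 + x ^ 2) ^ 2)⁻¹ : ℝ) : ℂ) := by
    intro x
    rw [← intervalIntegral.integral_Iic_add_Ioi (hIic x) (hI x)]
    have h1 : ∫ t in Iic (0 : ℝ), Complex.exp (-(Complex.I * x * t)) * f t =
        ∫ t in Ioi (0 : ℝ), Complex.exp (-(Complex.I * (-x : ℝ) * t)) * f t := by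
      simp_rw [← hneg]
      have := integral_comp_neg_Ioi (0 : ℝ) (fun t : ℝ => Complex.exp (-(Complex.I * x * t)) * f t)
      rw [neg_zero] at this
      exact this.symm
    rw [h1, setIntegral_congr_fun measurableSet_Ioi (hpos _),
      setIntegral_congr_fun measurableSet_Ioi (hpos _), (integral_one_add_mul_cexp (hre _)).2,
      (integral_one_add_mul_cexp (hre _)).2]
    have n1 : (1 + Complex.I * x : ℂ) ≠ 0 := fun h => by
      have := hre x; rw [h] at this; simp at this
    have n2 : (1 + Complex.I * (-x : ℝ) : ℂ) ≠ 0 := fun h => by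
      have := hre (-x); rw [h] at this; simp at this
    have n3 : (1 + x ^ 2 : ℂ) = (1 + Complex.I * x) * (1 + Complex.I * (-x : ℝ)) := by
      push_cast; linear_combination (x : ℂ) ^ 2 * Complex.I_sq
    push_cast at n2 n3 ⊢
    rw [n3]
    have n4 : (1 + Complex.I * -x : ℂ) = 2 - (1 + Complex.I * x) := by ring
    rw [n4] at n2 ⊢
    generalize (1 + Complex.I * x : ℂ) = u at n1 n2
    field_simp
    ring
  have hint : Integrable (fun x : ℝ => ((1 + x ^ 2) ^ 2)⁻¹) := by
    refine Integrable.mono' integrable_inv_one_add_sq (Continuous.aestronglyMeasurable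
      (Continuous.inv₀ (by fun_prop) fun x => by positivity)) (ae_of_all _ fun x => ?_)
    rw [Real.norm_of_nonneg (by positivity)]
    refine inv_anti₀ (by positivity) ?_
    nlinarith [sq_nonneg x, sq_nonneg (x ^ 2)]
  have hF : 𝓕 f = fun ξ : ℝ => ((4 * ((1 + (2 * Real.pi * ξ) ^ 2) ^ 2)⁻¹ : ℝ) : ℂ) := by
    ext ξ
    rw [← hval, Real.fourier_eq']
    refine integral_congr_ae (ae_of_all _ fun v => ?_)
    simp only [smul_eq_mul]
    congr 2
    simp only [RCLike.inner_apply, conj_trivial]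
    push_cast; ring
  have h2pi : (2 * Real.pi) ≠ 0 := by positivity
  have hFi : Integrable (𝓕 f) := by
    rw [hF]
    exact ((hint.comp_mul_left' h2pi).const_mul 4).ofReal
  have hinv := congrFun (hfc.fourierInv_fourier_eq (by simpa using hIall 0) hFi) t
  rw [hF, Real.fourierInv_eq'] at hinv
  have hi2 : Integrable (fun v : ℝ => Complex.exp (((2 * Real.pi * inner ℝ v t : ℝ) : ℂ) * Complex.I) •
      ((4 * ((1 + (2 * Real.pi * v) ^ 2) ^ 2)⁻¹ : ℝ) : ℂ)) := by
    rw [hF] at hFi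
    refine hFi.bdd_mul (c := 1) (Continuous.aestronglyMeasurable (by fun_prop))
      (ae_of_all _ fun v => (Complex.norm_exp_ofReal_mul_I _).le)
  have h3 := congrArg Complex.re hinv
  have h4 := integral_re hi2
  simp only [RCLike.re_to_complex] at h4
  rw [← h4] at h3
  have h5 : ∀ v : ℝ, (Complex.exp (((2 * Real.pi * inner ℝ v t : ℝ) : ℂ) * Complex.I) •
      ((4 * ((1 + (2 * Real.pi * v) ^ 2) ^ 2)⁻¹ : ℝ) : ℂ)).re =
      4 * (Real.cos ((2 * Real.pi * v) * t) * ((1 + (2 * Real.pi * v) ^ 2) ^ 2)⁻¹) := by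
    intro v
    rw [smul_eq_mul, Complex.re_mul_ofReal, Complex.exp_ofReal_mul_I_re]
    simp only [RCLike.inner_apply, conj_trivial]
    rw [show 2 * Real.pi * (t * v) = 2 * Real.pi * v * t by ring]; ring
  simp_rw [h5] at h3
  rw [integral_const_mul, Measure.integral_comp_mul_left (fun y : ℝ => Real.cos (y * t) *
    ((1 + y ^ 2) ^ 2)⁻¹) (2 * Real.pi), abs_of_pos (by positivity)] at h3
  have h6 : (f t).re = (1 + |t|) * Real.exp (-|t|) := by
    simp only [f]; rw [← Complex.ofReal_mul, Complex.ofReal_re]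
  rw [h6, smul_eq_mul] at h3
  rw [← h3, ← mul_assoc, ← mul_assoc]
  have h7 : Real.pi / 2 * 4 * (2 * Real.pi)⁻¹ = 1 := by field_simp; norm_num
  rw [h7, one_mul]

/-! ### Riemann's method: Abel limits and symmetric second differences -/

/-- The second symmetric difference at `0` of `x ↦ (1 - cos (x t)) / t²`. -/
noncomputable def cosKernel (x t : ℝ) : ℝ := 2 * (1 - Real.cos (x * t)) / t ^ 2

lemma cosKernel_nonneg (x t : ℝ) : 0 ≤ cosKernel x t :=
  div_nonneg (by linarith [Real.cos_le_one (x * t)]) (sq_nonneg t)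

lemma cosKernel_le_sq (x t : ℝ) : cosKernel x t ≤ x ^ 2 := by
  rcases eq_or_ne t 0 with rfl | ht
  · simp [cosKernel, sq_nonneg]
  · unfold cosKernel
    rw [div_le_iff₀ (by positivity)]
    have := Real.one_sub_sq_div_two_le_cos (x := x * t)
    nlinarith

/-- Adds the bounds x² and 4/t². The decay in t is what makes the product with a kernel merely
bounded at infinity integrable. -/
lemma cosKernel_le (x t : ℝ) : cosKernel x t ≤ 4 * (1 + x ^ 2) * (1 + t ^ 2)⁻¹ := by
  rw [← div_eq_mul_inv, le_div_iff₀ (by positivity)]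
  have h1 := cosKernel_le_sq x t
  have h2 : cosKernel x t * t ^ 2 ≤ 4 := by
    rcases eq_or_ne t 0 with rfl | ht
    · norm_num
    · unfold cosKernel
      rw [div_mul_cancel₀ _ (by positivity)]
      linarith [Real.neg_one_le_cos (x * t)]
  nlinarith [sq_nonneg x]

lemma continuous_cosKernel_left (t : ℝ) : Continuous fun x => cosKernel x t := by
  unfold cosKernel; fun_prop

lemma IsAdmissibleKernel.integrableOn_inv_one_add_sq {a : ℝ → ℝ} (ha : IsAdmissibleKernel a) :
    IntegrableOn (fun t => |a t| * (1 + t ^ 2)⁻¹) (Ioi 0) := by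
  have hc : Continuous fun t : ℝ => (1 + t ^ 2)⁻¹ :=
    Continuous.inv₀ (by fun_prop) fun x => by positivity
  rw [← Ioc_union_Ioi_eq_Ioi zero_le_one]
  refine IntegrableOn.union ?_ ?_
  · have h1 : IntegrableOn a (Icc 0 1) :=
      ha.locallyIntegrable.integrableOn_compact_subset Icc_subset_Ici_self isCompact_Icc
    exact (IntegrableOn.mul_continuousOn h1.abs hc.continuousOn isCompact_Icc).mono_set
      Ioc_subset_Icc_self
  · exact Integrable.mul_of_top_right
      integrable_inv_one_add_sq.integrableOn ha.essBounded.abs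

lemma IsAdmissibleKernel.aestronglyMeasurable {a : ℝ → ℝ} (ha : IsAdmissibleKernel a) :
    AEStronglyMeasurable a (volume.restrict (Ioi 0)) :=
  (ha.locallyIntegrable.mono_set Ioi_subset_Ici_self).aestronglyMeasurable

/-- The formal second symmetric difference, with step `x`, of twice the antiderivative of the
boundary values of the transform. -/
noncomputable def symbolDifference (a : ℝ → ℝ) (a₁ ω x : ℝ) : ℝ :=
  a₁ * x ^ 2 + ∫ t in Ioi (0 : ℝ), a t * Real.cos (ω * t) * cosKernel x t

lemma norm_mul_cos_mul_cosKernel_le (a : ℝ → ℝ) (ω x t : ℝ) :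
    ‖a t * Real.cos (ω * t) * cosKernel x t‖ ≤ |a t| * (1 + t ^ 2)⁻¹ * (4 * (1 + x ^ 2)) := by
  rw [norm_mul, norm_mul, Real.norm_of_nonneg (cosKernel_nonneg x t), Real.norm_eq_abs,
    Real.norm_eq_abs]
  calc |a t| * |Real.cos (ω * t)| * cosKernel x t
      ≤ |a t| * 1 * (4 * (1 + x ^ 2) * (1 + t ^ 2)⁻¹) := by
        gcongr
        · exact cosKernel_nonneg x t
        · exact Real.abs_cos_le_one _
        · exact cosKernel_le x t
    _ = _ := by ring

lemma integrableOn_mul_cos_mul_cosKernel {a : ℝ → ℝ} (ha : IsAdmissibleKernel a) (ω x : ℝ) :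
    IntegrableOn (fun t => a t * Real.cos (ω * t) * cosKernel x t) (Ioi 0) := by
  refine Integrable.mono' (ha.integrableOn_inv_one_add_sq.mul_const _) ?_
    (ae_of_all _ fun t => norm_mul_cos_mul_cosKernel_le a ω x t)
  have h1 : Measurable fun t => Real.cos (ω * t) := by fun_prop
  have h2 : Measurable fun t => cosKernel x t := by unfold cosKernel; fun_prop
  exact (ha.aestronglyMeasurable.fun_mul h1.aestronglyMeasurable).fun_mul h2.aestronglyMeasurable

lemma abs_symbolDifference_le {a : ℝ → ℝ} (ha : IsAdmissibleKernel a) (a₁ ω : ℝ) :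
    ∃ C, 0 ≤ C ∧ ∀ x, |symbolDifference a a₁ ω x| ≤ C * (1 + x ^ 2) := by
  refine ⟨|a₁| + 4 * ∫ t in Ioi (0 : ℝ), |a t| * (1 + t ^ 2)⁻¹, ?_, fun x => ?_⟩
  · have : 0 ≤ ∫ t in Ioi (0 : ℝ), |a t| * (1 + t ^ 2)⁻¹ :=
      integral_nonneg fun t => by positivity
    positivity
  · have h1 : |∫ t in Ioi (0 : ℝ), a t * Real.cos (ω * t) * cosKernel x t| ≤
        (∫ t in Ioi (0 : ℝ), |a t| * (1 + t ^ 2)⁻¹) * (4 * (1 + x ^ 2)) := by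
      rw [← integral_mul_const, ← Real.norm_eq_abs]
      exact norm_integral_le_of_norm_le (ha.integrableOn_inv_one_add_sq.mul_const _)
        (ae_of_all _ fun t => norm_mul_cos_mul_cosKernel_le a ω x t)
    unfold symbolDifference
    have h2 := abs_add_le (a₁ * x ^ 2) (∫ t in Ioi (0 : ℝ), a t * Real.cos (ω * t) * cosKernel x t)
    have h3 : |a₁ * x ^ 2| ≤ |a₁| * (1 + x ^ 2) := by
      rw [abs_mul, abs_of_nonneg (sq_nonneg x)]
      gcongr; linarith
    nlinarith

lemma continuous_symbolDifference {a : ℝ → ℝ} (ha : IsAdmissibleKernel a) (a₁ ω : ℝ) :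
    Continuous (symbolDifference a a₁ ω) := by
  unfold symbolDifference
  refine Continuous.add (by fun_prop) ?_
  rw [continuous_iff_continuousAt]
  intro x₀
  refine continuousAt_of_dominated
    (bound := fun t => |a t| * (1 + t ^ 2)⁻¹ * (4 * (1 + (|x₀| + 1) ^ 2))) ?_ ?_
    (ha.integrableOn_inv_one_add_sq.mul_const _) ?_
  · exact Eventually.of_forall fun x => (integrableOn_mul_cos_mul_cosKernel ha ω x).1
  · filter_upwards [Metric.ball_mem_nhds x₀ one_pos] with x hx
    refine ae_of_all _ fun t => (norm_mul_cos_mul_cosKernel_le a ω x t).trans ?_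
    have h1 : |x| ≤ |x₀| + 1 := by
      rw [Metric.mem_ball, Real.dist_eq] at hx
      linarith [abs_sub_abs_le_abs_sub x x₀]
    have h2 : x ^ 2 ≤ (|x₀| + 1) ^ 2 := by
      rw [← sq_abs x]; gcongr
    gcongr
  · exact ae_of_all _ fun t => ((continuous_cosKernel_left t).const_mul _).continuousAt

/-- `∫₀¹ σ e^{-σ y} dσ`, the weight relating Abel means to second symmetric differences. -/
noncomputable def abelWeight (y : ℝ) : ℝ := ∫ σ in (0 : ℝ)..1, σ * Real.exp (-(σ * y))

/-- This identity motivates the weight (1 + x²)⁻²: averaging 1 − cos(xy) against it gives, for y ≥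
0, π/2 times the right-hand side, and hence y² times a positive mixture of exponentials. -/
lemma sq_mul_abelWeight (y : ℝ) : y ^ 2 * abelWeight y = 1 - (1 + y) * Real.exp (-y) := by
  have hd : ∀ σ ∈ uIcc (0 : ℝ) 1, HasDerivAt (fun σ : ℝ => -((1 + σ * y) * Real.exp (-(σ * y))))
      (y ^ 2 * (σ * Real.exp (-(σ * y)))) σ := by
    intro σ _
    have h1 : HasDerivAt (fun σ : ℝ => σ * y) y σ := by
      simpa using (hasDerivAt_id σ).mul_const y
    refine ((h1.const_add 1).mul h1.neg.exp).neg.congr_deriv ?_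
    simp only [Pi.neg_apply]; ring
  have h := intervalIntegral.integral_eq_sub_of_hasDerivAt hd
    (Continuous.intervalIntegrable (by fun_prop) _ _)
  unfold abelWeight
  rw [← intervalIntegral.integral_const_mul, h]
  simp
  ring

lemma abelWeight_nonneg (y : ℝ) : 0 ≤ abelWeight y :=
  intervalIntegral.integral_nonneg zero_le_one fun _ hσ => mul_nonneg hσ.1 (Real.exp_nonneg _)

lemma abelWeight_le {y : ℝ} (hy : 0 ≤ y) : abelWeight y ≤ 1 := by
  have h : abelWeight y ≤ ∫ σ in (0 : ℝ)..1, (1 : ℝ) := by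
    refine intervalIntegral.integral_mono_on zero_le_one
      (Continuous.intervalIntegrable (by fun_prop) _ _) (by simp) fun σ hσ => ?_
    exact mul_le_one₀ hσ.2 (Real.exp_nonneg _)
      (Real.exp_le_one_iff.2 (by have := mul_nonneg hσ.1 hy; linarith))
  simpa using h

lemma integrable_inv_one_add_sq_sq : Integrable (fun x : ℝ => ((1 + x ^ 2) ^ 2)⁻¹) := by
  refine Integrable.mono' integrable_inv_one_add_sq (Continuous.aestronglyMeasurable
    (Continuous.inv₀ (by fun_prop) fun x => by positivity)) (ae_of_all _ fun x => ?_)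
  rw [Real.norm_of_nonneg (by positivity)]
  refine inv_anti₀ (by positivity) ?_
  nlinarith [sq_nonneg x, sq_nonneg (x ^ 2)]

lemma integral_inv_one_add_sq_sq : ∫ x : ℝ, ((1 + x ^ 2) ^ 2)⁻¹ = Real.pi / 2 := by
  have := integral_cos_div_sq 0
  simpa using this

lemma integral_sq_mul_inv : Integrable (fun x : ℝ => x ^ 2 * ((1 + x ^ 2) ^ 2)⁻¹) ∧
    ∫ x : ℝ, x ^ 2 * ((1 + x ^ 2) ^ 2)⁻¹ = Real.pi / 2 := by
  have e : ∀ x : ℝ, x ^ 2 * ((1 + x ^ 2) ^ 2)⁻¹ = (1 + x ^ 2)⁻¹ - ((1 + x ^ 2) ^ 2)⁻¹ := by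
    intro x
    have : (1 + x ^ 2) ≠ 0 := by positivity
    field_simp; ring
  simp_rw [e]
  refine ⟨integrable_inv_one_add_sq.sub integrable_inv_one_add_sq_sq, ?_⟩
  rw [integral_sub integrable_inv_one_add_sq integrable_inv_one_add_sq_sq,
    integral_univ_inv_one_add_sq, integral_inv_one_add_sq_sq]
  ring

lemma integral_cosKernel {h t : ℝ} (hh : 0 < h) (ht : 0 < t) :
    ∫ x : ℝ, cosKernel (h * x) t * ((1 + x ^ 2) ^ 2)⁻¹ = Real.pi * h ^ 2 * abelWeight (h * t) := by
  have e : ∀ x : ℝ, cosKernel (h * x) t * ((1 + x ^ 2) ^ 2)⁻¹ =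
      2 / t ^ 2 * (((1 + x ^ 2) ^ 2)⁻¹ - Real.cos (x * (h * t)) * ((1 + x ^ 2) ^ 2)⁻¹) := by
    intro x
    unfold cosKernel
    rw [show h * x * t = x * (h * t) by ring]; ring
  have hi : Integrable fun x : ℝ => Real.cos (x * (h * t)) * ((1 + x ^ 2) ^ 2)⁻¹ :=
    integrable_inv_one_add_sq_sq.bdd_mul (c := 1) (Continuous.aestronglyMeasurable (by fun_prop))
      (ae_of_all _ fun x => Real.abs_cos_le_one _)
  simp_rw [e]
  rw [integral_const_mul, integral_sub integrable_inv_one_add_sq_sq hi,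
    integral_inv_one_add_sq_sq, integral_cos_div_sq, abs_of_pos (mul_pos hh ht)]
  have h1 := sq_mul_abelWeight (h * t)
  have ht0 := ht.ne'
  have h2 : 2 / t ^ 2 * (Real.pi / 2 - Real.pi / 2 * ((1 + h * t) * Real.exp (-(h * t)))) =
      Real.pi / t ^ 2 * (1 - (1 + h * t) * Real.exp (-(h * t))) := by ring
  rw [h2, ← h1]
  field_simp

lemma inv_sq_bound (h x : ℝ) : (1 + (h * x) ^ 2) * ((1 + x ^ 2) ^ 2)⁻¹ ≤
    (1 + h ^ 2) * (1 + x ^ 2)⁻¹ := by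
  have : (1 + h ^ 2) * (1 + x ^ 2)⁻¹ = (1 + h ^ 2) * (1 + x ^ 2) * ((1 + x ^ 2) ^ 2)⁻¹ := by
    have : (1 + x ^ 2) ≠ 0 := by positivity
    field_simp
  rw [this]
  gcongr
  nlinarith [sq_nonneg h, sq_nonneg x]

/-- Fubini and `integral_cosKernel`. Second differences at scale h average to h² times Abel means at
heights σh, 0 < σ ≤ 1, with weight σ; the weight (1 + x²)⁻² is needed because `symbolDifference` may
grow quadratically. -/
lemma integral_symbolDifference_eq {a : ℝ → ℝ} (ha : IsAdmissibleKernel a) (a₁ ω : ℝ) {h : ℝ}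
    (hh : 0 < h) :
    ∫ x : ℝ, symbolDifference a a₁ ω (h * x) * ((1 + x ^ 2) ^ 2)⁻¹ =
      Real.pi * h ^ 2 * (a₁ / 2 +
        ∫ t in Ioi (0 : ℝ), a t * Real.cos (ω * t) * abelWeight (h * t)) := by
  have hprod : Integrable (Function.uncurry fun (x t : ℝ) =>
      a t * Real.cos (ω * t) * cosKernel (h * x) t * ((1 + x ^ 2) ^ 2)⁻¹)
      (volume.prod (volume.restrict (Ioi 0))) := by
    refine Integrable.mono' ((integrable_inv_one_add_sq.mul_prod
      ha.integrableOn_inv_one_add_sq).const_mul (4 * (1 + h ^ 2))) ?_ (ae_of_all _ fun p => ?_)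
    · have h1 : AEStronglyMeasurable (fun p : ℝ × ℝ => a p.2)
          (volume.prod (volume.restrict (Ioi 0))) := ha.aestronglyMeasurable.comp_snd
      have h2 : Measurable fun p : ℝ × ℝ => cosKernel (h * p.1) p.2 := by
        unfold cosKernel; fun_prop
      have h3 : Measurable fun p : ℝ × ℝ => Real.cos (ω * p.2) := by fun_prop
      have h4 : Measurable fun p : ℝ × ℝ => ((1 + p.1 ^ 2) ^ 2)⁻¹ := by fun_prop
      exact ((h1.fun_mul h3.aestronglyMeasurable).fun_mul h2.aestronglyMeasurable).fun_mul
        h4.aestronglyMeasurable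
    · simp only [Function.uncurry]
      rw [norm_mul, Real.norm_of_nonneg (by positivity : (0 : ℝ) ≤ ((1 + p.1 ^ 2) ^ 2)⁻¹)]
      calc _ ≤ |a p.2| * (1 + p.2 ^ 2)⁻¹ * (4 * (1 + (h * p.1) ^ 2)) * ((1 + p.1 ^ 2) ^ 2)⁻¹ := by
            gcongr
            exact norm_mul_cos_mul_cosKernel_le a ω _ _
        _ = 4 * (|a p.2| * (1 + p.2 ^ 2)⁻¹) * ((1 + (h * p.1) ^ 2) * ((1 + p.1 ^ 2) ^ 2)⁻¹) := by
            ring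
        _ ≤ 4 * (|a p.2| * (1 + p.2 ^ 2)⁻¹) * ((1 + h ^ 2) * (1 + p.1 ^ 2)⁻¹) := by
            gcongr ?_ * ?_
            exact inv_sq_bound h p.1
        _ = _ := by ring
  have hsw := integral_integral_swap hprod
  have e1 : ∀ x : ℝ, symbolDifference a a₁ ω (h * x) * ((1 + x ^ 2) ^ 2)⁻¹ =
      a₁ * h ^ 2 * (x ^ 2 * ((1 + x ^ 2) ^ 2)⁻¹) + ∫ t in Ioi (0 : ℝ),
        a t * Real.cos (ω * t) * cosKernel (h * x) t * ((1 + x ^ 2) ^ 2)⁻¹ := by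
    intro x
    rw [integral_mul_const]
    unfold symbolDifference
    ring
  have hi := hprod.integral_prod_left
  simp only [Function.uncurry] at hi
  simp_rw [e1]
  rw [integral_add (integral_sq_mul_inv.1.const_mul _) hi,
    integral_const_mul, integral_sq_mul_inv.2, hsw]
  have e2 : ∫ t in Ioi (0 : ℝ), ∫ x : ℝ, a t * Real.cos (ω * t) * cosKernel (h * x) t *
      ((1 + x ^ 2) ^ 2)⁻¹ = Real.pi * h ^ 2 *
        ∫ t in Ioi (0 : ℝ), a t * Real.cos (ω * t) * abelWeight (h * t) := by
    rw [← integral_const_mul]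
    refine setIntegral_congr_fun measurableSet_Ioi fun t ht => ?_
    simp only [mul_assoc, integral_const_mul]
    rw [integral_cosKernel hh ht]; ring
  rw [e2]; ring

lemma re_laplaceTransform {a : ℝ → ℝ} (ha : IsAdmissibleKernel a) {h : ℝ} (hh : 0 < h) (ω : ℝ) :
    (laplaceTransform a ((h : ℂ) + Complex.I * ω)).re =
      ∫ t in Ioi (0 : ℝ), Real.exp (-(h * t)) * Real.cos (ω * t) * a t := by
  have e : ∀ t : ℝ, Complex.exp (-(((h : ℂ) + Complex.I * ω) * t)) * (a t : ℂ) =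
      ((Real.exp (-(h * t)) * a t : ℝ) : ℂ) *
        Complex.exp (((-(ω * t) : ℝ) : ℂ) * Complex.I) := by
    intro t
    have : -(((h : ℂ) + Complex.I * ω) * t) = ((-(h * t) : ℝ) : ℂ) +
      ((-(ω * t) : ℝ) : ℂ) * Complex.I := by push_cast; ring
    rw [this, Complex.exp_add]; push_cast; ring
  unfold laplaceTransform
  simp_rw [e]
  have hi : IntegrableOn (fun t : ℝ => ((Real.exp (-(h * t)) * a t : ℝ) : ℂ) *
        Complex.exp (((-(ω * t) : ℝ) : ℂ) * Complex.I)) (Ioi 0) :=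
    (ha.integrableOn_exp hh).ofReal.mul_bdd (c := 1) (Continuous.aestronglyMeasurable (by fun_prop))
      (ae_of_all _ fun t => (Complex.norm_exp_ofReal_mul_I _).le)
  have := integral_re hi
  simp only [RCLike.re_to_complex] at this
  rw [← this]
  refine integral_congr_ae (ae_of_all _ fun t => ?_)
  simp only [Complex.re_ofReal_mul, Complex.exp_ofReal_mul_I_re, Real.cos_neg]
  ring

/-- Lower bounds for Abel means pass to their weighted averages. -/
lemma le_integral_abelWeight {a : ℝ → ℝ} (ha : IsAdmissibleKernel a) {a₁ ω m h : ℝ} (hh : 0 < h)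
    (hm : ∀ η, 0 < η → η ≤ h →
      m ≤ a₁ + (laplaceTransform a ((η : ℂ) + Complex.I * ω)).re) :
    m / 2 ≤ a₁ / 2 + ∫ t in Ioi (0 : ℝ), a t * Real.cos (ω * t) * abelWeight (h * t) := by
  have hnonneg : ∀ t ∈ Ioi (0 : ℝ), abelWeight (h * t) ≤ (2 / h ^ 2 + 2) * (1 + t ^ 2)⁻¹ := by
    intro t ht
    have ht' := mul_pos hh (mem_Ioi.1 ht)
    rw [← div_eq_mul_inv, le_div_iff₀ (by positivity)]
    have h1 := abelWeight_le ht'.le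
    have h2 : (h * t) ^ 2 * abelWeight (h * t) ≤ 1 := by
      rw [sq_mul_abelWeight]
      have : 0 ≤ (1 + h * t) * Real.exp (-(h * t)) := by positivity
      linarith
    have h3 : abelWeight (h * t) * t ^ 2 ≤ 1 / h ^ 2 := by
      rw [le_div_iff₀ (by positivity)]; linarith
    have h4 : 0 ≤ 1 / h ^ 2 := by positivity
    have h5 : 2 / h ^ 2 = 2 * (1 / h ^ 2) := by ring
    rw [h5]; linarith
  have hmeas : AEStronglyMeasurable (fun p : ℝ × ℝ => a p.2 * Real.cos (ω * p.2) *
      (p.1 * Real.exp (-(p.1 * (h * p.2)))))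
      ((volume.restrict (Ioc 0 1)).prod (volume.restrict (Ioi 0))) :=
    (AEStronglyMeasurable.mul ha.aestronglyMeasurable.comp_snd
      (Continuous.aestronglyMeasurable (by fun_prop))).mul
      (Continuous.aestronglyMeasurable (by fun_prop))
  have hprod : Integrable (Function.uncurry fun (σ t : ℝ) => a t * Real.cos (ω * t) *
      (σ * Real.exp (-(σ * (h * t)))))
      ((volume.restrict (Ioc 0 1)).prod (volume.restrict (Ioi 0))) := by
    refine (integrable_prod_iff' hmeas).2 ⟨ae_of_all _ fun t => ?_, ?_⟩
    · have : Continuous fun σ : ℝ => a t * Real.cos (ω * t) * (σ * Real.exp (-(σ * (h * t)))) := by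
        fun_prop
      exact this.integrableOn_Icc.mono_set Ioc_subset_Icc_self
    · refine Integrable.mono' (ha.integrableOn_inv_one_add_sq.mul_const (2 / h ^ 2 + 2)) ?_ ?_
      · exact hmeas.norm.prod_swap.integral_prod_right'
      · refine (ae_restrict_iff' measurableSet_Ioi).2 (ae_of_all _ fun t ht => ?_)
        rw [Real.norm_of_nonneg (integral_nonneg fun σ => norm_nonneg _)]
        have e : ∫ σ in Ioc (0 : ℝ) 1, ‖Function.uncurry (fun (σ t : ℝ) => a t * Real.cos (ω * t) *
            (σ * Real.exp (-(σ * (h * t))))) (σ, t)‖ =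
            |a t * Real.cos (ω * t)| * abelWeight (h * t) := by
          unfold abelWeight
          rw [intervalIntegral.integral_of_le zero_le_one, ← integral_const_mul]
          refine setIntegral_congr_fun measurableSet_Ioc fun σ hσ => ?_
          simp only [Function.uncurry, norm_mul, Real.norm_eq_abs, abs_mul, abs_of_pos hσ.1,
            Real.abs_exp]
        have e' := e
        simp only [Function.uncurry] at e' ⊢
        rw [e', abs_mul]
        calc |a t| * |Real.cos (ω * t)| * abelWeight (h * t)
            ≤ |a t| * 1 * ((2 / h ^ 2 + 2) * (1 + t ^ 2)⁻¹) := by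
              gcongr
              · exact abelWeight_nonneg _
              · exact Real.abs_cos_le_one _
              · exact hnonneg t ht
          _ = _ := by ring
  have hsw := integral_integral_swap hprod
  have e2 : ∫ t in Ioi (0 : ℝ), ∫ σ in Ioc (0 : ℝ) 1, a t * Real.cos (ω * t) *
      (σ * Real.exp (-(σ * (h * t)))) =
      ∫ t in Ioi (0 : ℝ), a t * Real.cos (ω * t) * abelWeight (h * t) := by
    refine integral_congr_ae (ae_of_all _ fun t => ?_)
    simp only [abelWeight, intervalIntegral.integral_of_le (zero_le_one' ℝ), integral_const_mul]
  rw [← e2, ← hsw]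
  have hi := hprod.integral_prod_left
  simp only [Function.uncurry] at hi
  have hσ : ∀ c : ℝ, IntegrableOn (fun σ : ℝ => σ * c) (Ioc 0 1) := fun c =>
    (Continuous.integrableOn_Icc (by fun_prop)).mono_set Ioc_subset_Icc_self
  have hc : ∀ c : ℝ, ∫ σ in Ioc (0 : ℝ) 1, σ * c = c / 2 := by
    intro c
    rw [← intervalIntegral.integral_of_le zero_le_one, intervalIntegral.integral_mul_const,
      integral_id]
    ring
  -- Since ∫₀¹ σ dσ = 1/2, both constants can be spread over (0, 1] with weight σ, which reduces the
  -- claim to the hypothesis at η = σh.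
  rw [← hc a₁, ← hc m, ← integral_add (hσ a₁) hi]
  refine setIntegral_mono_on (hσ m) ((hσ a₁).add hi) measurableSet_Ioc fun σ hσ' => ?_
  have h1 := hm (σ * h) (mul_pos hσ'.1 hh) (mul_le_of_le_one_left hh.le hσ'.2)
  rw [re_laplaceTransform ha (mul_pos hσ'.1 hh)] at h1
  have h2 : ∫ t in Ioi (0 : ℝ), a t * Real.cos (ω * t) * (σ * Real.exp (-(σ * (h * t)))) =
      σ * ∫ t in Ioi (0 : ℝ), Real.exp (-(σ * h * t)) * Real.cos (ω * t) * a t := by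
    rw [← integral_const_mul]
    refine integral_congr_ae (ae_of_all _ fun t => ?_)
    simp only
    rw [mul_assoc σ h t]; ring
  rw [h2]
  nlinarith [hσ'.1]

/-- If the Abel means are bounded below by a positive constant, the symmetric second differences
cannot be nonpositive for all small steps. -/
lemma exists_symbolDifference_pos {a : ℝ → ℝ} (ha : IsAdmissibleKernel a) {a₁ ω m h₀ : ℝ}
    (hm : 0 < m) (hh₀ : 0 < h₀)
    (hbound : ∀ η, 0 < η → η ≤ h₀ → m ≤ a₁ + (laplaceTransform a ((η : ℂ) + Complex.I * ω)).re)
    {δ : ℝ} (hδ : 0 < δ) : ∃ x, |x| ≤ δ ∧ 0 < symbolDifference a a₁ ω x := by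
  by_contra! hneg
  obtain ⟨C, hC0, hC⟩ := abs_symbolDifference_le ha a₁ ω
  -- Chosen so that C(1 + y²) ≤ C′y² when |y| > δ. At y = hx this extracts the factor h² needed to
  -- compare with the averaged identity.
  set C' : ℝ := C * (1 / δ ^ 2 + 1) with hC'
  have hC'0 : 0 ≤ C' := by positivity
  -- Small steps contribute nonpositively by assumption, so h²·B dominates the average. Its support
  -- escapes to infinity, so ∫B → 0 as h → 0, against the lower bound πm/2.
  let B : ℝ → ℝ → ℝ := fun h x => {x : ℝ | δ < |h * x|}.indicator (fun x => C' * (1 + x ^ 2)⁻¹) x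
  have hmeas : ∀ h : ℝ, MeasurableSet {x : ℝ | δ < |h * x|} := fun h =>
    (isOpen_lt continuous_const (by fun_prop)).measurableSet
  have hBi : ∀ h, Integrable (B h) := fun h =>
    (integrable_inv_one_add_sq.const_mul C').indicator (hmeas h)
  have hBlim : Tendsto (fun h => ∫ x, B h x) (𝓝[>] 0) (𝓝 0) := by
    have : Tendsto (fun h => ∫ x, B h x) (𝓝[>] 0) (𝓝 (∫ _ : ℝ, (0 : ℝ))) := by
      refine tendsto_integral_filter_of_dominated_convergence (fun x => C' * (1 + x ^ 2)⁻¹)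
        (Eventually.of_forall fun h => (hBi h).1) (Eventually.of_forall fun h => ae_of_all _ fun x => ?_)
        (integrable_inv_one_add_sq.const_mul C') (ae_of_all _ fun x => ?_)
      · exact (norm_indicator_le_norm_self _ _).trans
          (by rw [Real.norm_of_nonneg (by positivity)])
      · refine tendsto_const_nhds.congr' ?_
        have h1 : Tendsto (fun h : ℝ => |h * x|) (𝓝[>] 0) (𝓝 0) := by
          have : Continuous fun h : ℝ => |h * x| := by fun_prop
          have h2 := this.tendsto 0
          rw [zero_mul, abs_zero] at h2
          exact h2.mono_left nhdsWithin_le_nhds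
        filter_upwards [h1.eventually_lt_const hδ] with h hh
        exact (indicator_of_notMem (by simpa using hh.le) _).symm
    simpa using this
  have hev : ∀ᶠ h in 𝓝[>] (0 : ℝ), Real.pi * m / 2 ≤ ∫ x, B h x := by
    filter_upwards [Ioc_mem_nhdsGT hh₀] with h hh
    have h1 := le_integral_abelWeight ha hh.1 fun η h0 h1 => hbound η h0 (h1.trans hh.2)
    have h2 := integral_symbolDifference_eq ha a₁ ω hh.1
    have hle : ∀ x : ℝ, symbolDifference a a₁ ω (h * x) * ((1 + x ^ 2) ^ 2)⁻¹ ≤ h ^ 2 * B h x := by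
      intro x
      by_cases hx : δ < |h * x|
      · have e : B h x = C' * (1 + x ^ 2)⁻¹ := indicator_of_mem (by exact hx) _
        rw [e]
        have h3 : 1 ≤ 1 / δ ^ 2 * (h * x) ^ 2 := by
          rw [one_div, ← div_eq_inv_mul, one_le_div (by positivity), ← sq_abs (h * x)]
          gcongr
        have h4 : symbolDifference a a₁ ω (h * x) ≤ C' * (h ^ 2 * x ^ 2) := by
          calc _ ≤ C * (1 + (h * x) ^ 2) := (le_abs_self _).trans (hC _)
            _ ≤ C * (1 / δ ^ 2 * (h * x) ^ 2 + (h * x) ^ 2) := by gcongr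
            _ = _ := by rw [hC']; ring
        have h5 : x ^ 2 * ((1 + x ^ 2) ^ 2)⁻¹ ≤ (1 + x ^ 2)⁻¹ := by
          have := inv_sq_bound 1 x
          have h6 : x ^ 2 * ((1 + x ^ 2) ^ 2)⁻¹ = (1 + x ^ 2)⁻¹ - ((1 + x ^ 2) ^ 2)⁻¹ := by
            have : (1 + x ^ 2) ≠ 0 := by positivity
            field_simp; ring
          have : 0 ≤ ((1 + x ^ 2) ^ 2)⁻¹ := by positivity
          linarith
        calc _ ≤ C' * (h ^ 2 * x ^ 2) * ((1 + x ^ 2) ^ 2)⁻¹ := by gcongr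
          _ = C' * h ^ 2 * (x ^ 2 * ((1 + x ^ 2) ^ 2)⁻¹) := by ring
          _ ≤ C' * h ^ 2 * (1 + x ^ 2)⁻¹ := by gcongr
          _ = _ := by ring
      · have e : B h x = 0 := indicator_of_notMem (by simpa using hx) _
        rw [e, mul_zero]
        exact mul_nonpos_of_nonpos_of_nonneg (hneg _ (not_lt.1 hx)) (by positivity)
    have hint : Integrable fun x : ℝ =>
        symbolDifference a a₁ ω (h * x) * ((1 + x ^ 2) ^ 2)⁻¹ := by
      have hc := (continuous_symbolDifference ha a₁ ω).comp (continuous_const_mul h)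
      have hc2 : Continuous fun x : ℝ => ((1 + x ^ 2) ^ 2)⁻¹ :=
        Continuous.inv₀ (by fun_prop) fun x => by positivity
      refine Integrable.mono' (integrable_inv_one_add_sq.const_mul (C * (1 + h ^ 2)))
        (hc.mul hc2).aestronglyMeasurable (ae_of_all _ fun x => ?_)
      rw [norm_mul, Real.norm_of_nonneg (by positivity : (0 : ℝ) ≤ ((1 + x ^ 2) ^ 2)⁻¹)]
      calc _ ≤ C * (1 + (h * x) ^ 2) * ((1 + x ^ 2) ^ 2)⁻¹ := by gcongr; exact hC _
        _ = C * ((1 + (h * x) ^ 2) * ((1 + x ^ 2) ^ 2)⁻¹) := by ring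
        _ ≤ C * ((1 + h ^ 2) * (1 + x ^ 2)⁻¹) := by gcongr ?_ * ?_; exact inv_sq_bound h x
        _ = _ := by ring
    have h7 := integral_mono hint ((hBi h).const_mul (h ^ 2)) hle
    rw [h2, integral_const_mul] at h7
    have hh2 : 0 < h ^ 2 := pow_pos hh.1 2
    have h8 : Real.pi * (m / 2) ≤ ∫ x, B h x := by
      refine le_of_mul_le_mul_left ?_ hh2
      calc h ^ 2 * (Real.pi * (m / 2)) = Real.pi * h ^ 2 * (m / 2) := by ring
        _ ≤ _ := mul_le_mul_of_nonneg_left h1 (by positivity)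
        _ ≤ _ := h7
    linarith
  have := ge_of_tendsto hBlim hev
  have := mul_pos Real.pi_pos hm
  linarith

/-- A continuous function whose symmetric second differences are positive for arbitrarily small
steps is midpoint convex. -/
lemma second_difference_nonneg {f : ℝ → ℝ} (hf : Continuous f)
    (h : ∀ ω δ : ℝ, 0 < δ → ∃ x, |x| ≤ δ ∧ 0 < f (ω + x) + f (ω - x) - 2 * f ω) (ω k : ℝ)
    (hk : 0 < k) : 0 ≤ f (ω + k) + f (ω - k) - 2 * f ω := by
  by_contra! hneg
  -- Chord slope: subtracting s·y equalises the two end values. If the difference is negative, ω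
  -- lies above both ends, so the maximum is interior, where a positive second difference is
  -- impossible.
  set s : ℝ := (f (ω + k) - f (ω - k)) / (2 * k) with hs
  have hsk : s * (2 * k) = f (ω + k) - f (ω - k) := by
    rw [hs]; field_simp
  let L : ℝ → ℝ := fun y => f y - s * y
  have hL : Continuous L := by fun_prop
  obtain ⟨y, hy, hmax⟩ := (isCompact_Icc (a := ω - k) (b := ω + k)).exists_isMaxOn
    ⟨ω, by constructor <;> linarith⟩ hL.continuousOn
  have h0 : L ω ≤ L y := hmax ⟨by linarith, by linarith⟩
  have e1 : L (ω - k) < L ω := by simp only [L]; nlinarith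
  have e2 : L (ω + k) < L ω := by simp only [L]; nlinarith
  have hy1 : ω - k < y := lt_of_le_of_ne hy.1 fun hh => by rw [← hh] at h0; linarith
  have hy2 : y < ω + k := lt_of_le_of_ne hy.2 fun hh => by rw [hh] at h0; linarith
  obtain ⟨x, hx, hpos⟩ := h y (min (y - (ω - k)) (ω + k - y))
    (lt_min (by linarith) (by linarith))
  have hx' := abs_le.1 hx
  have m1 := min_le_left (y - (ω - k)) (ω + k - y)
  have m2 := min_le_right (y - (ω - k)) (ω + k - y)
  have l1 : L (y + x) ≤ L y := hmax ⟨by linarith, by linarith⟩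
  have l2 : L (y - x) ≤ L y := hmax ⟨by linarith, by linarith⟩
  simp only [L] at l1 l2
  nlinarith

/-- The addition formulas for cosine. All base points ω are thereby governed by a single continuous
function, to which the convexity criterion applies. -/
lemma symbolDifference_zero_second_difference {a : ℝ → ℝ} (ha : IsAdmissibleKernel a)
    (a₁ ω x : ℝ) :
    symbolDifference a a₁ 0 (ω + x) + symbolDifference a a₁ 0 (ω - x) -
      2 * symbolDifference a a₁ 0 ω = 2 * symbolDifference a a₁ ω x := by
  have h1 := integrableOn_mul_cos_mul_cosKernel ha 0 (ω + x)
  have h2 := integrableOn_mul_cos_mul_cosKernel ha 0 (ω - x)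
  have h3 := integrableOn_mul_cos_mul_cosKernel ha 0 ω
  have h4 : (∫ t in Ioi (0 : ℝ), a t * Real.cos (0 * t) * cosKernel (ω + x) t) +
      (∫ t in Ioi (0 : ℝ), a t * Real.cos (0 * t) * cosKernel (ω - x) t) -
      2 * (∫ t in Ioi (0 : ℝ), a t * Real.cos (0 * t) * cosKernel ω t) =
      2 * ∫ t in Ioi (0 : ℝ), a t * Real.cos (ω * t) * cosKernel x t := by
    rw [← integral_const_mul, ← integral_const_mul, ← integral_add h1 h2,
      ← integral_sub (h1.fun_add h2) (h3.const_mul 2)]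
    refine integral_congr_ae (ae_of_all _ fun t => ?_)
    simp only [cosKernel, zero_mul, Real.cos_zero, mul_one, add_mul, sub_mul,
      Real.cos_add, Real.cos_sub]
    ring
  unfold symbolDifference
  linear_combination h4

/-- Nonnegativity of the boundary Abel limits gives nonnegativity of the second differences. -/
lemma symbolDifference_nonneg {a : ℝ → ℝ} (ha : IsAdmissibleKernel a) {a₀ : ℝ}
    (hlim : ∀ ω : ℝ, ∃ L : EReal, 0 ≤ L ∧ Tendsto (fun h : ℝ =>
      ((a₀ + (laplaceTransform a ((h : ℂ) + Complex.I * (ω : ℂ))).re : ℝ) : EReal))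
      (𝓝[>] (0 : ℝ)) (𝓝 L)) (ω : ℝ) {k : ℝ} (hk : 0 < k) :
    0 ≤ symbolDifference a a₀ ω k := by
  -- Raising a₀ by ε makes the Abel means eventually at least ε/2, the strict positivity required by
  -- the second-difference argument.
  have key : ∀ ε : ℝ, 0 < ε → 0 ≤ symbolDifference a (a₀ + ε) ω k := by
    intro ε hε
    have h1 := second_difference_nonneg (continuous_symbolDifference ha (a₀ + ε) 0) ?_ ω k hk
    · rw [symbolDifference_zero_second_difference ha] at h1
      linarith
    · intro ω δ hδ
      obtain ⟨L, hL, ht⟩ := hlim ω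
      have hlt : ((-(ε / 2) : ℝ) : EReal) < L := lt_of_lt_of_le
        (by exact_mod_cast (by linarith : (-(ε / 2) : ℝ) < 0)) hL
      have hev := ht.eventually_const_lt hlt
      obtain ⟨h₀, hh₀, hsub⟩ := mem_nhdsGT_iff_exists_Ioc_subset.1 hev
      obtain ⟨x, hx, hpos⟩ := exists_symbolDifference_pos ha (a₁ := a₀ + ε) (ω := ω)
        (half_pos hε) hh₀ (fun η h0 h1 => by
          have h2 : ((-(ε / 2) : ℝ) : EReal) < ((a₀ + (laplaceTransform a
            ((η : ℂ) + Complex.I * (ω : ℂ))).re : ℝ) : EReal) := hsub ⟨h0, h1⟩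
          have h3 := EReal.coe_lt_coe_iff.1 h2
          linarith) hδ
      refine ⟨x, hx, ?_⟩
      rw [symbolDifference_zero_second_difference ha]
      linarith
  refine le_of_forall_pos_le_add fun ε hε => ?_
  have hk2 : 0 < k ^ 2 := pow_pos hk 2
  have h1 := key (ε / k ^ 2) (div_pos hε hk2)
  have h2 : symbolDifference a (a₀ + ε / k ^ 2) ω k = symbolDifference a a₀ ω k + ε := by
    unfold symbolDifference
    field_simp
    ring
  linarith

/-! ### Positivity of pairings from Abel limits alone -/

lemma tendsto_cosKernel_div {t : ℝ} (ht : 0 < t) :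
    Tendsto (fun k => cosKernel k t / k ^ 2) (𝓝[>] 0) (𝓝 1) := by
  -- 5/48 is twice the constant 5/96 of `Real.cos_bound`.
  have hlow : Tendsto (fun k : ℝ => 1 - (k * t) ^ 2 * (5 / 48)) (𝓝[>] 0) (𝓝 1) := by
    have : Continuous fun k : ℝ => 1 - (k * t) ^ 2 * (5 / 48) := by fun_prop
    have h := this.tendsto 0
    simp only [zero_mul, ne_eq, OfNat.ofNat_ne_zero, not_false_eq_true, zero_pow, sub_zero] at h
    exact h.mono_left nhdsWithin_le_nhds
  refine tendsto_of_tendsto_of_tendsto_of_le_of_le' hlow tendsto_const_nhds ?_ ?_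
  · filter_upwards [Ioc_mem_nhdsGT (inv_pos.2 ht)] with k hk
    have hkt : 0 < k * t := mul_pos hk.1 ht
    have hkt1 : k * t ≤ 1 := by
      calc k * t ≤ t⁻¹ * t := by gcongr; exact hk.2
        _ = 1 := inv_mul_cancel₀ ht.ne'
    have hb := Real.cos_bound (x := k * t) (by rwa [abs_of_pos hkt])
    have hb' := (abs_le.1 hb).2
    rw [abs_of_pos hkt] at hb'
    unfold cosKernel
    rw [div_div, le_div_iff₀ (by have := hk.1; positivity)]
    nlinarith
  · filter_upwards [self_mem_nhdsWithin] with k hk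
    rw [div_le_one (pow_pos hk 2)]
    exact cosKernel_le_sq k t

/-- A kernel with nonnegative boundary Abel limits pairs nonnegatively with functions of positive
type. -/
lemma pairing_nonneg_of_abel_limit {a : ℝ → ℝ} (ha : IsAdmissibleKernel a) {a₀ : ℝ}
    (hlim : ∀ ω : ℝ, ∃ L : EReal, 0 ≤ L ∧ Tendsto (fun h : ℝ =>
      ((a₀ + (laplaceTransform a ((h : ℂ) + Complex.I * (ω : ℂ))).re : ℝ) : EReal))
      (𝓝[>] (0 : ℝ)) (𝓝 L))
    {E : ℝ → ℝ} {T : ℝ} (hE : Continuous E) (hT : ∀ x, T < |x| → E x = 0)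
    (heven : ∀ x, E (-x) = E x) (hEpos : ∀ ω, 0 ≤ cosTransform E ω) :
    0 ≤ a₀ * E 0 + ∫ r in Ioi (0 : ℝ), a r * E r := by
  have haE : IntegrableOn (fun r => a r * E r) (Ioi 0) := by
    have h1 : IntegrableOn a (Icc 0 T) :=
      ha.locallyIntegrable.integrableOn_compact_subset Icc_subset_Ici_self isCompact_Icc
    have h2 : IntegrableOn (fun r => a r * E r) (Icc 0 T) :=
      h1.mul_continuousOn hE.continuousOn isCompact_Icc
    refine h2.of_forall_sdiff_eq_zero measurableSet_Ioi fun x hx => ?_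
    rw [hT x, mul_zero]
    by_contra! h
    exact hx.2 ⟨(mem_Ioi.1 hx.1).le, (le_abs_self x).trans h⟩
  have hmk : ∀ k, Measurable fun t => cosKernel k t := fun k => by unfold cosKernel; fun_prop
  have ht : Tendsto (fun k => a₀ * E 0 + ∫ r in Ioi (0 : ℝ), a r * (cosKernel k r / k ^ 2) * E r)
      (𝓝[>] 0) (𝓝 (a₀ * E 0 + ∫ r in Ioi (0 : ℝ), a r * E r)) := by
    refine tendsto_const_nhds.add ?_
    refine tendsto_integral_filter_of_dominated_convergence (fun r => ‖a r * E r‖) ?_ ?_ haE.norm ?_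
    · exact Eventually.of_forall fun k => (ha.aestronglyMeasurable.fun_mul
        ((hmk k).div_const _).aestronglyMeasurable).fun_mul hE.aestronglyMeasurable
    · filter_upwards [self_mem_nhdsWithin] with k hk
      refine ae_of_all _ fun r => ?_
      have h1 : |cosKernel k r / k ^ 2| ≤ 1 := by
        rw [abs_of_nonneg (div_nonneg (cosKernel_nonneg _ _) (sq_nonneg _)),
          div_le_one (pow_pos hk 2)]
        exact cosKernel_le_sq k r
      rw [norm_mul, norm_mul, norm_mul, Real.norm_eq_abs (cosKernel k r / k ^ 2)]
      calc _ ≤ ‖a r‖ * 1 * ‖E r‖ := by gcongr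
        _ = _ := by ring
    · refine (ae_restrict_iff' measurableSet_Ioi).2 (ae_of_all _ fun r hr => ?_)
      have := ((tendsto_cosKernel_div hr).const_mul (a r)).mul_const (E r)
      simpa using this
  refine ge_of_tendsto ht ?_
  filter_upwards [self_mem_nhdsWithin] with k hk
  have hk2 : 0 < k ^ 2 := pow_pos hk 2
  -- The multiplier makes the kernel integrable, and a₀ plus its cosine transform is exactly the
  -- second difference divided by k², already known to be nonnegative.
  refine pairing_nonneg_of_integrable (b := fun r => a r * (cosKernel k r / k ^ 2)) ?_ (fun ω => ?_)
    hE hT heven hEpos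
  · have : IntegrableOn (fun t => a t * Real.cos (0 * t) * cosKernel k t / k ^ 2) (Ioi 0) :=
      (integrableOn_mul_cos_mul_cosKernel ha 0 k).div_const (k ^ 2)
    refine this.congr_fun (fun t _ => ?_) measurableSet_Ioi
    simp only [zero_mul, Real.cos_zero]; ring
  · have h1 := symbolDifference_nonneg ha hlim ω hk
    have h2 : ∫ r in Ioi (0 : ℝ), Real.cos (ω * r) * (a r * (cosKernel k r / k ^ 2)) =
        (∫ t in Ioi (0 : ℝ), a t * Real.cos (ω * t) * cosKernel k t) / k ^ 2 := by
      rw [← integral_div]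
      refine integral_congr_ae (ae_of_all _ fun t => ?_)
      simp only; ring
    rw [h2]
    have h3 : a₀ + (∫ t in Ioi (0 : ℝ), a t * Real.cos (ω * t) * cosKernel k t) / k ^ 2 =
        symbolDifference a a₀ ω k / k ^ 2 := by
      unfold symbolDifference
      rw [add_div, mul_div_cancel_right₀ _ hk2.ne']
    rw [h3]
    exact div_nonneg h1 hk2.le

/-! ### Causal convolutions and correlations -/

/-- The causal convolution `∫₀ᵗ k (t - s) w s ds`. -/
noncomputable def causalConv (k w : ℝ → ℝ) (t : ℝ) : ℝ := ∫ s in (0 : ℝ)..t, k (t - s) * w s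

/-- The correlation of the restrictions of `η` and `w` to `(0, T]`. -/
noncomputable def truncCorr (η w : ℝ → ℝ) (T r : ℝ) : ℝ :=
  ∫ t, (Ioc 0 T).indicator η t * (Ioc 0 T).indicator w (t - r)

lemma exists_norm_indicator_le {w : ℝ → ℝ} (hw : Continuous w) (T : ℝ) :
    ∃ M, 0 ≤ M ∧ ∀ t, ‖(Ioc 0 T).indicator w t‖ ≤ M := by
  obtain ⟨M, hM⟩ := (isCompact_Icc (a := (0 : ℝ)) (b := T)).exists_bound_of_continuousOn
    hw.continuousOn
  refine ⟨max M 0, le_max_right _ _, fun t => ?_⟩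
  by_cases ht : t ∈ Ioc 0 T
  · rw [indicator_of_mem ht]; exact (hM t (Ioc_subset_Icc_self ht)).trans (le_max_left _ _)
  · rw [indicator_of_notMem ht, norm_zero]; exact le_max_right _ _

lemma integrable_indicator_Ioc {w : ℝ → ℝ} (hw : Continuous w) (T : ℝ) :
    Integrable ((Ioc 0 T).indicator w) :=
  (integrable_indicator_iff measurableSet_Ioc).2
    (hw.integrableOn_Icc.mono_set Ioc_subset_Icc_self)

lemma continuous_truncCorr {η w : ℝ → ℝ} (hη : Continuous η) (hw : Continuous w) (T : ℝ) :
    Continuous (truncCorr η w T) := by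
  obtain ⟨M, hM0, hM⟩ := exists_norm_indicator_le hw T
  rw [continuous_iff_continuousAt]
  intro r₀
  unfold truncCorr
  refine continuousAt_of_dominated (bound := fun t => ‖(Ioc 0 T).indicator η t‖ * M) ?_ ?_
    ((integrable_indicator_Ioc hη T).norm.mul_const M) ?_
  · refine Eventually.of_forall fun r => (integrable_indicator_Ioc hη T).1.fun_mul ?_
    exact (hw.measurable.indicator measurableSet_Ioc).aestronglyMeasurable.comp_measurable
      (measurable_sub_const r)
  · refine Eventually.of_forall fun r => ae_of_all _ fun t => ?_
    rw [norm_mul]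
    gcongr
    exact hM _
  · have h1 : ∀ᵐ t : ℝ, t ≠ r₀ := by simp [ae_iff]
    have h2 : ∀ᵐ t : ℝ, t ≠ r₀ + T := by simp [ae_iff]
    filter_upwards [h1, h2] with t ht1 ht2
    refine ContinuousAt.mul continuousAt_const ?_
    have h3 : ContinuousAt ((Ioc 0 T).indicator w) (t - r₀) := by
      have hu0 : t - r₀ ≠ 0 := sub_ne_zero.2 ht1
      have huT : t - r₀ ≠ T := fun h => ht2 (by linarith)
      by_cases hu : t - r₀ ∈ Ioo 0 T
      · refine (hw.continuousAt (x := t - r₀)).congr ?_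
        filter_upwards [isOpen_Ioo.mem_nhds hu] with y hy
        rw [indicator_of_mem (Ioo_subset_Ioc_self hy)]
      · have hu' : t - r₀ ∈ (Icc 0 T)ᶜ := fun h =>
          hu ⟨lt_of_le_of_ne h.1 hu0.symm, lt_of_le_of_ne h.2 huT⟩
        refine (continuousAt_const (y := (0 : ℝ))).congr ?_
        filter_upwards [isClosed_Icc.isOpen_compl.mem_nhds hu'] with y hy
        rw [indicator_of_notMem fun h => hy (Ioc_subset_Icc_self h)]
    exact ContinuousAt.comp (f := fun r => t - r) h3 (by fun_prop)

lemma truncCorr_eq_zero (η w : ℝ → ℝ) {T r : ℝ} (hr : T < |r|) : truncCorr η w T r = 0 := by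
  unfold truncCorr
  refine integral_eq_zero_of_ae (ae_of_all _ fun t => ?_)
  simp only [Pi.zero_apply, mul_eq_zero]
  by_contra! h
  have h1 := mem_of_indicator_ne_zero h.1
  have h2 := mem_of_indicator_ne_zero h.2
  have h3 : |r| ≤ T := abs_le.2 ⟨by linarith [h1.1, h2.2], by linarith [h1.2, h2.1]⟩
  linarith

lemma truncCorr_zero (η w : ℝ → ℝ) {T : ℝ} (hT : 0 ≤ T) :
    truncCorr η w T 0 = ∫ t in (0 : ℝ)..T, η t * w t := by
  unfold truncCorr
  rw [intervalIntegral.integral_of_le hT, ← integral_indicator measurableSet_Ioc]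
  refine integral_congr_ae (ae_of_all _ fun t => ?_)
  simp only [sub_zero]
  by_cases ht : t ∈ Ioc 0 T
  · simp [indicator_of_mem ht]
  · simp [indicator_of_notMem ht]

lemma causalConv_eq_integral_indicator (k w : ℝ → ℝ) {T t : ℝ} (ht : t ∈ Ioc 0 T) :
    causalConv k w t =
      ∫ r, (Ioc 0 T).indicator k r * (Ioc 0 T).indicator w (t - r) := by
  unfold causalConv
  have h1 := intervalIntegral.integral_comp_sub_left (fun r => k r * w (t - r)) t (a := 0) (b := t)
  simp only [sub_sub_cancel, sub_self, sub_zero] at h1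
  rw [h1, intervalIntegral.integral_of_le ht.1.le, integral_Ioc_eq_integral_Ioo,
    ← integral_indicator measurableSet_Ioo]
  refine integral_congr_ae (ae_of_all _ fun r => ?_)
  simp only
  by_cases hr : r ∈ Ioo 0 t
  · have h2 : r ∈ Ioc 0 T := ⟨hr.1, hr.2.le.trans ht.2⟩
    have h3 : t - r ∈ Ioc 0 T := ⟨by linarith [hr.2], by linarith [hr.1, ht.2]⟩
    rw [indicator_of_mem hr, indicator_of_mem h2, indicator_of_mem h3]
  · rw [indicator_of_notMem hr]
    by_cases h2 : r ∈ Ioc 0 T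
    · have h3 : t - r ∉ Ioc 0 T := fun h => hr ⟨h2.1, by linarith [h.1]⟩
      rw [indicator_of_notMem h3, mul_zero]
    · rw [indicator_of_notMem h2, zero_mul]

lemma integrable_triple {k η w : ℝ → ℝ} {T : ℝ} (hk : IntegrableOn k (Icc 0 T))
    (hη : Continuous η) (hw : Continuous w) :
    Integrable (Function.uncurry fun t r => (Ioc 0 T).indicator η t *
      ((Ioc 0 T).indicator k r * (Ioc 0 T).indicator w (t - r))) (volume.prod volume) := by
  have hk' : Integrable ((Ioc 0 T).indicator k) :=
    (integrable_indicator_iff measurableSet_Ioc).2 (hk.mono_set Ioc_subset_Icc_self)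
  obtain ⟨M, hM0, hM⟩ := exists_norm_indicator_le hη T
  have h := Integrable.convolution_integrand (ContinuousLinearMap.mul ℝ ℝ) hk'
    (integrable_indicator_Ioc hw T)
  simp only [ContinuousLinearMap.mul_apply'] at h
  exact h.bdd_mul (c := M) (f := fun p : ℝ × ℝ => (Ioc 0 T).indicator η p.1)
    (integrable_indicator_Ioc hη T).1.comp_fst (ae_of_all _ fun p => hM _)

lemma intervalIntegrable_mul_causalConv {k η w : ℝ → ℝ} {T : ℝ} (hT : 0 ≤ T)
    (hk : IntegrableOn k (Icc 0 T)) (hη : Continuous η) (hw : Continuous w) :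
    IntervalIntegrable (fun t => η t * causalConv k w t) volume 0 T := by
  rw [intervalIntegrable_iff_integrableOn_Ioc_of_le hT]
  have h := (integrable_triple hk hη hw).integral_prod_left
  refine (h.integrableOn (s := Ioc 0 T)).congr_fun (fun t ht => ?_) measurableSet_Ioc
  simp only [Function.uncurry]
  rw [integral_const_mul, indicator_of_mem ht, causalConv_eq_integral_indicator k w ht]

/-- Fubini: pairing with a causal convolution is pairing of the kernel with a correlation. -/
lemma integral_mul_causalConv {k η w : ℝ → ℝ} {T : ℝ} (hT : 0 ≤ T)
    (hk : IntegrableOn k (Icc 0 T)) (hη : Continuous η) (hw : Continuous w) :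
    ∫ t in (0 : ℝ)..T, η t * causalConv k w t =
      ∫ r in Ioi (0 : ℝ), k r * truncCorr η w T r := by
  have h := integral_integral_swap (integrable_triple hk hη hw)
  have h1 : ∫ t in (0 : ℝ)..T, η t * causalConv k w t =
      ∫ t, ∫ r, (Ioc 0 T).indicator η t *
        ((Ioc 0 T).indicator k r * (Ioc 0 T).indicator w (t - r)) := by
    rw [intervalIntegral.integral_of_le hT, ← integral_indicator measurableSet_Ioc]
    refine integral_congr_ae (ae_of_all _ fun t => ?_)
    simp only
    rw [integral_const_mul]
    by_cases ht : t ∈ Ioc 0 T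
    · rw [indicator_of_mem ht, indicator_of_mem ht, causalConv_eq_integral_indicator k w ht]
    · rw [indicator_of_notMem ht, indicator_of_notMem ht, zero_mul]
  rw [h1, h, ← integral_indicator measurableSet_Ioi]
  refine integral_congr_ae (ae_of_all _ fun r => ?_)
  simp only
  have h2 : ∀ t, (Ioc 0 T).indicator η t *
        ((Ioc 0 T).indicator k r * (Ioc 0 T).indicator w (t - r)) =
      (Ioc 0 T).indicator k r * ((Ioc 0 T).indicator η t * (Ioc 0 T).indicator w (t - r)) :=
    fun t => by ring
  simp_rw [h2]
  rw [integral_const_mul]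
  change _ * truncCorr η w T r = _
  by_cases hr : r ∈ Ioc 0 T
  · rw [indicator_of_mem hr, indicator_of_mem (show r ∈ Ioi 0 from hr.1)]
  · rw [indicator_of_notMem hr, zero_mul]
    by_cases hr0 : r ∈ Ioi 0
    · have : T < |r| := by
        rw [abs_of_pos hr0]; by_contra! h; exact hr ⟨hr0, h⟩
      rw [indicator_of_mem hr0, truncCorr_eq_zero η w this, mul_zero]
    · rw [indicator_of_notMem hr0]

/-- The even, exponentially damped correlation. -/
noncomputable def dampedCorr (κ : ℝ) (η w : ℝ → ℝ) (T r : ℝ) : ℝ :=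
  Real.exp (-(κ * |r|)) * truncCorr η w T |r|

lemma continuous_dampedCorr (κ : ℝ) {η w : ℝ → ℝ} (hη : Continuous η) (hw : Continuous w) (T : ℝ) :
    Continuous (dampedCorr κ η w T) := by
  have := continuous_truncCorr hη hw T
  unfold dampedCorr
  fun_prop

lemma dampedCorr_eq_zero (κ : ℝ) (η w : ℝ → ℝ) (T : ℝ) :
    ∀ r, T < |r| → dampedCorr κ η w T r = 0 := fun r hr => by
  rw [dampedCorr, truncCorr_eq_zero η w (by rwa [abs_abs]), mul_zero]

lemma dampedCorr_neg (κ : ℝ) (η w : ℝ → ℝ) (T r : ℝ) :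
    dampedCorr κ η w T (-r) = dampedCorr κ η w T r := by
  rw [dampedCorr, abs_neg, dampedCorr]

/-- Evenness folds the integral onto the half-line, and Fubini turns the correlation back into a
convolution. Positive type becomes an inequality about linear filters of w. -/
lemma cosTransform_dampedCorr (κ : ℝ) {η w : ℝ → ℝ} (hη : Continuous η) (hw : Continuous w)
    {T : ℝ} (hT : 0 ≤ T) (ω : ℝ) :
    cosTransform (dampedCorr κ η w T) ω =
      2 * ∫ t in (0 : ℝ)..T, η t * causalConv (fun r => Real.exp (-(κ * r)) * Real.cos (ω * r)) w t := by
  rw [integral_mul_causalConv hT (Continuous.integrableOn_Icc (by fun_prop)) hη hw]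
  have h := integral_comp_abs (f := fun r : ℝ => Real.exp (-(κ * r)) * Real.cos (ω * r) *
    truncCorr η w T r)
  rw [← h]
  unfold cosTransform dampedCorr
  refine integral_congr_ae (ae_of_all _ fun r => ?_)
  have hc : Real.cos (ω * |r|) = Real.cos (ω * r) := by
    rcases abs_choice r with h | h <;> rw [h]
    rw [mul_neg, Real.cos_neg]
  simp only [hc]
  ring

/-- The damping converts the weight e^{αr}, belonging to the line where the sign of the transform is
known, into the weight e^{βr} of the shifted equation. -/
lemma integral_exp_mul_dampedCorr {a : ℝ → ℝ} {α β : ℝ} {η w : ℝ → ℝ} {T : ℝ} (hT : 0 ≤ T)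
    (hk : IntegrableOn (fun r => Real.exp (β * r) * a r) (Icc 0 T))
    (hη : Continuous η) (hw : Continuous w) :
    ∫ r in Ioi (0 : ℝ), Real.exp (α * r) * a r * dampedCorr (α - β) η w T r =
      ∫ t in (0 : ℝ)..T, η t * causalConv (fun r => Real.exp (β * r) * a r) w t := by
  rw [integral_mul_causalConv hT hk hη hw]
  refine setIntegral_congr_fun measurableSet_Ioi fun r hr => ?_
  simp only [dampedCorr, abs_of_pos (mem_Ioi.1 hr)]
  have : Real.exp (β * r) = Real.exp (α * r) * Real.exp (-((α - β) * r)) := by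
    rw [← Real.exp_add]; congr 1; ring
  rw [this]; ring

/-! ### Damped cosine and sine filters -/

/-- The damped cosine filter of `w`. -/
noncomputable def cosFilter (κ ω : ℝ) (w : ℝ → ℝ) : ℝ → ℝ :=
  causalConv (fun r => Real.exp (-(κ * r)) * Real.cos (ω * r)) w

/-- The damped sine filter of `w`. -/
noncomputable def sinFilter (κ ω : ℝ) (w : ℝ → ℝ) : ℝ → ℝ :=
  causalConv (fun r => Real.exp (-(κ * r)) * Real.sin (ω * r)) w

lemma cosFilter_zero (κ ω : ℝ) (w : ℝ → ℝ) : cosFilter κ ω w 0 = 0 := by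
  simp [cosFilter, causalConv]

lemma sinFilter_zero (κ ω : ℝ) (w : ℝ → ℝ) : sinFilter κ ω w 0 = 0 := by
  simp [sinFilter, causalConv]

/-- The addition formulas separate t from s, leaving integrals to which the fundamental theorem of
calculus applies. -/
lemma filter_expansion (κ ω : ℝ) {w : ℝ → ℝ} (hw : Continuous w) (t : ℝ) :
    cosFilter κ ω w t = Real.exp (-(κ * t)) *
      (Real.cos (ω * t) * (∫ s in (0 : ℝ)..t, Real.exp (κ * s) * Real.cos (ω * s) * w s) +
        Real.sin (ω * t) * ∫ s in (0 : ℝ)..t, Real.exp (κ * s) * Real.sin (ω * s) * w s) ∧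
    sinFilter κ ω w t = Real.exp (-(κ * t)) *
      (Real.sin (ω * t) * (∫ s in (0 : ℝ)..t, Real.exp (κ * s) * Real.cos (ω * s) * w s) -
        Real.cos (ω * t) * ∫ s in (0 : ℝ)..t, Real.exp (κ * s) * Real.sin (ω * s) * w s) := by
  have i1 : IntervalIntegrable (fun s => Real.exp (κ * s) * Real.cos (ω * s) * w s) volume 0 t :=
    Continuous.intervalIntegrable (by fun_prop) _ _
  have i2 : IntervalIntegrable (fun s => Real.exp (κ * s) * Real.sin (ω * s) * w s) volume 0 t :=
    Continuous.intervalIntegrable (by fun_prop) _ _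
  have he : ∀ s, Real.exp (-(κ * (t - s))) = Real.exp (-(κ * t)) * Real.exp (κ * s) := by
    intro s; rw [← Real.exp_add]; congr 1; ring
  constructor
  · rw [← intervalIntegral.integral_const_mul, ← intervalIntegral.integral_const_mul,
      ← intervalIntegral.integral_add (i1.const_mul _) (i2.const_mul _),
      ← intervalIntegral.integral_const_mul]
    refine intervalIntegral.integral_congr fun s _ => ?_
    simp only [he]
    rw [mul_sub ω t s, Real.cos_sub]
    ring
  · rw [← intervalIntegral.integral_const_mul, ← intervalIntegral.integral_const_mul,
      ← intervalIntegral.integral_sub (i1.const_mul _) (i2.const_mul _),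
      ← intervalIntegral.integral_const_mul]
    refine intervalIntegral.integral_congr fun s _ => ?_
    simp only [he]
    rw [mul_sub ω t s, Real.sin_sub]
    ring

/-- With X and S the two filters, Z = X + iS solves Z′ = (iω − κ)Z + w. The dissipation estimates
rest on this system. -/
lemma hasDerivAt_filters (κ ω : ℝ) {w : ℝ → ℝ} (hw : Continuous w) (t : ℝ) :
    HasDerivAt (cosFilter κ ω w) (-κ * cosFilter κ ω w t - ω * sinFilter κ ω w t + w t) t ∧
    HasDerivAt (sinFilter κ ω w) (-κ * sinFilter κ ω w t + ω * cosFilter κ ω w t) t := by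
  have c1 : Continuous fun s => Real.exp (κ * s) * Real.cos (ω * s) * w s := by fun_prop
  have c2 : Continuous fun s => Real.exp (κ * s) * Real.sin (ω * s) * w s := by fun_prop
  have dP := c1.integral_hasStrictDerivAt 0 t |>.hasDerivAt
  have dQ := c2.integral_hasStrictDerivAt 0 t |>.hasDerivAt
  have dω : HasDerivAt (fun t : ℝ => ω * t) ω t := by simpa using (hasDerivAt_id t).const_mul ω
  have dκ : HasDerivAt (fun t : ℝ => -(κ * t)) (-κ) t := by
    simpa using (hasDerivAt_id t).const_mul (-κ)
  have hE : Real.exp (-(κ * t)) * Real.exp (κ * t) = 1 := by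
    rw [← Real.exp_add]; simp
  have hcs := Real.sin_sq_add_cos_sq (ω * t)
  have hX : cosFilter κ ω w = fun t => _ := funext fun t => (filter_expansion κ ω hw t).1
  have hS : sinFilter κ ω w = fun t => _ := funext fun t => (filter_expansion κ ω hw t).2
  rw [hX, hS]
  constructor
  · refine (dκ.exp.mul ((dω.cos.mul dP).add (dω.sin.mul dQ))).congr_deriv ?_
    simp only [Pi.mul_apply, Pi.add_apply]
    linear_combination (Real.exp (-(κ * t)) * Real.exp (κ * t) * w t) * hcs + w t * hE
  · refine (dκ.exp.mul ((dω.sin.mul dP).sub (dω.cos.mul dQ))).congr_deriv ?_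
    simp only [Pi.mul_apply, Pi.sub_apply]
    ring

lemma continuous_cosFilter (κ ω : ℝ) {w : ℝ → ℝ} (hw : Continuous w) :
    Continuous (cosFilter κ ω w) :=
  continuous_iff_continuousAt.2 fun t => (hasDerivAt_filters κ ω hw t).1.continuousAt

lemma continuous_sinFilter (κ ω : ℝ) {w : ℝ → ℝ} (hw : Continuous w) :
    Continuous (sinFilter κ ω w) :=
  continuous_iff_continuousAt.2 fun t => (hasDerivAt_filters κ ω hw t).2.continuousAt

lemma hasDerivAt_lowpass (κ : ℝ) {w : ℝ → ℝ} (hw : Continuous w) (t : ℝ) :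
    HasDerivAt (cosFilter κ 0 w) (-κ * cosFilter κ 0 w t + w t) t := by
  simpa using (hasDerivAt_filters κ 0 hw t).1

/-- Decomposition of the low-pass filter. -/
lemma lowpass_eq (κ ω : ℝ) {w : ℝ → ℝ} (hw : Continuous w) (t : ℝ) :
    cosFilter κ 0 w t = cosFilter κ ω w t + ω * cosFilter κ 0 (sinFilter κ ω w) t := by
  -- The difference d of the two sides solves d′ = −κd with d(0) = 0.
  have hd : ∀ t, HasDerivAt (fun t => Real.exp (κ * t) * (cosFilter κ 0 w t - cosFilter κ ω w t -
      ω * cosFilter κ 0 (sinFilter κ ω w) t)) 0 t := by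
    intro t
    have dκ : HasDerivAt (fun t : ℝ => κ * t) κ t := by simpa using (hasDerivAt_id t).const_mul κ
    refine (dκ.exp.mul (((hasDerivAt_lowpass κ hw t).sub (hasDerivAt_filters κ ω hw t).1).sub
      ((hasDerivAt_lowpass κ (continuous_sinFilter κ ω hw) t).const_mul ω))).congr_deriv ?_
    simp only [Pi.sub_apply]
    ring
  have h := is_const_of_deriv_eq_zero (fun t => (hd t).differentiableAt) (fun t => (hd t).deriv) t 0
  simp only [cosFilter_zero, mul_zero, sub_zero] at h
  have := (mul_eq_zero.1 h).resolve_left (Real.exp_ne_zero _)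
  linarith

/-! ### Dissipation estimates for the filters -/

section Dissipation

variable {κ ω T : ℝ} {w : ℝ → ℝ}

/-- Differentiate (X² + S²)/2: the rotation terms ±ωXS cancel. For κ, T ≥ 0 every term on the right
is nonnegative, which gives the positive type of damped autocorrelations. -/
lemma integral_mul_cosFilter (hw : Continuous w) :
    ∫ t in (0 : ℝ)..T, w t * cosFilter κ ω w t =
      κ * (∫ t in (0 : ℝ)..T, cosFilter κ ω w t ^ 2) +
      κ * (∫ t in (0 : ℝ)..T, sinFilter κ ω w t ^ 2) +
      (cosFilter κ ω w T ^ 2 + sinFilter κ ω w T ^ 2) / 2 := by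
  have hX := continuous_cosFilter κ ω hw
  have hS := continuous_sinFilter κ ω hw
  have hd : ∀ t ∈ uIcc 0 T, HasDerivAt (fun t => (cosFilter κ ω w t ^ 2 + sinFilter κ ω w t ^ 2) / 2)
      (w t * cosFilter κ ω w t - κ * cosFilter κ ω w t ^ 2 - κ * sinFilter κ ω w t ^ 2) t := by
    intro t _
    refine ((((hasDerivAt_filters κ ω hw t).1.pow 2).add
      ((hasDerivAt_filters κ ω hw t).2.pow 2)).div_const 2).congr_deriv ?_
    simp only [Nat.cast_ofNat]
    ring
  have h := intervalIntegral.integral_eq_sub_of_hasDerivAt hd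
    (Continuous.intervalIntegrable (by fun_prop) _ _)
  rw [intervalIntegral.integral_sub (Continuous.intervalIntegrable (by fun_prop) _ _)
    (Continuous.intervalIntegrable (by fun_prop) _ _),
    intervalIntegral.integral_sub (Continuous.intervalIntegrable (by fun_prop) _ _)
    (Continuous.intervalIntegrable (by fun_prop) _ _), intervalIntegral.integral_const_mul,
    intervalIntegral.integral_const_mul, cosFilter_zero, sinFilter_zero] at h
  linarith

lemma integral_mul_cosFilter_nonneg (hκ : 0 ≤ κ) (hT : 0 ≤ T) (hw : Continuous w) :
    0 ≤ ∫ t in (0 : ℝ)..T, w t * cosFilter κ ω w t := by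
  rw [integral_mul_cosFilter hw]
  have h1 : 0 ≤ ∫ t in (0 : ℝ)..T, cosFilter κ ω w t ^ 2 :=
    intervalIntegral.integral_nonneg hT fun _ _ => sq_nonneg _
  have h2 : 0 ≤ ∫ t in (0 : ℝ)..T, sinFilter κ ω w t ^ 2 :=
    intervalIntegral.integral_nonneg hT fun _ _ => sq_nonneg _
  positivity

lemma integral_mul_lowpass (hw : Continuous w) :
    ∫ t in (0 : ℝ)..T, w t * cosFilter κ 0 w t =
      κ * (∫ t in (0 : ℝ)..T, cosFilter κ 0 w t ^ 2) + cosFilter κ 0 w T ^ 2 / 2 := by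
  have h := integral_mul_cosFilter (κ := κ) (ω := 0) (T := T) hw
  have h0 : ∀ t, sinFilter κ 0 w t = 0 := by
    intro t; simp [sinFilter, causalConv]
  simpa [h0] using h

/-- A low-pass filter is bounded in `L²` and at the end point by its input. -/
lemma lowpass_sq_le (hκ : 0 < κ) (hT : 0 ≤ T) (hw : Continuous w) :
    cosFilter κ 0 w T ^ 2 + κ * (∫ t in (0 : ℝ)..T, cosFilter κ 0 w t ^ 2) ≤
      (∫ t in (0 : ℝ)..T, w t ^ 2) / κ := by
  have hX := continuous_cosFilter κ 0 hw
  have h1 := integral_mul_lowpass (κ := κ) (T := T) hw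
  have h2 : ∫ t in (0 : ℝ)..T, w t * cosFilter κ 0 w t ≤
      ∫ t in (0 : ℝ)..T, (κ / 2 * cosFilter κ 0 w t ^ 2 + 1 / (2 * κ) * w t ^ 2) := by
    refine intervalIntegral.integral_mono_on hT (Continuous.intervalIntegrable (by fun_prop) _ _)
      (Continuous.intervalIntegrable (by fun_prop) _ _) fun t _ => ?_
    have : κ / 2 * cosFilter κ 0 w t ^ 2 + 1 / (2 * κ) * w t ^ 2 - w t * cosFilter κ 0 w t =
        (κ * cosFilter κ 0 w t - w t) ^ 2 / (2 * κ) := by field_simp; ring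
    have h3 : 0 ≤ (κ * cosFilter κ 0 w t - w t) ^ 2 / (2 * κ) := by positivity
    linarith
  rw [intervalIntegral.integral_add (Continuous.intervalIntegrable (by fun_prop) _ _)
    (Continuous.intervalIntegrable (by fun_prop) _ _), intervalIntegral.integral_const_mul,
    intervalIntegral.integral_const_mul] at h2
  have h3 : 1 / (2 * κ) * (∫ t in (0 : ℝ)..T, w t ^ 2) =
    ((∫ t in (0 : ℝ)..T, w t ^ 2) / κ) / 2 := by field_simp
  rw [h3] at h2
  linarith

/-- The low-pass dissipation is controlled by the dissipation at frequency `ω`. -/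
lemma integral_mul_lowpass_le (hκ : 0 < κ) (hT : 0 ≤ T) (hw : Continuous w) :
    ∫ t in (0 : ℝ)..T, w t * cosFilter κ 0 w t ≤
      (2 + 3 * ω ^ 2 / κ ^ 2) * ∫ t in (0 : ℝ)..T, w t * cosFilter κ ω w t := by
  have hX := continuous_cosFilter κ ω hw
  have hS := continuous_sinFilter κ ω hw
  have hB := continuous_cosFilter κ 0 hS
  have hY := continuous_cosFilter κ 0 hw
  have hBS := lowpass_sq_le hκ hT hS
  set B := cosFilter κ 0 (sinFilter κ ω w)
  have hpt : ∀ t, cosFilter κ 0 w t ^ 2 ≤ 2 * cosFilter κ ω w t ^ 2 + 2 * ω ^ 2 * B t ^ 2 := by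
    intro t
    rw [lowpass_eq κ ω hw t]
    nlinarith [sq_nonneg (cosFilter κ ω w t - ω * B t)]
  have h1 : ∫ t in (0 : ℝ)..T, cosFilter κ 0 w t ^ 2 ≤
      ∫ t in (0 : ℝ)..T, (2 * cosFilter κ ω w t ^ 2 + 2 * ω ^ 2 * B t ^ 2) :=
    intervalIntegral.integral_mono_on hT (Continuous.intervalIntegrable (by fun_prop) _ _)
      (Continuous.intervalIntegrable (by fun_prop) _ _) fun t _ => hpt t
  rw [intervalIntegral.integral_add (Continuous.intervalIntegrable (by fun_prop) _ _)
    (Continuous.intervalIntegrable (by fun_prop) _ _), intervalIntegral.integral_const_mul,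
    intervalIntegral.integral_const_mul] at h1
  have h2 := hpt T
  rw [integral_mul_lowpass hw, integral_mul_cosFilter hw]
  have iX : 0 ≤ ∫ t in (0 : ℝ)..T, cosFilter κ ω w t ^ 2 :=
    intervalIntegral.integral_nonneg hT fun _ _ => sq_nonneg _
  have iS : 0 ≤ ∫ t in (0 : ℝ)..T, sinFilter κ ω w t ^ 2 :=
    intervalIntegral.integral_nonneg hT fun _ _ => sq_nonneg _
  have iB : 0 ≤ ∫ t in (0 : ℝ)..T, B t ^ 2 :=
    intervalIntegral.integral_nonneg hT fun _ _ => sq_nonneg _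
  generalize (∫ t in (0 : ℝ)..T, cosFilter κ ω w t ^ 2) = x at *
  generalize (∫ t in (0 : ℝ)..T, sinFilter κ ω w t ^ 2) = s at *
  generalize (∫ t in (0 : ℝ)..T, B t ^ 2) = b at *
  generalize (∫ t in (0 : ℝ)..T, cosFilter κ 0 w t ^ 2) = y at *
  have hb2 := sq_nonneg (B T)
  generalize B T ^ 2 = b₁ at *
  have hs2 := sq_nonneg (sinFilter κ ω w T)
  have hx2 := sq_nonneg (cosFilter κ ω w T)
  generalize sinFilter κ ω w T ^ 2 = s₁ at *
  generalize cosFilter κ ω w T ^ 2 = x₁ at *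
  generalize cosFilter κ 0 w T ^ 2 = y₁ at *
  have hb₁ : 0 ≤ κ * b := by positivity
  have e1 : κ * y + y₁ / 2 ≤ 2 * (κ * x) + x₁ + ω ^ 2 * (2 * (κ * b) + b₁) := by nlinarith
  have e2 : ω ^ 2 * (2 * (κ * b) + b₁) ≤ ω ^ 2 * (3 * (s / κ)) := by
    have : 0 ≤ s / κ := by positivity
    exact mul_le_mul_of_nonneg_left (by linarith) (sq_nonneg ω)
  have e3 : 3 * ω ^ 2 / κ ^ 2 * (κ * s) = ω ^ 2 * (3 * (s / κ)) := by field_simp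
  have e4 : 0 ≤ 3 * ω ^ 2 / κ ^ 2 * (κ * x + (x₁ + s₁) / 2) := by positivity
  have e5 : 0 ≤ κ * s := by positivity
  calc κ * y + y₁ / 2 ≤ 2 * (κ * x) + x₁ + ω ^ 2 * (3 * (s / κ)) := by linarith
    _ ≤ 2 * (κ * x + κ * s + (x₁ + s₁) / 2) + 3 * ω ^ 2 / κ ^ 2 * (κ * s) +
        3 * ω ^ 2 / κ ^ 2 * (κ * x + (x₁ + s₁) / 2) := by linarith
    _ = _ := by ring

/-- Pairing a low-pass filter with a band filter is controlled by the dissipation, uniformly in the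
frequency. -/
lemma integral_lowpass_mul_cosFilter_le (hκ : 0 < κ) (hT : 0 ≤ T) (hw : Continuous w) :
    ∫ t in (0 : ℝ)..T, cosFilter κ 0 w t * cosFilter κ ω w t ≤
      (1 + (1 + 1 / (2 * κ)) / κ) * ∫ t in (0 : ℝ)..T, w t * cosFilter κ ω w t := by
  have hX := continuous_cosFilter κ ω hw
  have hS := continuous_sinFilter κ ω hw
  have hB := continuous_cosFilter κ 0 hS
  have hBS := lowpass_sq_le hκ hT hS
  have hSB := integral_mul_lowpass (κ := κ) (T := T) hS
  -- With B the low-pass filter of S, the low-pass filter of w is X + ωB. Integrating (BS)′ replaces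
  -- ω∫BX by terms free of ω, whence the uniformity in frequency.
  have hd : ∀ t ∈ uIcc 0 T, HasDerivAt
      (fun t => cosFilter κ 0 (sinFilter κ ω w) t * sinFilter κ ω w t)
      (sinFilter κ ω w t ^ 2 + ω * (cosFilter κ 0 (sinFilter κ ω w) t * cosFilter κ ω w t) -
        2 * κ * (sinFilter κ ω w t * cosFilter κ 0 (sinFilter κ ω w) t)) t := by
    intro t _
    refine ((hasDerivAt_lowpass κ hS t).mul (hasDerivAt_filters κ ω hw t).2).congr_deriv ?_
    ring
  set B := cosFilter κ 0 (sinFilter κ ω w)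
  have h := intervalIntegral.integral_eq_sub_of_hasDerivAt hd
    (Continuous.intervalIntegrable (by fun_prop) _ _)
  rw [intervalIntegral.integral_sub (Continuous.intervalIntegrable (by fun_prop) _ _)
    (Continuous.intervalIntegrable (by fun_prop) _ _),
    intervalIntegral.integral_add (Continuous.intervalIntegrable (by fun_prop) _ _)
    (Continuous.intervalIntegrable (by fun_prop) _ _), intervalIntegral.integral_const_mul,
    intervalIntegral.integral_const_mul, sinFilter_zero, mul_zero, sub_zero, hSB] at h
  have hYX : ∫ t in (0 : ℝ)..T, cosFilter κ 0 w t * cosFilter κ ω w t =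
      (∫ t in (0 : ℝ)..T, cosFilter κ ω w t ^ 2) +
        ω * ∫ t in (0 : ℝ)..T, B t * cosFilter κ ω w t := by
    rw [← intervalIntegral.integral_const_mul, ← intervalIntegral.integral_add
      (Continuous.intervalIntegrable (by fun_prop) _ _)
      (Continuous.intervalIntegrable (by fun_prop) _ _)]
    refine intervalIntegral.integral_congr fun t _ => ?_
    simp only [lowpass_eq κ ω hw t]
    ring
  rw [hYX, integral_mul_cosFilter hw]
  have iX : 0 ≤ ∫ t in (0 : ℝ)..T, cosFilter κ ω w t ^ 2 :=
    intervalIntegral.integral_nonneg hT fun _ _ => sq_nonneg _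
  have iS : 0 ≤ ∫ t in (0 : ℝ)..T, sinFilter κ ω w t ^ 2 :=
    intervalIntegral.integral_nonneg hT fun _ _ => sq_nonneg _
  have iB : 0 ≤ ∫ t in (0 : ℝ)..T, B t ^ 2 :=
    intervalIntegral.integral_nonneg hT fun _ _ => sq_nonneg _
  generalize (∫ t in (0 : ℝ)..T, cosFilter κ ω w t ^ 2) = x at *
  generalize (∫ t in (0 : ℝ)..T, sinFilter κ ω w t ^ 2) = s at *
  generalize (∫ t in (0 : ℝ)..T, B t ^ 2) = b at *
  generalize (∫ t in (0 : ℝ)..T, B t * cosFilter κ ω w t) = z at *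
  have e0 := two_mul_le_add_sq (B T) (sinFilter κ ω w T)
  have hb2 := sq_nonneg (B T)
  have hx2 := sq_nonneg (cosFilter κ ω w T)
  have hs2 := sq_nonneg (sinFilter κ ω w T)
  have e1 : κ * (B T ^ 2 + κ * b) ≤ s := by
    calc κ * (B T ^ 2 + κ * b) ≤ κ * (s / κ) := by gcongr
      _ = s := by field_simp
  have e2 : x + ω * z ≤ x + (s / κ) / 2 + sinFilter κ ω w T ^ 2 / 2 + s := by
    have : 0 ≤ κ * b := by positivity
    have : 0 ≤ κ * B T ^ 2 := by positivity
    linarith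
  have e3 : (1 + 1 / (2 * κ)) / κ * (κ * x + κ * s) = x + s + (x / κ) / 2 + (s / κ) / 2 := by
    field_simp
    ring
  have e4 : 0 ≤ (1 + 1 / (2 * κ)) / κ *
      ((cosFilter κ ω w T ^ 2 + sinFilter κ ω w T ^ 2) / 2) := by positivity
  have e5 : 0 ≤ x / κ := by positivity
  have e6 : 0 ≤ κ * x := by positivity
  have e7 : 0 ≤ κ * s := by positivity
  rw [add_mul, one_mul, mul_add, e3]
  linarith

end Dissipation

/-! ### The exponentially shifted equation and its energy identities -/

lemma IsAdmissibleKernel.integrableOn_exp_mul_Icc {a : ℝ → ℝ} (ha : IsAdmissibleKernel a)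
    (β T : ℝ) : IntegrableOn (fun r => Real.exp (β * r) * a r) (Icc 0 T) :=
  (ha.locallyIntegrable.integrableOn_compact_subset Icc_subset_Ici_self
    isCompact_Icc).continuousOn_mul (Continuous.continuousOn (by fun_prop)) isCompact_Icc

/-- `w` is continuous and solves `w' = β w - μ (a₀ w + k * w)`, `w 0 = 1`, on the half-line. -/
structure IsShiftedSolution (a₀ : ℝ) (k : ℝ → ℝ) (μ β : ℝ) (w : ℝ → ℝ) : Prop where
  continuous : Continuous w
  hasDerivAt : ∀ t : ℝ, 0 < t →
    HasDerivAt w (β * w t - μ * (a₀ * w t + causalConv k w t)) t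
  initial : w 0 = 1

lemma IsScalarSolution.exists_shifted {a₀ μ : ℝ} {a z : ℝ → ℝ} (hz : IsScalarSolution a₀ a μ z)
    (β : ℝ) : ∃ w, IsShiftedSolution a₀ (fun r => Real.exp (β * r) * a r) μ β w ∧
      ∀ t, 0 ≤ t → w t = Real.exp (β * t) * z t := by
  have hw : ∀ t, 0 ≤ t → Real.exp (β * t) * z (max t 0) = Real.exp (β * t) * z t := fun t ht => by
    rw [max_eq_left ht]
  -- Freezing z at z(0) for negative times makes w continuous on the whole line.
  refine ⟨fun t => Real.exp (β * t) * z (max t 0), ⟨?_, fun t ht => ?_, ?_⟩, hw⟩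
  · have : Continuous fun t => z (max t 0) :=
      hz.continuousOn.comp_continuous (by fun_prop) fun t => mem_Ici.2 (le_max_right _ _)
    exact Continuous.mul (by fun_prop) this
  · have hβ : HasDerivAt (fun t : ℝ => β * t) β t := by simpa using (hasDerivAt_id t).const_mul β
    have h1 := hβ.exp.mul (hz.hasDerivAt t ht)
    have h2 : HasDerivAt (fun t => Real.exp (β * t) * z (max t 0)) _ t := h1.congr_of_eventuallyEq (by
      filter_upwards [Ioi_mem_nhds ht] with s hs
      exact hw s (mem_Ioi.1 hs).le)
    refine h2.congr_deriv ?_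
    have h3 : causalConv (fun r => Real.exp (β * r) * a r)
        (fun t => Real.exp (β * t) * z (max t 0)) t =
        Real.exp (β * t) * ∫ s in (0 : ℝ)..t, a (t - s) * z s := by
      unfold causalConv
      rw [← intervalIntegral.integral_const_mul]
      refine intervalIntegral.integral_congr fun s hs => ?_
      rw [uIcc_of_le ht.le] at hs
      have h4 : Real.exp (β * t) = Real.exp (β * (t - s)) * Real.exp (β * s) := by
        rw [← Real.exp_add]; congr 1; ring
      simp only [hw s hs.1, h4]
      ring
    rw [h3, hw t ht.le]
    ring
  · simp [hz.initial]

/-- The energy identity. -/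
lemma IsShiftedSolution.energy {a₀ μ β : ℝ} {k w : ℝ → ℝ} (hw : IsShiftedSolution a₀ k μ β w)
    {T : ℝ} (hT : 0 ≤ T) (hk : IntegrableOn k (Icc 0 T)) :
    w T ^ 2 = 1 + 2 * β * (∫ t in (0 : ℝ)..T, w t * w t) -
      2 * μ * (a₀ * (∫ t in (0 : ℝ)..T, w t * w t) + ∫ t in (0 : ℝ)..T, w t * causalConv k w t) := by
  have hc := hw.continuous
  have i1 : IntervalIntegrable (fun t => w t * w t) volume 0 T :=
    Continuous.intervalIntegrable (by fun_prop) _ _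
  have i2 := intervalIntegrable_mul_causalConv hT hk hc hc
  have hd : ∀ t ∈ Ioo 0 T, HasDerivAt (fun t => w t ^ 2)
      ((2 * β - 2 * μ * a₀) * (w t * w t) - 2 * μ * (w t * causalConv k w t)) t := by
    intro t ht
    refine ((hw.hasDerivAt t ht.1).pow 2).congr_deriv ?_
    simp only [Nat.cast_ofNat]
    ring
  have h := intervalIntegral.integral_eq_sub_of_hasDerivAt_of_le hT
    (Continuous.continuousOn (by fun_prop)) hd ((i1.const_mul _).sub (i2.const_mul _))
  rw [intervalIntegral.integral_sub (i1.const_mul _) (i2.const_mul _),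
    intervalIntegral.integral_const_mul, intervalIntegral.integral_const_mul, hw.initial] at h
  linarith

/-- The identity obtained by testing the equation with the low-pass filtered solution. -/
lemma IsShiftedSolution.lowpass_energy {μ β κ : ℝ} {k w : ℝ → ℝ}
    (hw : IsShiftedSolution 0 k μ β w) {T : ℝ} (hT : 0 ≤ T) (hk : IntegrableOn k (Icc 0 T)) :
    cosFilter κ 0 w T * w T = (∫ t in (0 : ℝ)..T, w t * w t) +
      (β - κ) * (∫ t in (0 : ℝ)..T, w t * cosFilter κ 0 w t) -
      μ * ∫ t in (0 : ℝ)..T, cosFilter κ 0 w t * causalConv k w t := by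
  have hc := hw.continuous
  have hy := continuous_cosFilter κ 0 hc
  have i1 : IntervalIntegrable (fun t => w t * w t) volume 0 T :=
    Continuous.intervalIntegrable (by fun_prop) _ _
  have i3 : IntervalIntegrable (fun t => w t * cosFilter κ 0 w t) volume 0 T :=
    Continuous.intervalIntegrable (by fun_prop) _ _
  have i2 := intervalIntegrable_mul_causalConv hT hk hy hc
  have hd : ∀ t ∈ Ioo 0 T, HasDerivAt (fun t => cosFilter κ 0 w t * w t)
      (w t * w t + (β - κ) * (w t * cosFilter κ 0 w t) -
        μ * (cosFilter κ 0 w t * causalConv k w t)) t := by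
    intro t ht
    refine ((hasDerivAt_lowpass κ hc t).mul (hw.hasDerivAt t ht.1)).congr_deriv ?_
    ring
  have h := intervalIntegral.integral_eq_sub_of_hasDerivAt_of_le hT
    (Continuous.continuousOn (by fun_prop)) hd ((i1.add (i3.const_mul _)).sub (i2.const_mul _))
  rw [intervalIntegral.integral_sub (i1.add (i3.const_mul _)) (i2.const_mul _),
    intervalIntegral.integral_add i1 (i3.const_mul _),
    intervalIntegral.integral_const_mul, intervalIntegral.integral_const_mul, cosFilter_zero] at h
  linarith

/-- A share δ of the instantaneous coefficient absorbs the growth term, since β ≤ μδ; the rest of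
the quadratic form is nonnegative by assumption. -/
lemma IsShiftedSolution.abs_le_one {a₀ μ β : ℝ} {k w : ℝ → ℝ}
    (hw : IsShiftedSolution a₀ k μ β w) {T : ℝ} (hT : 0 ≤ T) (hk : IntegrableOn k (Icc 0 T))
    {δ : ℝ} (hμ : 0 ≤ μ) (hβ : β ≤ μ * δ)
    (hpos : 0 ≤ (a₀ - δ) * (∫ t in (0 : ℝ)..T, w t * w t) +
      ∫ t in (0 : ℝ)..T, w t * causalConv k w t) : |w T| ≤ 1 := by
  have h := hw.energy hT hk
  have h1 : 0 ≤ ∫ t in (0 : ℝ)..T, w t * w t :=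
    intervalIntegral.integral_nonneg hT fun _ _ => mul_self_nonneg _
  have h2 := mul_nonneg hμ hpos
  have h3 := mul_le_mul_of_nonneg_right hβ h1
  rw [← sq_le_one_iff_abs_le_one]
  nlinarith

lemma cosTransform_dampedCorr_self_nonneg {κ : ℝ} (hκ : 0 ≤ κ) {w : ℝ → ℝ} (hw : Continuous w)
    {T : ℝ} (hT : 0 ≤ T) (ω : ℝ) : 0 ≤ cosTransform (dampedCorr κ w w T) ω := by
  rw [cosTransform_dampedCorr κ hw hw hT]
  exact mul_nonneg two_pos.le (integral_mul_cosFilter_nonneg hκ hT hw)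

lemma dampedCorr_zero_right (κ : ℝ) (η w : ℝ → ℝ) {T : ℝ} (hT : 0 ≤ T) :
    dampedCorr κ η w T 0 = ∫ t in (0 : ℝ)..T, η t * w t := by
  rw [dampedCorr, abs_zero, truncCorr_zero η w hT]
  simp

/-! ### The uniform bound and exponential decay -/

lemma abs_le_one_of_abel_limit {a : ℝ → ℝ} (ha : IsAdmissibleKernel a) {a₀ : ℝ}
    (hlim : ∀ ω : ℝ, ∃ L : EReal, 0 ≤ L ∧ Tendsto (fun h : ℝ =>
      ((a₀ + (laplaceTransform a ((h : ℂ) + Complex.I * (ω : ℂ))).re : ℝ) : EReal))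
      (𝓝[>] (0 : ℝ)) (𝓝 L)) {μ : ℝ} (hμ : 0 ≤ μ) {z : ℝ → ℝ}
    (hz : IsScalarSolution a₀ a μ z) {t : ℝ} (ht : 0 ≤ t) : |z t| ≤ 1 := by
  obtain ⟨w, hw, hwz⟩ := hz.exists_shifted 0
  have hc := hw.continuous
  have hk := ha.integrableOn_exp_mul_Icc 0 t
  have h := pairing_nonneg_of_abel_limit ha hlim
    (continuous_dampedCorr 0 hc hc t) (dampedCorr_eq_zero 0 w w t) (dampedCorr_neg 0 w w t)
    (cosTransform_dampedCorr_self_nonneg le_rfl hc ht)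
  have h2 := integral_exp_mul_dampedCorr (α := 0) (β := 0) ht hk hc hc
  rw [sub_self] at h2
  simp only [zero_mul, Real.exp_zero, one_mul] at h2 hw
  have h3 := hw.abs_le_one (δ := 0) ht (by simpa using hk) hμ (by simp) (by
    rw [sub_zero, ← h2, ← dampedCorr_zero_right 0 w w ht]
    exact h)
  rw [hwz t ht] at h3
  simpa using h3

/-- Schwarz's lemma on the disc of radius α about iω, where F differs from F(iω) by at most 2M. The
estimate is uniform in ω. -/
lemma IsLaplaceExtension.dist_vertical_le {a : ℝ → ℝ} {α : ℝ} {F : ℂ → ℂ}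
    (hF : IsLaplaceExtension a α F) {M : ℝ} (hM : ∀ s : ℂ, -α ≤ s.re → ‖F s‖ ≤ M) {β : ℝ}
    (hβ : 0 ≤ β) (hβα : β < α) (ω : ℝ) :
    ‖F (-(β : ℂ) + Complex.I * ω) - F (Complex.I * ω)‖ ≤ 2 * M / α * β := by
  have hsub : ∀ s ∈ Metric.ball (Complex.I * ω : ℂ) α, -α < s.re := by
    intro s hs
    rw [mem_ball_iff_norm] at hs
    have h := (abs_lt.1 ((Complex.abs_re_le_norm _).trans_lt hs)).1
    simpa using h
  have h0 : ‖F (Complex.I * ω)‖ ≤ M := hM _ (by simp; linarith)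
  have h := Complex.dist_le_div_mul_dist_of_mapsTo_ball (f := F) (c := Complex.I * ω) (R₁ := α)
    (R₂ := 2 * M) (z := -(β : ℂ) + Complex.I * ω)
    (hF.differentiableOn.mono fun s hs => hsub s hs) (fun s hs => ?_) ?_
  · rw [dist_eq_norm, dist_eq_norm, add_sub_cancel_right, norm_neg,
      Complex.norm_of_nonneg hβ] at h
    exact h
  · rw [mem_closedBall_iff_norm]
    exact (norm_sub_le _ _).trans (by linarith [hM s (hsub s hs).le])
  · rw [mem_ball_iff_norm, add_sub_cancel_right, norm_neg, Complex.norm_of_nonneg hβ]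
    exact hβα

lemma abs_le_of_shifted {z w : ℝ → ℝ} {β t C : ℝ} (hwz : w t = Real.exp (β * t) * z t)
    (h : |w t| ≤ C) : |z t| ≤ C * Real.exp (-(β * t)) := by
  have : z t = w t * Real.exp (-(β * t)) := by
    rw [hwz, mul_right_comm, ← Real.exp_add]; simp
  rw [this, abs_mul, Real.abs_exp]
  gcongr

/-- Exponential decay when the boundary values are uniformly positive. -/
lemma exists_decay_of_uniform_positive {a : ℝ → ℝ} (ha : IsAdmissibleKernel a) {a₀ α : ℝ}
    {F : ℂ → ℂ} (hα : 0 < α) (hF : IsLaplaceExtension a α F) {c : ℝ} (hc : 0 < c)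
    (hpos : ∀ ω : ℝ, c ≤ a₀ + (F (Complex.I * (ω : ℂ))).re) :
    ∃ ε : ℝ, 0 < ε ∧ ∀ μ : ℝ, 0 ≤ μ → ∀ z : ℝ → ℝ, IsScalarSolution a₀ a μ z →
      ∀ t : ℝ, 0 ≤ t → |z t| ≤ 2 * Real.exp (-(ε * min μ 1 * t)) := by
  obtain ⟨M, hM⟩ := hF.bounded
  have hM0 : 0 ≤ M := (norm_nonneg _).trans (hM 0 (by simp; linarith))
  have hden : 0 < 1 + 2 * M / α := by positivity
  -- The first entry keeps β < α. The second gives ε + (2M/α)ε ≤ c, covering both the share ε taken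
  -- from a₀ and the variation of F.
  refine ⟨min (α / 2) (c / (1 + 2 * M / α)), lt_min (by linarith) (div_pos hc hden), ?_⟩
  set ε := min (α / 2) (c / (1 + 2 * M / α)) with hε
  have hε0 : 0 < ε := lt_min (by linarith) (div_pos hc hden)
  have hε1 : ε ≤ α / 2 := min_le_left _ _
  have hε2 : ε * (1 + 2 * M / α) ≤ c := (le_div_iff₀ hden).1 (min_le_right _ _)
  intro μ hμ z hz t ht
  set β := ε * min μ 1 with hβ
  have hβ0 : 0 ≤ β := mul_nonneg hε0.le (le_min hμ zero_le_one)
  have hβε : β ≤ ε := mul_le_of_le_one_right hε0.le (min_le_right _ _)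
  have hβμ : β ≤ μ * ε := by
    rw [mul_comm μ]; exact mul_le_mul_of_nonneg_left (min_le_left _ _) hε0.le
  obtain ⟨w, hw, hwz⟩ := hz.exists_shifted β
  have hwc := hw.continuous
  have hk := ha.integrableOn_exp_mul_Icc β t
  have h := hF.pairing_nonneg ha (a₁ := a₀ - ε) hβ0 (by linarith) (fun ω => ?_)
    (continuous_dampedCorr (β - β) hwc hwc t) (dampedCorr_eq_zero _ w w t) (dampedCorr_neg _ w w t)
    (cosTransform_dampedCorr_self_nonneg (sub_self β).ge hwc ht)
  · rw [integral_exp_mul_dampedCorr ht hk hwc hwc, dampedCorr_zero_right _ w w ht] at h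
    have h3 := hw.abs_le_one ht hk hμ hβμ h
    exact abs_le_of_shifted (hwz t ht) (h3.trans one_le_two)
  · have h1 := hF.dist_vertical_le hM hβ0 (by linarith) ω
    have h2 := (abs_le.1 ((Complex.abs_re_le_norm _).trans h1)).1
    rw [Complex.sub_re] at h2
    have h3 : 2 * M / α * β ≤ 2 * M / α * ε := by gcongr
    linarith [hpos ω]

/-- Exponential decay when the boundary values have nonnegative real part and `a₀ > 0`. -/
lemma exists_decay_of_pos {a : ℝ → ℝ} (ha : IsAdmissibleKernel a) {a₀ α : ℝ} (ha₀ : 0 < a₀)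
    {F : ℂ → ℂ} (hα : 0 < α) (hF : IsLaplaceExtension a α F)
    (hpos : ∀ ω : ℝ, 0 ≤ (F (-(α : ℂ) + Complex.I * (ω : ℂ))).re) :
    ∃ ε : ℝ, 0 < ε ∧ ∀ μ : ℝ, 0 ≤ μ → ∀ z : ℝ → ℝ, IsScalarSolution a₀ a μ z →
      ∀ t : ℝ, 0 ≤ t → |z t| ≤ 2 * Real.exp (-(ε * min μ 1 * t)) := by
  refine ⟨min a₀ α, lt_min ha₀ hα, fun μ hμ z hz t ht => ?_⟩
  set ε := min a₀ α
  have hε0 : 0 < ε := lt_min ha₀ hα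
  set β := ε * min μ 1
  have hβε : β ≤ ε := mul_le_of_le_one_right hε0.le (min_le_right _ _)
  have hβμ : β ≤ μ * a₀ := by
    calc β ≤ ε * μ := mul_le_mul_of_nonneg_left (min_le_left _ _) hε0.le
      _ ≤ a₀ * μ := mul_le_mul_of_nonneg_right (min_le_left _ _) hμ
      _ = _ := mul_comm _ _
  obtain ⟨w, hw, hwz⟩ := hz.exists_shifted β
  have hwc := hw.continuous
  have hk := ha.integrableOn_exp_mul_Icc β t
  have h := hF.pairing_nonneg ha (a₁ := 0) hα.le le_rfl (by simpa using hpos)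
    (continuous_dampedCorr (α - β) hwc hwc t) (dampedCorr_eq_zero _ w w t) (dampedCorr_neg _ w w t)
    (cosTransform_dampedCorr_self_nonneg (by linarith [min_le_right a₀ α]) hwc ht)
  rw [integral_exp_mul_dampedCorr ht hk hwc hwc, zero_mul] at h
  -- All of a₀ is spent on absorbing β; the kernel form is nonnegative by itself.
  have h3 := hw.abs_le_one (δ := a₀) ht hk hμ hβμ (by rwa [sub_self, zero_mul])
  exact abs_le_of_shifted (hwz t ht) (h3.trans one_le_two)

/-- The damping κ = α − β varies with μ, so the constant is frozen at the smallest admissible value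
κ = α/2. -/
lemma lowpass_constant_antitone {α κ : ℝ} (hα : 0 < α) (hκ : α / 2 ≤ κ) :
    1 + (1 + 1 / (2 * κ)) / κ ≤ 1 + (1 + 1 / α) / (α / 2) := by
  have : 1 / (2 * κ) ≤ 1 / α := one_div_le_one_div_of_le hα (by linarith)
  gcongr

/-- Pairing the low-pass filtered solution with the memory term is controlled by the dissipation. -/
lemma IsLaplaceExtension.lowpass_pairing_le {a : ℝ → ℝ} (ha : IsAdmissibleKernel a) {α : ℝ}
    {F : ℂ → ℂ} (hα : 0 < α) (hF : IsLaplaceExtension a α F)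
    (hpos : ∀ ω : ℝ, 0 ≤ (F (-(α : ℂ) + Complex.I * (ω : ℂ))).re) {β T : ℝ} (hβ : β ≤ α / 2)
    (hT : 0 ≤ T) {w : ℝ → ℝ} (hw : Continuous w) :
    ∫ t in (0 : ℝ)..T, cosFilter (α - β) 0 w t *
        causalConv (fun r => Real.exp (β * r) * a r) w t ≤
      (1 + (1 + 1 / α) / (α / 2)) *
        ∫ t in (0 : ℝ)..T, w t * causalConv (fun r => Real.exp (β * r) * a r) w t := by
  have hk := ha.integrableOn_exp_mul_Icc β T
  have hy := continuous_cosFilter (α - β) 0 hw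
  set C := 1 + (1 + 1 / α) / (α / 2) with hC
  -- C is large enough that this test function has a nonnegative pairing with the cosine filter of w
  -- at every frequency, so its damped correlation with w is of positive type.
  have hη : Continuous fun t => C * w t - cosFilter (α - β) 0 w t := by fun_prop
  have hsplit : ∀ k : ℝ → ℝ, IntegrableOn k (Icc 0 T) →
      ∫ t in (0 : ℝ)..T, (C * w t - cosFilter (α - β) 0 w t) * causalConv k w t =
        C * (∫ t in (0 : ℝ)..T, w t * causalConv k w t) -
          ∫ t in (0 : ℝ)..T, cosFilter (α - β) 0 w t * causalConv k w t := by
    intro k hk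
    have i1 := intervalIntegrable_mul_causalConv hT hk hw hw
    have i2 := intervalIntegrable_mul_causalConv hT hk hy hw
    rw [← intervalIntegral.integral_const_mul, ← intervalIntegral.integral_sub (i1.const_mul C) i2]
    refine intervalIntegral.integral_congr fun t _ => ?_
    ring
  have h := hF.pairing_nonneg ha (a₁ := 0) hα.le le_rfl (by simpa using hpos)
    (continuous_dampedCorr (α - β) hη hw T) (dampedCorr_eq_zero _ _ w T) (dampedCorr_neg _ _ w T)
    (fun ω => ?_)
  · rw [integral_exp_mul_dampedCorr hT hk hη hw, zero_mul, hsplit _ hk] at h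
    linarith
  · rw [cosTransform_dampedCorr _ hη hw hT, hsplit _ (Continuous.integrableOn_Icc (by fun_prop))]
    have h1 := integral_lowpass_mul_cosFilter_le (κ := α - β) (ω := ω) (by linarith) hT hw
    have h2 := integral_mul_cosFilter_nonneg (κ := α - β) (ω := ω) (by linarith) hT hw
    have h3 := mul_le_mul_of_nonneg_right
      (lowpass_constant_antitone (κ := α - β) hα (by linarith)) h2
    rw [← hC] at h3
    simp only [cosFilter] at h1 h3 ⊢
    refine mul_nonneg two_pos.le ?_
    linarith

/-- Strict positivity: the dissipation controls the low-pass dissipation. -/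
lemma IsLaplaceExtension.exists_lowpass_dissipation_le {a : ℝ → ℝ} (ha : IsAdmissibleKernel a)
    {α : ℝ} {F : ℂ → ℂ} (hα : 0 < α) (hF : IsLaplaceExtension a α F)
    (hne : ¬ a =ᵐ[volume.restrict (Ioi (0 : ℝ))] 0)
    (hpos : ∀ ω : ℝ, 0 ≤ (F (-(α : ℂ) + Complex.I * (ω : ℂ))).re) :
    ∃ c : ℝ, 0 < c ∧ ∀ β T : ℝ, β ≤ α / 2 → 0 ≤ T → ∀ w : ℝ → ℝ, Continuous w →
      c * (∫ t in (0 : ℝ)..T, w t * cosFilter (α - β) 0 w t) ≤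
        ∫ t in (0 : ℝ)..T, w t * causalConv (fun r => Real.exp (β * r) * a r) w t := by
  obtain ⟨ω₁, hω₁⟩ : ∃ ω : ℝ, 0 < (F (-(α : ℂ) + Complex.I * (ω : ℂ))).re := by
    by_contra! h
    exact hne (hF.ae_eq_zero ha hα.le fun ω => le_antisymm (h ω) (hpos ω))
  set g₀ := (F (-(α : ℂ) + Complex.I * (ω₁ : ℂ))).re / 2 with hg₀
  have hg₀pos : 0 < g₀ := by positivity
  have hcont : Continuous fun ω : ℝ => (F (-(α : ℂ) + Complex.I * (ω : ℂ))).re :=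
    Complex.continuous_re.comp (hF.continuous_vertical le_rfl)
  have hev : ∀ᶠ ω : ℝ in 𝓝 ω₁, g₀ < (F (-(α : ℂ) + Complex.I * (ω : ℂ))).re :=
    (hcont.tendsto ω₁).eventually_const_lt (by rw [hg₀]; linarith)
  obtain ⟨r, hr, hball⟩ := Metric.nhds_basis_closedBall.eventually_iff.1 hev
  rw [Real.closedBall_eq_Icc] at hball
  set R := |ω₁| + r with hR
  have hRb : ∀ ω ∈ Icc (ω₁ - r) (ω₁ + r), |ω| ≤ R := fun ω hω => by
    rw [abs_le]
    constructor <;> linarith [hω.1, hω.2, neg_abs_le ω₁, le_abs_self ω₁]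
  -- The constant of `integral_mul_lowpass_le` at its worst over |ω| ≤ R and α − β ≥ α/2, hence
  -- independent of β.
  set K := 2 + 3 * R ^ 2 / (α / 2) ^ 2 with hK
  have hKpos : 0 < K := by positivity
  set c₀ := (2 * Real.pi)⁻¹ * ((ω₁ + r - (ω₁ - r)) * Real.exp (-(R ^ 2 / 2)) * g₀) with hc₀
  have hc₀pos : 0 < c₀ := by
    have : 0 < ω₁ + r - (ω₁ - r) := by linarith
    have := Real.pi_pos
    positivity
  -- The 2 is the factor between the cosine transform of a damped correlation and the filter
  -- pairing.
  refine ⟨c₀ * (2 / K), by positivity, fun β T hβ hT w hw => ?_⟩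
  have hκ : 0 < α - β := by linarith
  have hA : 0 ≤ ∫ t in (0 : ℝ)..T, w t * cosFilter (α - β) 0 w t :=
    integral_mul_cosFilter_nonneg hκ.le hT hw
  have h := hF.le_pairing ha hα.le hpos (p := ω₁ - r) (q := ω₁ + r) (R := R) (g₀ := g₀)
    (m := 2 / K * ∫ t in (0 : ℝ)..T, w t * cosFilter (α - β) 0 w t) (by linarith) hRb hg₀pos.le
    (by positivity) (fun ω hω => (hball hω).le)
    (continuous_dampedCorr (α - β) hw hw T) (dampedCorr_eq_zero _ w w T) (dampedCorr_neg _ w w T)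
    (cosTransform_dampedCorr_self_nonneg hκ.le hw hT) (fun ω hω => ?_)
  · rw [integral_exp_mul_dampedCorr hT (ha.integrableOn_exp_mul_Icc β T) hw hw] at h
    linarith
  · rw [cosTransform_dampedCorr _ hw hw hT]
    have h1 := integral_mul_lowpass_le (κ := α - β) (ω := ω) hκ hT hw
    have h2 := integral_mul_cosFilter_nonneg (κ := α - β) (ω := ω) hκ.le hT hw
    have h3 : 2 + 3 * ω ^ 2 / (α - β) ^ 2 ≤ K := by
      have : ω ^ 2 ≤ R ^ 2 := by
        rw [← sq_abs ω]; exact pow_le_pow_left₀ (abs_nonneg _) (hRb ω hω) 2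
      have : α / 2 ≤ α - β := by linarith
      rw [hK]; gcongr
    have h4 := h1.trans (mul_le_mul_of_nonneg_right h3 h2)
    rw [div_mul_eq_mul_div, div_le_iff₀ hKpos]
    change _ ≤ 2 * (∫ t in (0 : ℝ)..T, w t * cosFilter (α - β) ω w t) * K
    linarith

/-- Exponential decay for a nontrivial kernel with nonnegative boundary values and `a₀ = 0`. -/
lemma exists_decay_of_zero {a : ℝ → ℝ} (ha : IsAdmissibleKernel a) {α : ℝ}
    {F : ℂ → ℂ} (hα : 0 < α) (hF : IsLaplaceExtension a α F)
    (hne : ¬ a =ᵐ[volume.restrict (Ioi (0 : ℝ))] 0)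
    (hpos : ∀ ω : ℝ, 0 ≤ (F (-(α : ℂ) + Complex.I * (ω : ℂ))).re) :
    ∃ ε : ℝ, 0 < ε ∧ ∀ μ : ℝ, 0 ≤ μ → ∀ z : ℝ → ℝ, IsScalarSolution 0 a μ z →
      ∀ t : ℝ, 0 ≤ t → |z t| ≤ 2 * Real.exp (-(ε * min μ 1 * t)) := by
  obtain ⟨c, hc, hstrict⟩ := hF.exists_lowpass_dissipation_le ha hα hne hpos
  set C := 1 + (1 + 1 / α) / (α / 2) with hC
  have hC0 : 0 < C := by positivity
  -- The total multiple of Q in the bound for β∫w²: (2 + α)/c through A ≤ Q/c, and C from the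
  -- low-pass pairing. Taking ε ≤ 1/D keeps it below μQ.
  set D := (2 + α) / c + C with hD
  have hD0 : 0 < D := by positivity
  have hε0 : 0 < min (min (α / 2) 1) (1 / D) :=
    lt_min (lt_min (by linarith) one_pos) (by positivity)
  refine ⟨_, hε0, fun μ hμ z hz t ht => ?_⟩
  set ε := min (min (α / 2) 1) (1 / D)
  have hε1 : ε ≤ α / 2 := (min_le_left _ _).trans (min_le_left _ _)
  have hε2 : ε ≤ 1 := (min_le_left _ _).trans (min_le_right _ _)
  have hε3 : ε * D ≤ 1 := (le_div_iff₀ hD0).1 (min_le_right _ _)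
  set β := ε * min μ 1
  have hβ0 : 0 ≤ β := mul_nonneg hε0.le (le_min hμ zero_le_one)
  have hβε : β ≤ ε := mul_le_of_le_one_right hε0.le (min_le_right _ _)
  have hβμ : β ≤ ε * μ := mul_le_mul_of_nonneg_left (min_le_left _ _) hε0.le
  obtain ⟨w, hw, hwz⟩ := hz.exists_shifted β
  have hwc := hw.continuous
  have hk := ha.integrableOn_exp_mul_Icc β t
  have hκ : 0 < α - β := by linarith
  have e1 := hw.energy ht hk
  have e2 := hw.lowpass_energy (κ := α - β) ht hk
  have e3 := hstrict β t (by linarith) ht w hwc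
  have e4 := hF.lowpass_pairing_le ha hα hpos (β := β) (by linarith) ht hwc
  rw [← hC] at e4
  have e5 : cosFilter (α - β) 0 w t ^ 2 ≤
      2 * ∫ s in (0 : ℝ)..t, w s * cosFilter (α - β) 0 w s := by
    rw [integral_mul_lowpass hwc]
    have : 0 ≤ ∫ s in (0 : ℝ)..t, cosFilter (α - β) 0 w s ^ 2 :=
      intervalIntegral.integral_nonneg ht fun _ _ => sq_nonneg _
    have := mul_nonneg hκ.le this
    linarith
  have hA : 0 ≤ ∫ s in (0 : ℝ)..t, w s * cosFilter (α - β) 0 w s :=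
    integral_mul_cosFilter_nonneg hκ.le ht hwc
  generalize (∫ s in (0 : ℝ)..t, w s * cosFilter (α - β) 0 w s) = A at *
  generalize (∫ s in (0 : ℝ)..t, w s * w s) = I at *
  generalize (∫ s in (0 : ℝ)..t, w s *
    causalConv (fun r => Real.exp (β * r) * a r) w s) = Q at *
  generalize (∫ s in (0 : ℝ)..t, cosFilter (α - β) 0 w s *
    causalConv (fun r => Real.exp (β * r) * a r) w s) = P at *
  generalize cosFilter (α - β) 0 w t = Y at *
  refine abs_le_of_shifted (hwz t ht) ?_
  have hQ : 0 ≤ Q := (mul_nonneg hc.le hA).trans e3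
  have hAQ : A ≤ Q / c := by rw [le_div_iff₀ hc]; linarith
  have f1 : Y * w t ≤ w t ^ 2 / 4 + Y ^ 2 := by nlinarith [sq_nonneg (w t / 2 - Y)]
  -- Solve the low-pass identity for I, using Y² ≤ 2A. The remaining coefficient of A is κ − β = α −
  -- 2β ≤ α.
  have f2 : I ≤ w t ^ 2 / 4 + (2 + α) * A + μ * (C * Q) := by
    have := mul_nonneg hβ0 hA
    have := mul_le_mul_of_nonneg_left e4 hμ
    nlinarith
  have f3 : β * I ≤ w t ^ 2 / 4 + μ * Q := by
    have g1 : β * (w t ^ 2 / 4) ≤ 1 * (w t ^ 2 / 4) :=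
      mul_le_mul_of_nonneg_right (by linarith) (by positivity)
    have g2 : β * ((2 + α) * A) ≤ (ε * μ) * ((2 + α) * (Q / c)) := by gcongr
    have g3 : β * (μ * (C * Q)) ≤ ε * (μ * (C * Q)) :=
      mul_le_mul_of_nonneg_right hβε (by positivity)
    have g4 : (ε * μ) * ((2 + α) * (Q / c)) + ε * (μ * (C * Q)) = (ε * D) * (μ * Q) := by
      rw [hD]; ring
    have g5 : (ε * D) * (μ * Q) ≤ 1 * (μ * Q) :=
      mul_le_mul_of_nonneg_right hε3 (mul_nonneg hμ hQ)
    have g6 := mul_le_mul_of_nonneg_left f2 hβ0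
    linarith
  -- In the energy identity the terms 2μQ cancel, leaving w² ≤ 1 + w²/2. This is the one case of
  -- part 2 whose bound on w is not 1.
  have f4 : w t ^ 2 ≤ 2 ^ 2 := by nlinarith
  exact abs_le_of_sq_le_sq f4 two_pos.le

theorem lemmaA1 (a₀ : ℝ) (ha₀ : 0 ≤ a₀) (a : ℝ → ℝ) (ha : IsAdmissibleKernel a) :
    -- Part 1: the boundary limit is taken in the extended reals, so that `+∞` is allowed.
    ((∀ ω : ℝ, ∃ L : EReal, 0 ≤ L ∧
        Tendsto (fun h : ℝ =>
            ((a₀ + (laplaceTransform a ((h : ℂ) + Complex.I * (ω : ℂ))).re : ℝ) : EReal))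
          (𝓝[>] (0 : ℝ)) (𝓝 L)) →
      ∀ μ : ℝ, 0 ≤ μ → ∀ z : ℝ → ℝ, IsScalarSolution a₀ a μ z →
        ∀ t : ℝ, 0 ≤ t → |z t| ≤ 1) ∧
    -- Part 2: the constant `ε` depends neither on `μ` nor on `t`.
    (∀ (α : ℝ) (F : ℂ → ℂ), 0 < α → IsLaplaceExtension a α F →
      ¬ (a₀ = 0 ∧ a =ᵐ[volume.restrict (Ioi (0 : ℝ))] 0) →
      ((0 < a₀ ∧ ∃ c : ℝ, 0 < c ∧ ∀ ω : ℝ, c ≤ a₀ + (F (Complex.I * (ω : ℂ))).re) ∨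
        (∀ ω : ℝ, 0 ≤ (F (-(α : ℂ) + Complex.I * (ω : ℂ))).re)) →
      ∃ ε : ℝ, 0 < ε ∧ ∀ μ : ℝ, 0 ≤ μ → ∀ z : ℝ → ℝ, IsScalarSolution a₀ a μ z →
        ∀ t : ℝ, 0 ≤ t → |z t| ≤ 2 * Real.exp (-(ε * min μ 1 * t))) := by
  refine ⟨fun hlim μ hμ z hz t ht => abs_le_one_of_abel_limit ha hlim hμ hz ht,
    fun α F hα hF hne hcase => ?_⟩
  rcases hcase with ⟨-, c, hc, hpos⟩ | hpos
  · exact exists_decay_of_uniform_positive ha hα hF hc hpos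
  · rcases ha₀.eq_or_lt with rfl | h0
    · exact exists_decay_of_zero ha hα hF (fun h => hne ⟨rfl, h⟩) hpos
    · exact exists_decay_of_pos ha h0 hα hF hpos
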